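/- Let $G$ be a finite simple graph. A tree decomposition of $G$ is a pair $\mathcal T=(T,\{X_t\}_{t\in V(T)})$ where $T$ is a finite tree and $X_t\subseteq V(G)$ for every node $t$, such that every vertex of $G$ lies in some bag $X_t$, every edge of $G$ has both ends in some bag, and for every $v\in V(G)$ the set $\{t: v\in X_t\}$ induces a connected (nonempty) subgraph of $T$. Its independence number is $\max_{t}\alpha(G[X_t])$. Given a family $\mathcal H=\{H_j\}_{j\in J}$ of connected non-null subgraphs of $G$, with $J$ finite, a distance-$d$ $\mathcal H$-packing is a subfamily $\{H_i\}_{i\in I}$, $I\subseteq J$, such that $\mathrm{dist}_G(V(H_i),V(H_j))\ge d$ for all distinct $i,j\in I$, where $\mathrm{dist}_G(A,B)$ is the minimum distance in $G$ between a vertex of $A$ and a vertex of $B$ (and $\infty$ if there is no path between them). Given weights $\mathfrak w:J\to\mathbb Q_{\ge 0}$, the Maximum Weight Distance-$d$ Packing problem asks for a distance-$d$ $\mathcal H$-packing maximizing $\sum_{i\in I}\mathfrak w_i$. Theorem. For every even positive integer $d$ and every integer $k\ge 1$ there is an algorithm that, given a finite graph $G$, a tree decomposition $\mathcal T=(T,\{X_t\}_{t\in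 V(T)})$ of $G$ with independence number at most $k$, a finite family $\mathcal H=\{H_j\}_{j\in J}$ of connected non-null subgraphs of $G$, and a weight function $\mathfrak w:J\to\mathbb Q_{\ge 0}$, solves the Maximum Weight Distance-$d$ Packing problem in time $$\mathcal O\Big(1+(|V(G)|+|V(T)|)\cdot|E(G)| + |J|\cdot|V(G)|\cdot\big((|J|+|V(T)|+|V(G)|)+|J|^{k+1}\cdot|V(T)|\big)\Big),$$ where the constant in $\mathcal O$ depends only on $d$ and $k$. Here an algorithm is a program for a random access machine with arrays of natural numbers and of rational numbers, in which memory access (with indirect addressing), addition, subtraction and comparison each take one step, and which has no multiplication or division. Graphs are given by lists of edges, and bags and subgraphs by lists of their vertices and edges. -/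

import Mathlib

open scoped NNRat

/-! ## Tree decompositions and their independence number -/

/-- A tree decomposition of the graph `G`, with nodes in `ι`: a tree `tree` on `ι` and a bag of
vertices of `G` for every node. -/
structure TreeDecomposition {V : Type*} (G : SimpleGraph V) (ι : Type*) where
  tree : SimpleGraph ι
  bag : ι → Finset V
  isTree : tree.IsTree
  vertex_mem : ∀ v : V, ∃ t : ι, v ∈ bag t
  edge_mem : ∀ u v : V, G.Adj u v → ∃ t : ι, u ∈ bag t ∧ v ∈ bag t
  connected : ∀ v : V, (tree.induce {t : ι | v ∈ bag t}).Connected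

/-- The independence number of a tree decomposition: the maximum, over the nodes `t`, of the
independence number of the subgraph of `G` induced by the bag of `t`. -/
noncomputable def TreeDecomposition.indepNumber {V ι : Type*} [Fintype ι] {G : SimpleGraph V}
    (D : TreeDecomposition G ι) : ℕ :=
  Finset.univ.sup fun t : ι => (G.induce (D.bag t : Set V)).indepNum

/-! ## Distance-`d` packings -/

/-- The distance in `G` between two sets of vertices: the minimum of the distances between a
vertex of the first and a vertex of the second (`⊤` if no path joins them). -/
noncomputable def setDist {V : Type*} (G : SimpleGraph V) (A B : Set V) : ℕ∞ :=
  ⨅ u ∈ A, ⨅ v ∈ B, G.edist u v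

/-- The subfamily of `H` with index set `I` is a distance-`d` packing: its members are at pairwise
distance at least `d` in `G`. -/
def IsDistPacking {V J : Type*} {G : SimpleGraph V} (d : ℕ) (H : J → G.Subgraph)
    (I : Finset J) : Prop :=
  ∀ i ∈ I, ∀ j ∈ I, i ≠ j → (d : ℕ∞) ≤ setDist G (H i).verts (H j).verts

/-- `I` is a distance-`d` packing whose weight is maximum among all distance-`d` packings. -/
def IsMaxWeightDistPacking {V J : Type*} {G : SimpleGraph V} (d : ℕ) (H : J → G.Subgraph)
    (w : J → ℚ≥0) (I : Finset J) : Prop :=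
  IsDistPacking d H I ∧
    ∀ I' : Finset J, IsDistPacking d H I' → ∑ i ∈ I', w i ≤ ∑ i ∈ I, w i

/-! ## Random access machine programs

The machine has arrays of natural numbers and arrays of rational numbers, with random access
(indirect addressing). A program names finitely many arrays. Memory access, addition, subtraction
and comparison take one step each; there is no multiplication or division, and rational numbers
cannot be used as addresses or be converted to natural numbers. -/

namespace RAM

/-- The memory: cell `i` of the `a`-th array of natural numbers is `nat a i`, and cell `i` of the
`a`-th array of rational numbers is `rat a i`. -/
structure State where
  nat : ℕ → ℕ → ℕ
  rat : ℕ → ℕ → ℚ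

/-- Expressions with natural number values; `get a i` reads cell `i` of array `a`, and subtraction
is truncated. -/
inductive NatExpr where
  | const (c : ℕ)
  | get (a : ℕ) (i : NatExpr)
  | add (x y : NatExpr)
  | sub (x y : NatExpr)

/-- Expressions with rational values. -/
inductive RatExpr where
  | const (c : ℚ)
  | get (a : ℕ) (i : NatExpr)
  | add (x y : RatExpr)
  | sub (x y : RatExpr)

/-- Tests. -/
inductive Test where
  | natLe (x y : NatExpr)
  | natEq (x y : NatExpr)
  | ratLe (x y : RatExpr)
  | not (b : Test)
  | and (b c : Test)

/-- Programs. `setNat a i x` writes the value of `x` into cell `i` of the `a`-th array of natural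
numbers, and `setRat a i x` does so for the arrays of rational numbers. -/
inductive Program where
  | skip
  | setNat (a : ℕ) (i x : NatExpr)
  | setRat (a : ℕ) (i : NatExpr) (x : RatExpr)
  | seq (p q : Program)
  | branch (b : Test) (p q : Program)
  | loop (b : Test) (p : Program)

def NatExpr.eval (s : State) : NatExpr → ℕ
  | const c => c
  | get a i => s.nat a (i.eval s)
  | add x y => x.eval s + y.eval s
  | sub x y => x.eval s - y.eval s

def RatExpr.eval (s : State) : RatExpr → ℚ
  | const c => c
  | get a i => s.rat a (i.eval s)
  | add x y => x.eval s + y.eval s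
  | sub x y => x.eval s - y.eval s

def Test.eval (s : State) : Test → Prop
  | natLe x y => x.eval s ≤ y.eval s
  | natEq x y => x.eval s = y.eval s
  | ratLe x y => x.eval s ≤ y.eval s
  | not b => ¬ b.eval s
  | and b c => b.eval s ∧ c.eval s

/-- The number of steps to evaluate an expression: one for every operation in it. -/
def NatExpr.cost : NatExpr → ℕ
  | const _ => 1
  | get _ i => i.cost + 1
  | add x y => x.cost + y.cost + 1
  | sub x y => x.cost + y.cost + 1

def RatExpr.cost : RatExpr → ℕ
  | const _ => 1
  | get _ i => i.cost + 1
  | add x y => x.cost + y.cost + 1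
  | sub x y => x.cost + y.cost + 1

def Test.cost : Test → ℕ
  | natLe x y => x.cost + y.cost + 1
  | natEq x y => x.cost + y.cost + 1
  | ratLe x y => x.cost + y.cost + 1
  | not b => b.cost + 1
  | and b c => b.cost + c.cost + 1

def State.writeNat (s : State) (a i x : ℕ) : State :=
  { s with nat := Function.update s.nat a (Function.update (s.nat a) i x) }

def State.writeRat (s : State) (a i : ℕ) (x : ℚ) : State :=
  { s with rat := Function.update s.rat a (Function.update (s.rat a) i x) }

/-- `Runs p s t s'`: started in the memory state `s`, the program `p` halts after exactly `t` steps,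
in the memory state `s'`. -/
inductive Runs : Program → State → ℕ → State → Prop where
  | skip (s : State) : Runs .skip s 1 s
  | setNat (s : State) (a : ℕ) (i x : NatExpr) :
      Runs (.setNat a i x) s (i.cost + x.cost + 1) (s.writeNat a (i.eval s) (x.eval s))
  | setRat (s : State) (a : ℕ) (i : NatExpr) (x : RatExpr) :
      Runs (.setRat a i x) s (i.cost + x.cost + 1) (s.writeRat a (i.eval s) (x.eval s))
  | seq {p q : Program} {s s₁ s₂ : State} {t₁ t₂ : ℕ} :
      Runs p s t₁ s₁ → Runs q s₁ t₂ s₂ → Runs (.seq p q) s (t₁ + t₂) s₂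
  | branch_true {b : Test} {p q : Program} {s s₁ : State} {t : ℕ} :
      b.eval s → Runs p s t s₁ → Runs (.branch b p q) s (b.cost + t + 1) s₁
  | branch_false {b : Test} {p q : Program} {s s₁ : State} {t : ℕ} :
      ¬ b.eval s → Runs q s t s₁ → Runs (.branch b p q) s (b.cost + t + 1) s₁
  | loop_done {b : Test} {p : Program} {s : State} :
      ¬ b.eval s → Runs (.loop b p) s (b.cost + 1) s
  | loop_step {b : Test} {p : Program} {s s₁ s₂ : State} {t₁ t₂ : ℕ} :
      b.eval s → Runs p s t₁ s₁ → Runs (.loop b p) s₁ t₂ s₂ →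
        Runs (.loop b p) s (b.cost + t₁ + t₂ + 1) s₂

end RAM

/-! ## Inputs and outputs -/

/-- `l` lists every element of `S` exactly once. -/
def ListsVertices {V : Type*} (S : Set V) (l : List V) : Prop :=
  l.Nodup ∧ ∀ v : V, v ∈ l ↔ v ∈ S

/-- `l` lists every edge in `E` exactly once, by its two ends in one of the two orders. -/
def ListsEdges {V : Type*} (E : Set (Sym2 V)) (l : List (V × V)) : Prop :=
  (l.map fun e => s(e.1, e.2)).Nodup ∧ ∀ e : Sym2 V, e ∈ l.map (fun e => s(e.1, e.2)) ↔ e ∈ E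

/-- A description by lists, in any order, of a graph `G` with vertices `0, …, n - 1`, a tree
decomposition `D` of `G` with nodes `0, …, q - 1`, and a family `H` of `p` subgraphs of `G`. -/
structure InputLists {n q p : ℕ} {G : SimpleGraph (Fin n)} (D : TreeDecomposition G (Fin q))
    (H : Fin p → G.Subgraph) where
  edges : List (Fin n × Fin n)
  treeEdges : List (Fin q × Fin q)
  bags : Fin q → List (Fin n)
  subVerts : Fin p → List (Fin n)
  subEdges : Fin p → List (Fin n × Fin n)
  edges_spec : ListsEdges G.edgeSet edges
  treeEdges_spec : ListsEdges D.tree.edgeSet treeEdges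
  bags_spec : ∀ t, ListsVertices (D.bag t : Set (Fin n)) (bags t)
  subVerts_spec : ∀ j, ListsVertices (H j).verts (subVerts j)
  subEdges_spec : ∀ j, ListsEdges (H j).edgeSet (subEdges j)

/-- A list of vertices as a sequence of numbers: its length, then its entries. -/
def encodeVertices {n : ℕ} (l : List (Fin n)) : List ℕ :=
  l.length :: l.map fun v => (v : ℕ)

/-- A list of edges as a sequence of numbers: its length, then the two ends of every entry. -/
def encodeEdges {n : ℕ} (l : List (Fin n × Fin n)) : List ℕ :=
  l.length :: l.flatMap fun e => [(e.1 : ℕ), (e.2 : ℕ)]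

/-- The input as one sequence of numbers: the three sizes, the edges of `G`, the edges of the tree,
the bags, and then the vertices and the edges of every subgraph of the family. -/
def InputLists.encode {n q p : ℕ} {G : SimpleGraph (Fin n)} {D : TreeDecomposition G (Fin q)}
    {H : Fin p → G.Subgraph} (x : InputLists D H) : List ℕ :=
  [n, q, p] ++ encodeEdges x.edges ++ encodeEdges x.treeEdges ++
    (List.finRange q).flatMap (fun t => encodeVertices (x.bags t)) ++
    (List.finRange p).flatMap
      (fun j => encodeVertices (x.subVerts j) ++ encodeEdges (x.subEdges j))

/-- The initial memory: array `0` of natural numbers holds the encoded input, array `0` of rational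
numbers holds the weights, and every other cell is `0`. -/
def InputLists.initialState {n q p : ℕ} {G : SimpleGraph (Fin n)}
    {D : TreeDecomposition G (Fin q)} {H : Fin p → G.Subgraph} (x : InputLists D H)
    (w : Fin p → ℚ≥0) : RAM.State where
  nat a i := if a = 0 then x.encode.getD i 0 else 0
  rat a i := if h : a = 0 ∧ i < p then (w ⟨i, h.2⟩ : ℚ) else 0

/-- The output, a set of indices, is read off array `1` of natural numbers as an indicator vector. -/
def RAM.State.output (s : RAM.State) (p : ℕ) : Finset (Fin p) :=
  Finset.univ.filter fun j => s.nat 1 j = 1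

/-!
Write `d = 2 * r + 2`, and let `Meets r D H t j` say that bag `t` contains a vertex within distance
`r` of `H j`. For the fixed `j`, the nodes with this property form a connected set in the tree,
since `H j` is connected and so is the ball of radius `r` around it (`reflTransGen_meets`). Two
members at distance less than `d` are joined by a path of at most `2 * r + 1` edges, whose two
middle vertices are equal or adjacent and hence lie in one bag; so members in conflict meet a
common bag (`exists_middle`; this is where `d` is even). Conversely, choose for every member of a
packing that meets bag `t` a vertex of the bag within distance `r` of it. The chosen vertices are
distinct and pairwise nonadjacent, so there are at most `k` of them (`card_le_of_meets`). Thus the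
sets `{j | Meets r D H t j}` are a tree decomposition of the conflict graph in which every
independent subset of a bag has at most `k` elements (`IsLeafOrder.eliminationScheme`), and the
problem is to find an independent set of maximum weight in this graph.

This is done by dynamic programming. A choice in a bag is a set of at most `k` members, coded as a
`k`-digit number in base `p + 1`; there are at most `2 ^ k * p ^ k` such codes. The nodes of the
tree are eliminated leaf by leaf. When node `u` with parent `v` is eliminated, the best value for
every choice in `u`, plus the weight of the chosen members that do not meet bag `v`, is maximized
over all choices with the same restriction to `v` and added to the table of `v`
(`EliminationScheme.tablesExact_succ`). This takes a number of steps proportional to the number of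
codes, as the restriction of a code and the other data about it are computed from those of the code
without its last digit. An extra node with empty bag, the parent of the root, finally holds the
largest weight (`EliminationScheme.isMaxWeight`). A packing of this weight is found by running the
dynamic program once more for every member, with the weight of this member replaced by zero: the
member is dropped if the largest weight stays the same, and every optimal packing for the remaining
weights contains all members that are not dropped (`SelectionInvariant.final`). In total there are
`p + 1` runs, each with `O(q * p ^ k)` steps, which `p * n * p ^ (k + 1) * q` pays for.

The distances from every member to all bags and members, up to `d`, are found beforehand by
relaxing all edges `d` times and taking minima over the lists of vertices, with
`O(p * (n ^ 2 + (p + q) * n))` steps in total.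

The machine cannot multiply, so products, quotients and remainders are tabulated by repeated
addition. Programs are verified with triples `Halts P s T Q` for total correctness with a time
bound; a frame rule based on the arrays that occur in a program keeps track of the memory that it
does not change.
-/

namespace RAM

/-! ### Reasoning about programs -/

/-- Started in `s`, the program `P` halts within `T` steps in a state that satisfies `Q`. -/
def Halts (P : Program) (s : State) (T : ℕ) (Q : State → Prop) : Prop :=
  ∃ t s', Runs P s t s' ∧ t ≤ T ∧ Q s'

/-- The arrays of natural numbers that a program may write. -/
def Program.natWrites : Program → List ℕ
  | .skip => []
  | .setNat a _ _ => [a]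
  | .setRat _ _ _ => []
  | .seq p q => p.natWrites ++ q.natWrites
  | .branch _ p q => p.natWrites ++ q.natWrites
  | .loop _ p => p.natWrites

/-- The arrays of rational numbers that a program may write. -/
def Program.ratWrites : Program → List ℕ
  | .skip => []
  | .setNat _ _ _ => []
  | .setRat a _ _ => [a]
  | .seq p q => p.ratWrites ++ q.ratWrites
  | .branch _ p q => p.ratWrites ++ q.ratWrites
  | .loop _ p => p.ratWrites

/-- `s` and `s'` agree on all arrays that the program `P` does not write. -/
structure Frame (P : Program) (s s' : State) : Prop where
  nat : ∀ a, a ∉ P.natWrites → s'.nat a = s.nat a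
  rat : ∀ a, a ∉ P.ratWrites → s'.rat a = s.rat a

theorem State.writeNat_nat_self (s : State) (a i x : ℕ) :
    (s.writeNat a i x).nat a = Function.update (s.nat a) i x := by
  simp [State.writeNat]

theorem State.writeNat_nat_of_ne (s : State) {a b : ℕ} (i x : ℕ) (h : b ≠ a) :
    (s.writeNat a i x).nat b = s.nat b := by
  simp [State.writeNat, h]

theorem State.writeNat_rat (s : State) (a i x : ℕ) : (s.writeNat a i x).rat = s.rat := rfl

theorem State.writeRat_rat_self (s : State) (a i : ℕ) (x : ℚ) :
    (s.writeRat a i x).rat a = Function.update (s.rat a) i x := by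
  simp [State.writeRat]

theorem State.writeRat_rat_of_ne (s : State) {a b : ℕ} (i : ℕ) (x : ℚ) (h : b ≠ a) :
    (s.writeRat a i x).rat b = s.rat b := by
  simp [State.writeRat, h]

theorem State.writeRat_nat (s : State) (a i : ℕ) (x : ℚ) : (s.writeRat a i x).nat = s.nat := rfl

theorem Frame.refl (P : Program) (s : State) : Frame P s s := ⟨fun _ _ => rfl, fun _ _ => rfl⟩

theorem Frame.trans {P : Program} {s₁ s₂ s₃ : State} (h : Frame P s₁ s₂) (h' : Frame P s₂ s₃) :
    Frame P s₁ s₃ :=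
  ⟨fun a ha => (h'.nat a ha).trans (h.nat a ha), fun a ha => (h'.rat a ha).trans (h.rat a ha)⟩

theorem Frame.mono {P P' : Program} {s s' : State} (h : Frame P s s')
    (hn : P.natWrites ⊆ P'.natWrites) (hr : P.ratWrites ⊆ P'.ratWrites) : Frame P' s s' :=
  ⟨fun a ha => h.nat a fun h' => ha (hn h'), fun a ha => h.rat a fun h' => ha (hr h')⟩

theorem Runs.frame {P : Program} {s s' : State} {t : ℕ} (h : Runs P s t s') : Frame P s s' := by
  induction h with
  | skip s => exact Frame.refl _ _
  | setNat s a i x =>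
    refine ⟨fun b hb => State.writeNat_nat_of_ne _ _ _ ?_, fun _ _ => rfl⟩
    simpa [Program.natWrites] using hb
  | setRat s a i x =>
    refine ⟨fun _ _ => rfl, fun b hb => State.writeRat_rat_of_ne _ _ _ ?_⟩
    simpa [Program.ratWrites] using hb
  | seq _ _ h₁ h₂ =>
    exact (h₁.mono (by simp [Program.natWrites]) (by simp [Program.ratWrites])).trans
      (h₂.mono (by simp [Program.natWrites]) (by simp [Program.ratWrites]))
  | branch_true _ _ h => exact h.mono (by simp [Program.natWrites]) (by simp [Program.ratWrites])
  | branch_false _ _ h => exact h.mono (by simp [Program.natWrites]) (by simp [Program.ratWrites])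
  | loop_done _ => exact Frame.refl _ _
  | loop_step _ _ _ h₁ h₂ =>
    exact (h₁.mono (by simp [Program.natWrites]) (by simp [Program.ratWrites])).trans h₂

/-- The rule of consequence. It comes with a frame rule, as the final state agrees with the
initial one on all arrays that `P` does not write. -/
theorem Halts.mono {P : Program} {s : State} {T T' : ℕ} {Q Q' : State → Prop}
    (h : Halts P s T Q) (hT : T ≤ T') (hQ : ∀ s', Frame P s s' → Q s' → Q' s') :
    Halts P s T' Q' := by
  obtain ⟨t, s', hr, ht, hq⟩ := h
  exact ⟨t, s', hr, ht.trans hT, hQ _ hr.frame hq⟩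

theorem Halts.seq {P P' : Program} {s : State} {T T' : ℕ} {Q Q' : State → Prop}
    (h : Halts P s T Q) (h' : ∀ s', Frame P s s' → Q s' → Halts P' s' T' Q') :
    Halts (.seq P P') s (T + T') Q' := by
  obtain ⟨t, s₁, hr, ht, hq⟩ := h
  obtain ⟨t', s₂, hr', ht', hq'⟩ := h' s₁ hr.frame hq
  exact ⟨t + t', s₂, hr.seq hr', by omega, hq'⟩

theorem Halts.branch {b : Test} {P P' : Program} {s : State} {T : ℕ} {Q : State → Prop}
    (h : b.eval s → Halts P s T Q) (h' : ¬ b.eval s → Halts P' s T Q) :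
    Halts (.branch b P P') s (b.cost + T + 1) Q := by
  by_cases hb : b.eval s
  · obtain ⟨t, s₁, hr, ht, hq⟩ := h hb
    exact ⟨_, s₁, .branch_true hb hr, by omega, hq⟩
  · obtain ⟨t, s₁, hr, ht, hq⟩ := h' hb
    exact ⟨_, s₁, .branch_false hb hr, by omega, hq⟩

/-- Programs without loops. -/
def Program.loopFree : Program → Bool
  | .seq p q => p.loopFree && q.loopFree
  | .branch _ p q => p.loopFree && q.loopFree
  | .loop _ _ => false
  | _ => true

/-- A bound for the running time of a program without loops. -/
def Program.cost : Program → ℕ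
  | .skip => 1
  | .setNat _ i x => i.cost + x.cost + 1
  | .setRat _ i x => i.cost + x.cost + 1
  | .seq p q => p.cost + q.cost
  | .branch b p q => b.cost + max p.cost q.cost + 1
  | .loop _ _ => 0

open Classical in
/-- The effect of a program without loops. -/
noncomputable def Program.exec : Program → State → State
  | .skip, s => s
  | .setNat a i x, s => s.writeNat a (i.eval s) (x.eval s)
  | .setRat a i x, s => s.writeRat a (i.eval s) (x.eval s)
  | .seq p q, s => q.exec (p.exec s)
  | .branch b p q, s => if b.eval s then p.exec s else q.exec s
  | .loop _ _, s => s

theorem Program.exists_runs_exec {P : Program} (h : P.loopFree = true) (s : State) :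
    ∃ t, Runs P s t (P.exec s) ∧ t ≤ P.cost := by
  induction P generalizing s with
  | skip => exact ⟨_, .skip s, le_rfl⟩
  | setNat a i x => exact ⟨_, .setNat s a i x, le_rfl⟩
  | setRat a i x => exact ⟨_, .setRat s a i x, le_rfl⟩
  | seq p q hp hq =>
    simp only [Program.loopFree, Bool.and_eq_true] at h
    obtain ⟨t, ht, ht'⟩ := hp h.1 s
    obtain ⟨t', hu, hu'⟩ := hq h.2 (p.exec s)
    exact ⟨_, ht.seq hu, by simp only [Program.cost]; omega⟩
  | branch b p q hp hq =>
    simp only [Program.loopFree, Bool.and_eq_true] at h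
    by_cases hb : b.eval s
    · obtain ⟨t, ht, ht'⟩ := hp h.1 s
      refine ⟨b.cost + t + 1, ?_, by simp only [Program.cost]; omega⟩
      simpa [Program.exec, hb] using Runs.branch_true (q := q) hb ht
    · obtain ⟨t, ht, ht'⟩ := hq h.2 s
      refine ⟨b.cost + t + 1, ?_, by simp only [Program.cost]; omega⟩
      simpa [Program.exec, hb] using Runs.branch_false (p := p) hb ht
  | loop b p _ => simp [Program.loopFree] at h

/-- Programs without loops are verified by evaluating `Program.exec`. -/
theorem Halts.of_loopFree {P : Program} {s : State} {Q : State → Prop}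
    (h : P.loopFree = true) (hQ : Q (P.exec s)) : Halts P s P.cost Q := by
  obtain ⟨t, ht, ht'⟩ := Program.exists_runs_exec h s
  exact ⟨t, _, ht, ht', hQ⟩

theorem Halts.exec_seq {P P' : Program} {s : State} {T : ℕ} {Q : State → Prop}
    (h : P.loopFree = true) (h' : Halts P' (P.exec s) T Q) :
    Halts (.seq P P') s (P.cost + T) Q :=
  (Halts.of_loopFree (Q := fun s' => s' = P.exec s) h rfl).seq
    fun _ _ hs => by subst hs; exact h'

/-- Cell `e` of array `a`. -/
abbrev rd (a : ℕ) (e : NatExpr) : NatExpr := .get a e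

/-- Numerical variables are kept in cell `0` of an array of their own. -/
abbrev var (a : ℕ) : NatExpr := .get a (.const 0)

/-! Expressions of the machine are written with the usual symbols. -/

instance : Add NatExpr := ⟨.add⟩
instance : Sub NatExpr := ⟨.sub⟩
instance (c : ℕ) : OfNat NatExpr c := ⟨.const c⟩

@[simp] theorem NatExpr.eval_add' (s : State) (x y : NatExpr) :
    (x + y).eval s = x.eval s + y.eval s := rfl
@[simp] theorem NatExpr.eval_sub' (s : State) (x y : NatExpr) :
    (x - y).eval s = x.eval s - y.eval s := rfl
@[simp] theorem NatExpr.eval_ofNat' (s : State) (c : ℕ) :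
    (OfNat.ofNat c : NatExpr).eval s = c := rfl
@[simp] theorem NatExpr.eval_zero' (s : State) : (0 : NatExpr).eval s = 0 := rfl
@[simp] theorem NatExpr.eval_one' (s : State) : (1 : NatExpr).eval s = 1 := rfl

@[simp] theorem NatExpr.cost_add' (x y : NatExpr) : (x + y).cost = x.cost + y.cost + 1 := rfl
@[simp] theorem NatExpr.cost_sub' (x y : NatExpr) : (x - y).cost = x.cost + y.cost + 1 := rfl
@[simp] theorem NatExpr.cost_ofNat' (c : ℕ) : (OfNat.ofNat c : NatExpr).cost = 1 := rfl
@[simp] theorem NatExpr.cost_zero' : (0 : NatExpr).cost = 1 := rfl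
@[simp] theorem NatExpr.cost_one' : (1 : NatExpr).cost = 1 := rfl

/-- Assignment to a numerical variable. -/
abbrev setVar (a : ℕ) (x : NatExpr) : Program := .setNat a (.const 0) x

/-- `for i := 0, …, N - 1 do body`. -/
def forLoop (i : ℕ) (N : NatExpr) (body : Program) : Program :=
  .seq (setVar i 0) (.loop (.natLe (var i + 1) N) (.seq body (setVar i (var i + 1))))

theorem natWrites_forLoop (i : ℕ) (N : NatExpr) (body : Program) :
    (forLoop i N body).natWrites = i :: (body.natWrites ++ [i]) := rfl

theorem ratWrites_forLoop (i : ℕ) (N : NatExpr) (body : Program) :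
    (forLoop i N body).ratWrites = body.ratWrites := by
  simp [forLoop, Program.ratWrites]

/-- The rule for counting loops: `Inv m` holds when the loop variable has been set to `m`. -/
theorem Halts.forLoop {i : ℕ} {N : NatExpr} {body : Program} {s₀ : State} {c : ℕ}
    (n : ℕ) (Inv : ℕ → State → Prop) (hi : i ∉ body.natWrites)
    (hN : ∀ s, Frame (forLoop i N body) s₀ s → N.eval s = n)
    (h₀ : Inv 0 (s₀.writeNat i 0 0))
    (hbody : ∀ m < n, ∀ s, Frame (forLoop i N body) s₀ s → s.nat i 0 = m → Inv m s →
      Halts body s c fun s' => Inv (m + 1) (s'.writeNat i 0 (m + 1))) :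
    Halts (forLoop i N body) s₀ ((n + 1) * (c + N.cost + 12)) (Inv n) := by
  -- The state when `r` rounds are left: a round costs `c` for the body, `N.cost + 6` for the test
  -- and `6` for the increment.
  have key : ∀ r m, m + r = n → ∀ s, Frame (RAM.forLoop i N body) s₀ s → s.nat i 0 = m →
      Inv m s → Halts (.loop (.natLe (var i + 1) N) (.seq body (setVar i (var i + 1)))) s
        (r * (c + N.cost + 12) + N.cost + 6) (Inv n) := by
    intro r
    induction r with
    | zero =>
      intro m hm s hf hs hI
      refine ⟨_, s, .loop_done ?_, ?_, ?_⟩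
      · simp [Test.eval, NatExpr.eval, hN s hf, hs]; omega
      · change (4 + N.cost + 1) + 1 ≤ _; omega
      · rwa [← hm, Nat.add_zero]
    | succ r ih =>
      intro m hm s hf hs hI
      obtain ⟨t, s₁, hr, ht, hq⟩ := hbody m (by omega) s hf hs hI
      have hs₁ : s₁.nat i 0 = m := by rw [hr.frame.nat i hi, hs]
      have hr₂ : Runs (setVar i (var i + 1)) s₁ 6 (s₁.writeNat i 0 (m + 1)) := by
        have e : (var i + 1).eval s₁ = m + 1 := by simp [NatExpr.eval, hs₁]
        have := Runs.setNat s₁ i (.const 0) (var i + 1)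
        rw [e] at this
        exact this
      have hf₂ : Frame (RAM.forLoop i N body) s₀ (s₁.writeNat i 0 (m + 1)) := by
        refine (hf.trans ?_).trans (s₂ := s₁) ?_
        · exact hr.frame.mono (by simp [natWrites_forLoop]) (by simp [ratWrites_forLoop])
        · exact hr₂.frame.mono (by simp [natWrites_forLoop, Program.natWrites])
            (by simp [Program.ratWrites])
      obtain ⟨t', s₂, hr', ht', hq'⟩ := ih (m + 1) (by omega) _ hf₂
        (by simp [State.writeNat_nat_self]) hq
      refine ⟨_, s₂, .loop_step ?_ (hr.seq hr₂) hr', ?_, hq'⟩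
      · simp [Test.eval, NatExpr.eval, hN s hf, hs]; omega
      · change (4 + N.cost + 1) + (t + 6) + t' + 1 ≤ _
        rw [Nat.add_mul]; omega
  have h1 : Runs (setVar i 0) s₀ 3 (s₀.writeNat i 0 0) := Runs.setNat s₀ i (.const 0) 0
  obtain ⟨t, s', hr, ht, hq⟩ := key n 0 (by omega) (s₀.writeNat i 0 0)
    (h1.frame.mono (by simp [natWrites_forLoop, Program.natWrites])
      (by simp [Program.ratWrites])) (by simp [State.writeNat_nat_self]) h₀
  exact ⟨_, s', h1.seq hr, by rw [Nat.add_mul]; omega, hq⟩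

attribute [simp] NatExpr.cost RatExpr.cost Test.cost Program.cost NatExpr.eval RatExpr.eval
  Test.eval Program.exec State.writeNat_nat_self
  State.writeNat_nat_of_ne State.writeNat_rat State.writeRat_rat_self State.writeRat_rat_of_ne
  State.writeRat_nat

end RAM

/-! ### Reading the input -/

/-! Names for the arrays of natural numbers. Array `0` holds the input. -/

notation "OUT" => 1
notation "STRIDE" => 20
notation "BASE" => 21
notation "CODES" => 22
notation "POS" => 23
notation "LEN" => 24
notation "ROW" => 25
notation "ACC" => 26
notation "TEDGES" => 27
notation "LIMIT" => 28
notation "RADIUS" => 29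
notation "WIDTH" => 33
notation "IA" => 30
notation "IB" => 31
notation "IC" => 32
notation "MUL" => 40
notation "INC" => 41
notation "LEV" => 42
notation "DIST" => 43
notation "PREF" => 44
notation "LAST" => 45
notation "MULB" => 46
notation "BAD" => 47
notation "MULK" => 48
notation "DEG" => 49
notation "SUM" => 50
notation "QUEUE" => 51
notation "UP" => 52
notation "PROJ" => 53
notation "OUTX" => 54
notation "TAIL" => 55
notation "NODE" => 56
notation "NEXT" => 57

/-- The cells of `a` from `pos` on hold the list `l`. -/
def HoldsAt (a : ℕ → ℕ) (pos : ℕ) (l : List ℕ) : Prop :=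
  ∀ i (h : i < l.length), a (pos + i) = l[i]

theorem holdsAt_append {a : ℕ → ℕ} {pos : ℕ} {l l' : List ℕ} :
    HoldsAt a pos (l ++ l') ↔ HoldsAt a pos l ∧ HoldsAt a (pos + l.length) l' := by
  constructor
  · intro h
    refine ⟨fun i hi => ?_, fun i hi => ?_⟩
    · rw [h i (by simp; omega), List.getElem_append_left hi]
    · rw [Nat.add_assoc, h (l.length + i) (by simp; omega), List.getElem_append_right (by omega)]
      simp
  · rintro ⟨h, h'⟩ i hi
    by_cases hil : i < l.length
    · rw [h i hil, List.getElem_append_left hil]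
    · rw [List.getElem_append_right (by omega), ← h' (i - l.length) (by simp at hi; omega)]
      congr 1; omega

theorem holdsAt_cons {a : ℕ → ℕ} {pos x : ℕ} {l : List ℕ} :
    HoldsAt a pos (x :: l) ↔ a pos = x ∧ HoldsAt a (pos + 1) l := by
  rw [← List.singleton_append, holdsAt_append]
  simp [HoldsAt]

theorem HoldsAt.pairs {a : ℕ → ℕ} {N : ℕ} {l : List (Fin N × Fin N)} {pos : ℕ}
    (h : HoldsAt a pos (l.flatMap fun e => [(e.1 : ℕ), (e.2 : ℕ)])) (i : ℕ) (hi : i < l.length) :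
    a (pos + i + i) = l[i].1 ∧ a (pos + i + i + 1) = l[i].2 := by
  induction l generalizing pos i with
  | nil => simp at hi
  | cons e l ih =>
    simp only [List.flatMap_cons, List.cons_append, List.nil_append, holdsAt_cons] at h
    cases i with
    | zero => simpa using ⟨h.1, h.2.1⟩
    | succ i =>
      have := ih h.2.2 i (by simpa using hi)
      simp only [List.getElem_cons_succ]
      rw [← this.1, ← this.2]
      constructor <;> congr 1 <;> ring

theorem length_flatMap_pair {N : ℕ} (l : List (Fin N × Fin N)) :
    (l.flatMap fun e => [(e.1 : ℕ), (e.2 : ℕ)]).length = l.length + l.length := by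
  induction l with
  | nil => rfl
  | cons e l ih => simp only [List.flatMap_cons, List.length_append, ih, List.length_cons,
      List.length_nil]; omega

/-- Positions in a table with rows of length `N` determine row and column. -/
theorem rowCol_inj {N i i' j j' : ℕ} (hj : j < N) (hj' : j' < N) :
    i * N + j = i' * N + j' ↔ i = i' ∧ j = j' := by
  constructor
  · intro h
    have h1 := congrArg (· / N) h
    have h2 := congrArg (· % N) h
    have hN : 0 < N := by omega
    simp only [Nat.add_comm (_ * N), Nat.add_mul_div_right _ _ hN, Nat.div_eq_of_lt hj,
      Nat.div_eq_of_lt hj', Nat.add_mul_mod_self_right, Nat.mod_eq_of_lt hj,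
      Nat.mod_eq_of_lt hj'] at h1 h2
    omega
  · rintro ⟨rfl, rfl⟩; rfl

namespace RAM

/-- Tables with rows of length `STRIDE` are addressed through an array of multiples of it. -/
def setup : Program :=
  .seq (.seq (setVar STRIDE (rd 0 0 + rd 0 1 + rd 0 2 + 2)) (setVar BASE (rd 0 2 + 1))) <|
  forLoop IA (var STRIDE) (.setNat MUL (var IA + 1) (rd MUL (var IA) + var STRIDE))

theorem halts_setup {s : State} {n q p : ℕ} (hn : s.nat 0 0 = n) (hq : s.nat 0 1 = q)
    (hp : s.nat 0 2 = p) (hM : s.nat MUL 0 = 0) :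
    Halts setup s (40 * (n + q + p + 3)) fun s' =>
      s'.nat STRIDE 0 = n + q + p + 2 ∧ s'.nat BASE 0 = p + 1 ∧
      ∀ x ≤ n + q + p + 2, s'.nat MUL x = x * (n + q + p + 2) := by
  set N := n + q + p + 2 with hN
  refine Halts.mono (Halts.exec_seq rfl ((Halts.forLoop (c := 13) N
    (fun m s' => ∀ x ≤ m, s'.nat MUL x = x * N) (by decide) ?_ ?_ ?_).mono le_rfl
    fun s' hs' hI => ⟨?_, ?_, hI⟩)) (T' := 40 * (n + q + p + 3)) ?_ fun _ _ h => h
  · intro s' hs'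
    simp [hs'.nat STRIDE (by decide), hn, hq, hp, hN]
  · intro x hx
    simp [hM, show x = 0 by omega]
  · intro m hm s' hs' hi hI
    refine (Halts.of_loopFree rfl ?_).mono (by simp) fun _ _ h => h
    intro x hx
    by_cases hxm : x = m + 1
    · simp [hxm, hI m le_rfl, hi, hs'.nat STRIDE (by decide), hn, hq, hp, hN]; ring
    · simp [hxm, hi, hI x (by omega)]
  · simp; omega
  · simp [hs'.nat STRIDE (by decide), hn, hq, hp, hN]
  · simp [hs'.nat BASE (by decide), hp]

/-- Reads a list of columns at position `POS` into the row `ROW` of the incidence table. -/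
def loadRow : Program :=
  .seq (setVar LEN (rd 0 (var POS))) <|
  .seq (forLoop IB (var LEN) (.setNat INC (rd MUL (var ROW) + rd 0 (var POS + 1 + var IB)) 1)) <|
  setVar POS (var POS + 1 + var LEN)

theorem halts_loadRow {s : State} {l : List ℕ} {c : ℕ} (hl : l.length ≤ c)
    (h : HoldsAt (s.nat 0) (s.nat POS 0) (l.length :: l)) :
    Halts loadRow s (40 * (c + 2)) fun s' =>
      s'.nat POS 0 = s.nat POS 0 + 1 + l.length ∧
      ∀ x, s'.nat INC x = 1 ↔
        (∃ v ∈ l, x = s.nat MUL (s.nat ROW 0) + v) ∨ s.nat INC x = 1 := by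
  obtain ⟨hlen, hl'⟩ := holdsAt_cons.1 h
  refine Halts.mono (Halts.exec_seq rfl (Halts.seq (Halts.forLoop (c := 16) l.length
    (fun m s' => ∀ x, s'.nat INC x = 1 ↔
      (∃ v ∈ l.take m, x = s.nat MUL (s.nat ROW 0) + v) ∨ s.nat INC x = 1) (by decide) ?_ ?_ ?_)
    fun s' hs' hI => Halts.of_loopFree rfl ⟨?_, ?_⟩)) (T' := 40 * (c + 2)) ?_ fun _ _ h => h
  · intro s' hs'
    simp [hs'.nat LEN (by decide), hlen]
  · simp
  · intro m hm s' hs' hi hI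
    refine (Halts.of_loopFree rfl ?_).mono (by simp) fun _ _ h => h
    intro x
    have h1 := hl' m hm
    have h2 : (∃ v ∈ l.take (m + 1), x = s.nat MUL (s.nat ROW 0) + v) ↔
        x = s.nat MUL (s.nat ROW 0) + l[m] ∨
        (∃ v ∈ l.take m, x = s.nat MUL (s.nat ROW 0) + v) := by
      rw [List.take_add_one, List.getElem?_eq_getElem hm]
      constructor
      · rintro ⟨v, hv, rfl⟩
        rcases List.mem_append.1 hv with hv | hv
        · exact .inr ⟨v, hv, rfl⟩
        · left; simp_all
      · rintro (rfl | ⟨v, hv, rfl⟩)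
        · exact ⟨_, List.mem_append_right _ (by simp), rfl⟩
        · exact ⟨v, List.mem_append_left _ hv, rfl⟩
    rw [h2]
    simp [hs'.nat MUL (by decide), hs'.nat ROW (by decide), hs'.nat 0 (by decide),
      hs'.nat POS (by decide), hi, h1, Function.update_apply]
    by_cases h3 : x = s.nat MUL (s.nat ROW 0) + l[m] <;> simp [h3, hI]
  · simp; omega
  · simp [hs'.nat LEN (by decide), hs'.nat POS (by decide), hlen]
  · simpa using hI

/-- Reads the lists of the vertices of the bags and of the subgraphs into the incidence table: row
`t` belongs to bag `t`, row `q` stays empty, and row `q + 1 + j` belongs to subgraph `j`. -/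
def loadRows : Program :=
  .seq (.seq (setVar TEDGES (rd 0 3 + rd 0 3 + 5))
    (setVar POS (var TEDGES + rd 0 (var TEDGES - 1) + rd 0 (var TEDGES - 1)))) <|
  .seq (forLoop IA (rd 0 1) (.seq (setVar ROW (var IA)) loadRow)) <|
  forLoop IA (rd 0 2) (.seq (setVar ROW (rd 0 1 + 1 + var IA))
    (.seq loadRow (setVar POS (var POS + 1 + rd 0 (var POS) + rd 0 (var POS)))))

theorem holdsAt_flatMap_range {a : ℕ → ℕ} {pos q : ℕ} {f : ℕ → List ℕ}
    (h : HoldsAt a pos ((List.range q).flatMap f)) {m : ℕ} (hm : m < q) :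
    HoldsAt a (pos + ((List.range m).flatMap f).length) (f m) := by
  induction q with
  | zero => omega
  | succ q ih =>
    rw [List.range_succ, List.flatMap_append, holdsAt_append] at h
    rcases Nat.lt_succ_iff_lt_or_eq.1 hm with h' | rfl
    · exact ih h.1 h'
    · simpa using h.2

theorem halts_loadRows {s : State} {n q p N pos : ℕ} {R E : ℕ → List ℕ} (hN : N = n + q + p + 2)
    (hq : s.nat 0 1 = q) (hp : s.nat 0 2 = p)
    (hMUL : ∀ x ≤ N, s.nat MUL x = x * N) (hINC : ∀ x, s.nat INC x = 0)
    (hpos : s.nat 0 3 + s.nat 0 3 + 5 + s.nat 0 (s.nat 0 3 + s.nat 0 3 + 4) +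
      s.nat 0 (s.nat 0 3 + s.nat 0 3 + 4) = pos)
    (hbags : HoldsAt (s.nat 0) pos ((List.range q).flatMap fun t => (R t).length :: R t))
    (hsubs : HoldsAt (s.nat 0)
      (pos + ((List.range q).flatMap fun t => (R t).length :: R t).length)
      ((List.range p).flatMap fun j => ((R (q + 1 + j)).length :: R (q + 1 + j)) ++
        (E j).length / 2 :: E j)) (hE : ∀ j, Even (E j).length)
    (hR : ∀ ρ, ∀ v ∈ R ρ, v < n) (hlen : ∀ ρ, (R ρ).length ≤ n) (hRq : R q = []) :
    Halts loadRows s (100 * ((q + p + 2) * (n + 2))) fun s' =>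
      s'.nat TEDGES 0 = s.nat 0 3 + s.nat 0 3 + 5 ∧
      ∀ ρ v, v < N → (s'.nat INC (ρ * N + v) = 1 ↔ ρ < q + 1 + p ∧ v ∈ R ρ) := by
  have key : ∀ (σ : ℕ → ℕ) (s' : State) (ρ : ℕ), ρ ≤ N →
      (∀ x, s'.nat INC x = 1 ↔ (∃ v ∈ R ρ, x = ρ * N + v) ∨ σ x = 1) →
      (∀ ρ' v, v < N → (σ (ρ' * N + v) = 1 ↔ ρ' < ρ ∧ v ∈ R ρ')) →
      ∀ ρ' v, v < N → (s'.nat INC (ρ' * N + v) = 1 ↔ ρ' < ρ + 1 ∧ v ∈ R ρ') := by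
    intro σ s' ρ hρ h hσ ρ' v hv
    have h1 : (∃ v' ∈ R ρ, ρ' * N + v = ρ * N + v') ↔ ρ' = ρ ∧ v ∈ R ρ := by
      constructor
      · rintro ⟨v', hv', h'⟩
        obtain ⟨rfl, rfl⟩ := (rowCol_inj hv (by have := hR _ _ hv'; omega)).1 h'
        exact ⟨rfl, hv'⟩
      · rintro ⟨rfl, hv'⟩
        exact ⟨v, hv', rfl⟩
    rw [h, h1, hσ _ _ hv]
    constructor
    · rintro (⟨rfl, h2⟩ | ⟨h2, h3⟩)
      · exact ⟨by omega, h2⟩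
      · exact ⟨by omega, h3⟩
    · rintro ⟨h2, h3⟩
      rcases Nat.lt_succ_iff_lt_or_eq.1 h2 with h4 | rfl
      · exact .inr ⟨h4, h3⟩
      · exact .inl ⟨rfl, h3⟩
  set s₁ := (Program.seq (setVar TEDGES (rd 0 3 + rd 0 3 + 5))
    (setVar POS (var TEDGES + rd 0 (var TEDGES - 1) + rd 0 (var TEDGES - 1)))).exec s with hs₁
  refine Halts.mono (Halts.exec_seq rfl (Halts.seq (Halts.forLoop (c := 40 * (n + 2) + 5) q
    (fun m s' => s'.nat POS 0 =
      pos + ((List.range m).flatMap fun t => (R t).length :: R t).length ∧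
      ∀ ρ v, v < N → (s'.nat INC (ρ * N + v) = 1 ↔ ρ < m ∧ v ∈ R ρ)) (by decide) ?_ ?_ ?_)
    fun s₂ hs₂ hI => (Halts.forLoop (c := 40 * (n + 2) + 25) p
    (fun m s' => s'.nat POS 0 =
      pos + ((List.range q).flatMap fun t => (R t).length :: R t).length +
        ((List.range m).flatMap fun j => ((R (q + 1 + j)).length :: R (q + 1 + j)) ++
        (E j).length / 2 :: E j).length ∧
      ∀ ρ v, v < N → (s'.nat INC (ρ * N + v) = 1 ↔ ρ < q + 1 + m ∧ v ∈ R ρ)) (by decide)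
      ?_ ?_ ?_).mono le_rfl fun s' hs' hI => ⟨?_, hI.2⟩))
      (T' := 100 * ((q + p + 2) * (n + 2))) ?_ fun _ _ h => h
  · intro s' hs'
    simp [hs'.nat 0 (by decide), hq]
  · simp [hINC, hpos]
  · intro m hm s' hs' hi hI
    refine ((Halts.exec_seq rfl (halts_loadRow (l := R m) (hlen m) ?_)).mono (by simp; omega)
      fun s'' hs'' h => ⟨?_, ?_⟩)
    · simpa [hs₁, hs'.nat 0 (by decide), hI.1] using holdsAt_flatMap_range hbags hm
    · simp [h.1, hI.1, List.range_succ]; ring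
    · simp only [State.writeNat_nat_of_ne _ _ _ (show INC ≠ IA by decide)]
      refine key (s'.nat INC) s'' m (by omega) ?_ hI.2
      intro x
      rw [h.2]
      simp [hs'.nat MUL (by decide), hi, hMUL m (by omega)]
  · intro s' hs'
    simp [hs'.nat 0 (by decide), hs₂.nat 0 (by decide), hp]
  · simp only [State.writeNat_nat_of_ne _ _ _ (show INC ≠ IA by decide),
      State.writeNat_nat_of_ne _ _ _ (show POS ≠ IA by decide)]
    refine ⟨by simpa using hI.1, fun ρ v hv => ?_⟩
    rw [hI.2 ρ v hv]
    constructor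
    · rintro ⟨h3, h4⟩; exact ⟨by omega, h4⟩
    · rintro ⟨h3, h4⟩
      refine ⟨?_, h4⟩
      rcases Nat.lt_succ_iff_lt_or_eq.1 h3 with h5 | rfl
      · exact h5
      · simp [hRq] at h4
  · intro m hm s' hs' hi hI
    have hh := holdsAt_append.1 (holdsAt_flatMap_range hsubs hm)
    have hh' := holdsAt_cons.1 hh.2
    refine ((Halts.exec_seq rfl (Halts.seq (halts_loadRow (l := R (q + 1 + m)) (hlen _) ?_)
      fun s'' hs'' h => Halts.of_loopFree rfl ⟨?_, ?_⟩)).mono (by simp; omega) fun _ _ h => h)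
    · simpa [hs₁, hs'.nat 0 (by decide), hs₂.nat 0 (by decide), hI.1] using hh.1
    · have h3 : s''.nat POS 0 = pos + ((List.range q).flatMap fun t => (R t).length :: R t).length +
        ((List.range m).flatMap fun j => ((R (q + 1 + j)).length :: R (q + 1 + j)) ++
        (E j).length / 2 :: E j).length + ((R (q + 1 + m)).length :: R (q + 1 + m)).length := by
        rw [h.1]; simp [hI.1]; ring
      have h4 : s''.nat 0 = s.nat 0 := by
        simp [hs''.nat 0 (by decide), hs'.nat 0 (by decide), hs₂.nat 0 (by decide)]
      have h5 := Nat.two_mul_div_two_of_even (hE m)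
      have h6 := hh'.1
      rw [← h3] at h6
      simp only [Program.exec, NatExpr.eval, h4, h6,
        State.writeNat_nat_self, State.writeNat_nat_of_ne _ _ _ (show POS ≠ IA by decide),
        Function.update_self]
      rw [h3, List.range_succ]
      simp
      omega
    · have h3 : ∀ x, s''.nat INC x = 1 ↔
          (∃ v ∈ R (q + 1 + m), x = (q + 1 + m) * N + v) ∨ s'.nat INC x = 1 := by
        intro x
        rw [h.2]
        simp [hs'.nat MUL (by decide), hs'.nat 0 (by decide), hs₂.nat 0 (by decide),
          hs₂.nat MUL (by decide), hi, hMUL (q + 1 + m) (by omega), hq]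
      simp only [Program.exec, State.writeNat_nat_of_ne _ _ _ (show INC ≠ IA by decide),
        State.writeNat_nat_of_ne _ _ _ (show INC ≠ POS by decide)]
      exact key (s'.nat INC) s'' (q + 1 + m) (by omega) h3 hI.2
  · simp
    ring_nf
    nlinarith [Nat.zero_le (q * n), Nat.zero_le (p * n)]
  · simp [hs'.nat TEDGES (by decide), hs₂.nat TEDGES (by decide)]

end RAM

/-! ### Distances from the members of the family -/

/-- `v` can be reached from `A` in at most `l` steps along `E`. -/
def StepReach (A : ℕ → Prop) (E : ℕ → ℕ → Prop) : ℕ → ℕ → Prop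
  | 0 => A
  | l + 1 => fun v => StepReach A E l v ∨ ∃ u, StepReach A E l u ∧ E u v

theorem StepReach.mono {A : ℕ → Prop} {E : ℕ → ℕ → Prop} {l l' v : ℕ} (h : StepReach A E l v)
    (hl : l ≤ l') : StepReach A E l' v := by
  induction l', hl using Nat.le_induction with
  | base => exact h
  | succ m _ ih => exact .inl ih

namespace RAM

/-- The first end of edge number `IC`. -/
abbrev edgeFst : NatExpr := rd 0 (4 + var IC + var IC)

/-- The second end of edge number `IC`. -/
abbrev edgeSnd : NatExpr := rd 0 (5 + var IC + var IC)

/-- Computes in `LEV` the distances from the vertices in row `ROW`, up to `LIMIT`, by relaxing all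
edges `LIMIT` times. -/
def levels : Program :=
  .seq (forLoop IB (rd 0 0) (.branch (.natEq (rd INC (rd MUL (var ROW) + var IB)) 1)
    (.setNat LEV (var IB) 0) (.setNat LEV (var IB) (var LIMIT)))) <|
  forLoop IB (var LIMIT) <| forLoop IC (rd 0 3) <|
    .branch (.natLe (rd LEV edgeFst + 1) (rd LEV edgeSnd))
      (.setNat LEV edgeSnd (rd LEV edgeFst + 1))
      (.branch (.natLe (rd LEV edgeSnd + 1) (rd LEV edgeFst))
        (.setNat LEV edgeFst (rd LEV edgeSnd + 1)) .skip)

/-- One of the first `m` pairs in `eu`, `ev` joins `u` and `v`. -/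
def Joined (eu ev : ℕ → ℕ) (m u v : ℕ) : Prop :=
  ∃ i < m, eu i = u ∧ ev i = v ∨ eu i = v ∧ ev i = u

/-- Every round extends the radius within which the levels are exact by at least one, and levels
below `d` are always attained by some path, so `d` rounds suffice. -/
theorem halts_levels {s : State} {d n m N ρ : ℕ} {A : ℕ → Prop} {eu ev : ℕ → ℕ}
    (hd : s.nat LIMIT 0 = d) (hn : s.nat 0 0 = n) (hm : s.nat 0 3 = m)
    (heu : ∀ i < m, s.nat 0 (4 + i + i) = eu i) (hev : ∀ i < m, s.nat 0 (5 + i + i) = ev i)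
    (hun : ∀ i < m, eu i < n) (hvn : ∀ i < m, ev i < n)
    (hMUL : s.nat MUL (s.nat ROW 0) = ρ * N)
    (hA : ∀ v < n, s.nat INC (ρ * N + v) = 1 ↔ A v) :
    Halts levels s (200 * ((d + 1) * (m + n + 2))) fun s' =>
      ∀ v < n, ∀ x < d, s'.nat LEV v ≤ x ↔ StepReach A (Joined eu ev m) x v := by
  have inner : ∀ (s₁ : State), (s₁.nat 0 = s.nat 0) →
      (∀ v < n, s₁.nat LEV v < d → StepReach A (Joined eu ev m) (s₁.nat LEV v) v) →
      Halts (forLoop IC (rd 0 3) <|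
        .branch (.natLe (rd LEV edgeFst + 1) (rd LEV edgeSnd))
          (.setNat LEV edgeSnd (rd LEV edgeFst + 1))
          (.branch (.natLe (rd LEV edgeSnd + 1) (rd LEV edgeFst))
            (.setNat LEV edgeFst (rd LEV edgeSnd + 1)) .skip)) s₁ (100 * (m + 1)) fun s' =>
        (∀ v < n, s'.nat LEV v < d → StepReach A (Joined eu ev m) (s'.nat LEV v) v) ∧
        (∀ v < n, s'.nat LEV v ≤ s₁.nat LEV v) ∧
        ∀ i < m, s'.nat LEV (ev i) ≤ s₁.nat LEV (eu i) + 1 ∧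
          s'.nat LEV (eu i) ≤ s₁.nat LEV (ev i) + 1 := by
    intro s₁ hs₁ hI₁
    refine (Halts.forLoop (c := 80) m (fun k s' =>
        (∀ v < n, s'.nat LEV v < d → StepReach A (Joined eu ev m) (s'.nat LEV v) v) ∧
        (∀ v < n, s'.nat LEV v ≤ s₁.nat LEV v) ∧
        ∀ i < k, s'.nat LEV (ev i) ≤ s₁.nat LEV (eu i) + 1 ∧
          s'.nat LEV (eu i) ≤ s₁.nat LEV (ev i) + 1) (by decide) ?_ ?_ ?_).mono ?_ fun _ _ h => h
    · intro s' hs'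
      simp [hs'.nat 0 (by decide), hs₁, hm]
    · simpa using hI₁
    · intro k hk s' hs' hi hI
      have h0 : s'.nat 0 = s.nat 0 := by rw [hs'.nat 0 (by decide), hs₁]
      have e1 := heu k hk
      have e2 := hev k hk
      have hu := hun k hk
      have hv := hvn k hk
      refine (Halts.of_loopFree rfl ?_).mono (by simp) fun _ _ h => h
      -- A relaxation along an edge keeps the levels sound, and can only lower them.
      have relax : ∀ a b, a < n → b < n → Joined eu ev m a b → s'.nat LEV a + 1 ≤ s'.nat LEV b →
          (∀ v < n, Function.update (s'.nat LEV) b (s'.nat LEV a + 1) v < d →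
            StepReach A (Joined eu ev m) (Function.update (s'.nat LEV) b (s'.nat LEV a + 1) v) v) ∧
          (∀ v < n, Function.update (s'.nat LEV) b (s'.nat LEV a + 1) v ≤ s'.nat LEV v) := by
        intro a b ha hb hab hle
        refine ⟨fun v hv => ?_, fun v hv => ?_⟩
        · by_cases hvb : v = b
          · subst hvb
            simp only [Function.update_self]
            exact fun h => .inr ⟨a, hI.1 a ha (by omega), hab⟩
          · simpa [hvb] using hI.1 v hv
        · by_cases hvb : v = b
          · subst hvb; simpa using hle
          · simp [hvb]
      have fin : ∀ f : ℕ → ℕ, (∀ v < n, f v < d → StepReach A (Joined eu ev m) (f v) v) →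
          (∀ v < n, f v ≤ s'.nat LEV v) → f (ev k) ≤ s'.nat LEV (eu k) + 1 →
          f (eu k) ≤ s'.nat LEV (ev k) + 1 →
          (∀ v < n, f v < d → StepReach A (Joined eu ev m) (f v) v) ∧
          (∀ v < n, f v ≤ s₁.nat LEV v) ∧
          ∀ i < k + 1, f (ev i) ≤ s₁.nat LEV (eu i) + 1 ∧ f (eu i) ≤ s₁.nat LEV (ev i) + 1 := by
        intro f h1 h2 h3 h4
        refine ⟨h1, fun v hv => (h2 v hv).trans (hI.2.1 v hv), fun i hi' => ?_⟩
        rcases Nat.lt_succ_iff_lt_or_eq.1 hi' with h | rfl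
        · have := hI.2.2 i h
          have := h2 _ (hvn i (by omega))
          have := h2 _ (hun i (by omega))
          omega
        · have := hI.2.1 _ hu
          have := hI.2.1 _ hv
          omega
      simp only [Program.exec, Test.eval, NatExpr.eval,
        hi, h0, e1, e2]
      split_ifs with h1 h2
      · simp only [State.writeNat_nat_self,
          State.writeNat_nat_of_ne _ _ _ (show LEV ≠ IC by decide)]
        obtain ⟨r1, r2⟩ := relax _ _ hu hv ⟨k, hk, .inl ⟨rfl, rfl⟩⟩ h1
        refine fin _ r1 r2 (by simp) ?_
        have := r2 _ hu
        omega
      · simp only [State.writeNat_nat_self,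
          State.writeNat_nat_of_ne _ _ _ (show LEV ≠ IC by decide)]
        obtain ⟨r1, r2⟩ := relax _ _ hv hu ⟨k, hk, .inr ⟨rfl, rfl⟩⟩ h2
        refine fin _ r1 r2 ?_ (by simp)
        have := r2 _ hv
        omega
      · simp only [State.writeNat_nat_of_ne _ _ _ (show LEV ≠ IC by decide)]
        exact fin _ hI.1 (fun v _ => le_rfl) (by omega) (by omega)
    · simp; omega
  refine Halts.mono (Halts.seq (Halts.forLoop (c := 40) n (fun k s' => ∀ v < k,
      (A v → s'.nat LEV v = 0) ∧ (¬ A v → s'.nat LEV v = d)) (by decide) ?_ ?_ ?_)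
    fun s₁ hs₁ hI₁ => (Halts.forLoop (c := 100 * (m + 1)) d (fun l s' =>
      (∀ v < n, s'.nat LEV v < d → StepReach A (Joined eu ev m) (s'.nat LEV v) v) ∧
      ∀ v < n, ∀ x ≤ l, StepReach A (Joined eu ev m) x v → s'.nat LEV v ≤ x) (by decide)
      ?_ ?_ ?_).mono le_rfl fun s' hs' hI => ?_) (T' := 200 * ((d + 1) * (m + n + 2))) ?_
      fun _ _ h => h
  · intro s' hs'
    simp [hs'.nat 0 (by decide), hn]
  · simp
  · intro k hk s' hs' hi hI
    refine (Halts.of_loopFree rfl ?_).mono (by simp) fun _ _ h => h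
    intro v hv
    have h1 := hA k hk
    rcases Nat.lt_succ_iff_lt_or_eq.1 hv with h | rfl
    · have := hI v h
      by_cases hAk : A k <;>
      simpa [h1, hs'.nat INC (by decide), hs'.nat MUL (by decide), hs'.nat ROW (by decide),
        hs'.nat LIMIT (by decide), hMUL, hi, h1, hAk, h.ne, hd] using this
    · by_cases hAk : A v <;>
      simp [hs'.nat INC (by decide), hs'.nat MUL (by decide), hs'.nat ROW (by decide),
        hs'.nat LIMIT (by decide), hMUL, hi, h1, hAk, hd]
  · intro s' hs'
    simp [hs'.nat LIMIT (by decide), hs₁.nat LIMIT (by decide), hd]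
  · simp only [State.writeNat_nat_of_ne _ _ _ (show LEV ≠ IB by decide)]
    refine ⟨fun v hv h => ?_, fun v hv x hx h => ?_⟩
    · have hAv : A v := by
        by_contra hAv
        rw [(hI₁ v hv).2 hAv] at h; omega
      rw [(hI₁ v hv).1 hAv]; exact hAv
    · obtain rfl : x = 0 := by omega
      exact ((hI₁ v hv).1 h).le
  · intro l hl s' hs' hi hI
    refine (inner s' ?_ hI.1).mono le_rfl fun s'' hs'' h => ?_
    · rw [hs'.nat 0 (by decide), hs₁.nat 0 (by decide)]
    · simp only [State.writeNat_nat_of_ne _ _ _ (show LEV ≠ IB by decide)]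
      refine ⟨h.1, fun v hv x hx hr => ?_⟩
      rcases hx.lt_or_eq with hx | rfl
      · exact (h.2.1 v hv).trans (hI.2 v hv x (by omega) hr)
      · rcases hr with hr | ⟨u, hu, i, hi', (⟨rfl, rfl⟩ | ⟨rfl, rfl⟩)⟩
        · have := (h.2.1 v hv).trans (hI.2 v hv l le_rfl hr)
          omega
        · have := (h.2.2 i hi').1
          have := hI.2 _ (hun i hi') l le_rfl hu
          omega
        · have := (h.2.2 i hi').2
          have := hI.2 _ (hvn i hi') l le_rfl hu
          omega
  · intro v hv x hx
    refine ⟨fun h => (hI.1 v hv (by omega)).mono h, fun h => hI.2 v hv x hx.le h⟩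
  · simp
    nlinarith [Nat.zero_le (d * n), Nat.zero_le (d * m)]

/-- Computes the smallest entry of `LEV` over every row, and stores it in row `IA` of `DIST`. -/
def rowMins : Program :=
  forLoop IB (rd 0 1 + 1 + rd 0 2) <| .seq (setVar ACC (var LIMIT)) <|
    .seq (forLoop IC (rd 0 0) (.branch
      (.and (.natEq (rd INC (rd MUL (var IB) + var IC)) 1) (.natLe (rd LEV (var IC)) (var ACC)))
      (setVar ACC (rd LEV (var IC))) .skip)) <|
    .setNat DIST (rd MUL (var IA) + var IB) (var ACC)

theorem halts_rowMins {s : State} {d n q p N j : ℕ} {R : ℕ → ℕ → Prop} (hN : N = n + q + p + 2)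
    (hd : s.nat LIMIT 0 = d) (hn : s.nat 0 0 = n) (hq : s.nat 0 1 = q) (hp : s.nat 0 2 = p)
    (hMUL : ∀ x ≤ N, s.nat MUL x = x * N) (hj : s.nat IA 0 = j) (hjp : j < p)
    (hR : ∀ ρ < q + 1 + p, ∀ v < n, s.nat INC (ρ * N + v) = 1 ↔ R ρ v) :
    Halts rowMins s (100 * ((q + p + 2) * (n + 2))) fun s' =>
      (∀ ρ < q + 1 + p, ∀ x < d, s'.nat DIST (j * N + ρ) ≤ x ↔
        ∃ v < n, R ρ v ∧ s.nat LEV v ≤ x) ∧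
      ∀ i ≠ j, ∀ ρ < N, s'.nat DIST (i * N + ρ) = s.nat DIST (i * N + ρ) := by
  refine (Halts.forLoop (c := 5 + ((n + 1) * 60 + 20)) (q + 1 + p) (fun k s' =>
      (∀ ρ < k, ∀ x < d, s'.nat DIST (j * N + ρ) ≤ x ↔
        ∃ v < n, R ρ v ∧ s.nat LEV v ≤ x) ∧
      ∀ i ≠ j, ∀ ρ < N, s'.nat DIST (i * N + ρ) = s.nat DIST (i * N + ρ)) (by decide)
      ?_ ?_ ?_).mono ?_ fun _ _ h => h
  · intro s' hs'
    simp [hs'.nat 0 (by decide), hq, hp]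
  · simp
  · intro k hk s₁ hs₁ hi hI
    refine (Halts.exec_seq rfl (Halts.seq (Halts.forLoop (c := 46) n (fun l s' => ∀ x < d,
      s'.nat ACC 0 ≤ x ↔ ∃ v < l, R k v ∧ s.nat LEV v ≤ x) (by decide) ?_ ?_ ?_)
      fun s' hs' hI' => Halts.of_loopFree rfl ⟨?_, ?_⟩)).mono ?_ fun _ _ h => h
    · intro s' hs'
      simp [hs'.nat 0 (by decide), hs₁.nat 0 (by decide), hn]
    · simp [hs₁.nat LIMIT (by decide), hd]
    · intro l hl s' hs' hi' hI'
      refine (Halts.of_loopFree rfl ?_).mono (by simp) fun _ _ h => h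
      intro x hx
      have h1 := hR k hk l hl
      have h2 : (∃ v < l + 1, R k v ∧ s.nat LEV v ≤ x) ↔
          (R k l ∧ s.nat LEV l ≤ x) ∨ ∃ v < l, R k v ∧ s.nat LEV v ≤ x := by
        constructor
        · rintro ⟨v, hv, h⟩
          rcases Nat.lt_succ_iff_lt_or_eq.1 hv with h' | rfl
          · exact .inr ⟨v, h', h⟩
          · exact .inl h
        · rintro (h | ⟨v, hv, h⟩)
          · exact ⟨l, by omega, h⟩
          · exact ⟨v, by omega, h⟩
      rw [h2, ← hI' x hx]
      by_cases h3 : R k l ∧ s.nat LEV l ≤ s'.nat ACC 0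
      · simp [hs'.nat INC (by decide), hs₁.nat INC (by decide), hs'.nat MUL (by decide),
          hs₁.nat MUL (by decide), hMUL k (by omega), hs'.nat IB (by decide), hi, hi', h1, h3,
          hs'.nat LEV (by decide), hs₁.nat LEV (by decide)]
        omega
      · simp [hs'.nat INC (by decide), hs₁.nat INC (by decide), hs'.nat MUL (by decide),
          hs₁.nat MUL (by decide), hMUL k (by omega), hs'.nat IB (by decide), hi, hi', h1, h3,
          hs'.nat LEV (by decide), hs₁.nat LEV (by decide)]
        intro h4 h5
        by_contra h6
        exact h3 ⟨h4, by omega⟩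
    · simp; omega
    · intro ρ hρ x hx
      have e1 : s'.nat IB 0 = k := by simp [hs'.nat IB (by decide), hi]
      have e2 : s'.nat MUL (s'.nat IA 0) = j * N := by
        simp [hs'.nat MUL (by decide), hs'.nat IA (by decide), hs₁.nat MUL (by decide),
          hs₁.nat IA (by decide), hj, hMUL j (by omega)]
      have e3 : s'.nat DIST = s₁.nat DIST := by simp [hs'.nat DIST (by decide)]
      rcases Nat.lt_succ_iff_lt_or_eq.1 hρ with h | rfl
      · simp [e1, e2, e3, hI.1 ρ h x hx, h.ne]
      · simp [e1, e2, hI' x hx]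
    · intro i hij ρ hρ
      have e1 : s'.nat IB 0 = k := by simp [hs'.nat IB (by decide), hi]
      have e2 : s'.nat MUL (s'.nat IA 0) = j * N := by
        simp [hs'.nat MUL (by decide), hs'.nat IA (by decide), hs₁.nat MUL (by decide),
          hs₁.nat IA (by decide), hj, hMUL j (by omega)]
      have e3 : s'.nat DIST = s₁.nat DIST := by simp [hs'.nat DIST (by decide)]
      have e4 : i * N + ρ ≠ j * N + k := fun h =>
        hij ((rowCol_inj hρ (by omega)).1 h).1
      simp [e1, e2, e3, hI.2 i hij ρ hρ, e4]
  · simp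
    nlinarith [Nat.zero_le (q * n), Nat.zero_le (p * n)]

/-- Computes the distances from the subgraphs to the bags and to each other, up to `LIMIT`. -/
def distances : Program :=
  forLoop IA (rd 0 2) (.seq (setVar ROW (rd 0 1 + 1 + var IA)) (.seq levels rowMins))

theorem halts_distances {s : State} {d n q p N m : ℕ} {R : ℕ → ℕ → Prop} {eu ev : ℕ → ℕ}
    (hN : N = n + q + p + 2)
    (hd : s.nat LIMIT 0 = d) (hn : s.nat 0 0 = n) (hq : s.nat 0 1 = q) (hp : s.nat 0 2 = p)
    (hm : s.nat 0 3 = m)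
    (heu : ∀ i < m, s.nat 0 (4 + i + i) = eu i) (hev : ∀ i < m, s.nat 0 (5 + i + i) = ev i)
    (hun : ∀ i < m, eu i < n) (hvn : ∀ i < m, ev i < n)
    (hMUL : ∀ x ≤ N, s.nat MUL x = x * N)
    (hR : ∀ ρ < q + 1 + p, ∀ v < n, s.nat INC (ρ * N + v) = 1 ↔ R ρ v) :
    Halts distances s (500 * ((p + 1) * ((d + 1) * (m + n + 2) + (q + p + 2) * (n + 2)))) fun s' =>
      ∀ j < p, ∀ ρ < q + 1 + p, ∀ x < d, s'.nat DIST (j * N + ρ) ≤ x ↔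
        ∃ v < n, R ρ v ∧ StepReach (R (q + 1 + j)) (Joined eu ev m) x v := by
  refine (Halts.forLoop
    (c := 12 + (200 * ((d + 1) * (m + n + 2)) + 100 * ((q + p + 2) * (n + 2)))) p (fun k s' =>
      ∀ j < k, ∀ ρ < q + 1 + p, ∀ x < d, s'.nat DIST (j * N + ρ) ≤ x ↔
        ∃ v < n, R ρ v ∧ StepReach (R (q + 1 + j)) (Joined eu ev m) x v) (by decide)
      ?_ ?_ ?_).mono ?_ fun _ _ h => h
  · intro s' hs'
    simp [hs'.nat 0 (by decide), hp]
  · simp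
  · intro k hk s₁ hs₁ hi hI
    have h0 := hs₁.nat 0 (by decide)
    refine (Halts.exec_seq rfl (Halts.seq (halts_levels (d := d) (n := n) (m := m) (N := N)
      (ρ := q + 1 + k) (A := R (q + 1 + k)) (eu := eu) (ev := ev) ?_ ?_ ?_ ?_ ?_ hun hvn ?_ ?_)
      fun s' hs' hI' => (halts_rowMins (d := d) (j := k) (R := R) hN ?_ ?_ ?_ ?_ ?_ ?_ hk ?_).mono
        le_rfl fun s'' hs'' h => ?_)).mono ?_ fun _ _ h => h
    · simp [hs₁.nat LIMIT (by decide), hd]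
    · simp [h0, hn]
    · simp [h0, hm]
    · simpa [h0] using heu
    · simpa [h0] using hev
    · simp [h0, hs₁.nat MUL (by decide), hq, hi, hMUL (q + 1 + k) (by omega)]
    · simpa [hs₁.nat INC (by decide)] using hR (q + 1 + k) (by omega)
    · simp [hs'.nat LIMIT (by decide), hs₁.nat LIMIT (by decide), hd]
    · simp [hs'.nat 0 (by decide), h0, hn]
    · simp [hs'.nat 0 (by decide), h0, hq]
    · simp [hs'.nat 0 (by decide), h0, hp]
    · simpa [hs'.nat MUL (by decide), hs₁.nat MUL (by decide)] using hMUL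
    · simp [hs'.nat IA (by decide), hi]
    · simpa [hs'.nat INC (by decide), hs₁.nat INC (by decide)] using hR
    · have e3 : s'.nat DIST = s₁.nat DIST := by simp [hs'.nat DIST (by decide)]
      simp only [State.writeNat_nat_of_ne _ _ _ (show DIST ≠ IA by decide)]
      intro j hj ρ hρ x hx
      rcases Nat.lt_succ_iff_lt_or_eq.1 hj with h' | rfl
      · rw [h.2 j h'.ne ρ (by omega), e3]
        exact hI j h' ρ hρ x hx
      · rw [h.1 ρ hρ x hx]
        refine exists_congr fun v => and_congr_right fun hv => ?_
        rw [hI' v hv x hx]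
    · simp
  · simp
    ring_nf
    nlinarith [Nat.zero_le ((q + p) * n * p), Nat.zero_le ((q + p) * n),
      Nat.zero_le (d * (m + n) * p), Nat.zero_le (p * (m + n)), Nat.zero_le (d * p)]

end RAM

/-! ### Sets as digit sequences -/

/-- Digit number `i` of `c` in base `b`. In base `p + 1`, a number `c < (p + 1) ^ k` stands for the
set of all `j` such that `j + 1` is one of its `k` digits; the digit `0` is a blank. -/
def digitAt (b c i : ℕ) : ℕ := c / b ^ i % b

theorem digitAt_zero (b c : ℕ) : digitAt b c 0 = c % b := by simp [digitAt]

theorem digitAt_succ (b c i : ℕ) : digitAt b c (i + 1) = digitAt b (c / b) i := by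
  simp [digitAt, pow_succ', Nat.div_div_eq_div_mul]

theorem digitAt_lt {b : ℕ} (hb : 0 < b) (c i : ℕ) : digitAt b c i < b := Nat.mod_lt _ hb

theorem digitAt_mul_add_zero {b a : ℕ} (x : ℕ) (ha : a < b) : digitAt b (x * b + a) 0 = a := by
  rw [digitAt_zero, Nat.mul_add_mod', Nat.mod_eq_of_lt ha]

theorem digitAt_mul_add_succ {b a : ℕ} (x i : ℕ) (ha : a < b) :
    digitAt b (x * b + a) (i + 1) = digitAt b x i := by
  rw [digitAt_succ, Nat.add_comm, Nat.add_mul_div_right _ _ (by omega), Nat.div_eq_of_lt ha,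
    Nat.zero_add]

theorem digitAt_eq_zero {b k c i : ℕ} (hb : 0 < b) (hc : c < b ^ k) (hi : k ≤ i) :
    digitAt b c i = 0 := by
  rw [digitAt, Nat.div_eq_of_lt (hc.trans_le (Nat.pow_le_pow_right hb hi)), Nat.zero_mod]

theorem digitAt_of_zero (b i : ℕ) : digitAt b 0 i = 0 := by simp [digitAt]

theorem exists_digitAt_eq {b : ℕ} (k : ℕ) (f : ℕ → ℕ) (hf : ∀ i < k, f i < b) :
    ∃ c < b ^ k, ∀ i < k, digitAt b c i = f i := by
  induction k generalizing f with
  | zero => exact ⟨0, by simp, by simp⟩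
  | succ k ih =>
    obtain ⟨c, hc, h⟩ := ih (fun i => f (i + 1)) fun i hi => hf _ (by omega)
    have h0 := hf 0 (by omega)
    refine ⟨c * b + f 0, ?_, fun i hi => ?_⟩
    · rw [pow_succ]
      nlinarith
    · cases i with
      | zero => exact digitAt_mul_add_zero _ h0
      | succ i => rw [digitAt_mul_add_succ _ _ h0, h i (by omega)]

theorem digitAt_ext {b k c c' : ℕ} (hc : c < b ^ k) (hc' : c' < b ^ k)
    (h : ∀ i < k, digitAt b c i = digitAt b c' i) : c = c' := by
  induction k generalizing c c' with
  | zero => simp at hc hc'; omega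
  | succ k ih =>
    have h0 := h 0 (by omega)
    rw [digitAt_zero, digitAt_zero] at h0
    have h1 : c / b = c' / b := by
      rw [pow_succ] at hc hc'
      refine ih (Nat.div_lt_of_lt_mul (by rwa [Nat.mul_comm]))
        (Nat.div_lt_of_lt_mul (by rwa [Nat.mul_comm])) fun i hi => ?_
      rw [← digitAt_succ, ← digitAt_succ, h _ (by omega)]
    rw [← Nat.div_add_mod c b, ← Nat.div_add_mod c' b, h0, h1]

/-- `j` is an element of the set with code `c`. -/
def InCode (b k c j : ℕ) : Prop := ∃ i < k, digitAt b c i = j + 1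

theorem InCode.lt {p k c j : ℕ} (h : InCode (p + 1) k c j) : j < p := by
  obtain ⟨i, -, hi⟩ := h
  have := digitAt_lt (Nat.succ_pos p) c i
  simp at this; omega

/-- Nonblank digits at different positions are not in conflict. -/
def GoodCode (cf : ℕ → ℕ → Prop) (b c : ℕ) : Prop :=
  ∀ i i', i < i' → digitAt b c i ≠ 0 → digitAt b c i' ≠ 0 →
    ¬ cf (digitAt b c i - 1) (digitAt b c i' - 1)

/-- The recursion by which good codes are found: a pair of digits of `c` avoids digit `0`, avoids
digit `1`, or consists of these two. -/
theorem goodCode_iff {cf : ℕ → ℕ → Prop} {b c : ℕ} (hb : 0 < b) :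
    GoodCode cf b c ↔
      (c % b ≠ 0 → c / b % b ≠ 0 → ¬ cf (c % b - 1) (c / b % b - 1)) ∧
      GoodCode cf b (c / b) ∧ GoodCode cf b (c / b / b * b + c % b) := by
  have hm := Nat.mod_lt c hb
  have e0 : c % b = digitAt b c 0 := (digitAt_zero b c).symm
  have e1 : c / b % b = digitAt b c 1 := by rw [digitAt_succ, digitAt_zero]
  have e2 : ∀ i, digitAt b (c / b) i = digitAt b c (i + 1) := fun i => (digitAt_succ b c i).symm
  have e3 : digitAt b (c / b / b * b + c % b) 0 = digitAt b c 0 := by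
    rw [digitAt_mul_add_zero _ hm, e0]
  have e4 : ∀ i, digitAt b (c / b / b * b + c % b) (i + 1) = digitAt b c (i + 2) := fun i => by
    rw [digitAt_mul_add_succ _ _ hm, digitAt_succ, digitAt_succ]
  constructor
  · intro h
    refine ⟨fun h0 h1 => ?_, fun i i' hi h0 h1 => ?_, fun i i' hi h0 h1 => ?_⟩
    · rw [e0] at h0 ⊢; rw [e1] at h1 ⊢; exact h 0 1 (by omega) h0 h1
    · rw [e2] at h0 h1; rw [e2, e2]; exact h _ _ (by omega) h0 h1
    · obtain ⟨i', rfl⟩ : ∃ l, i' = l + 1 := ⟨i' - 1, by omega⟩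
      rw [e4] at h1 ⊢
      cases i with
      | zero => rw [e3] at h0 ⊢; exact h _ _ (by omega) h0 h1
      | succ i => rw [e4] at h0 ⊢; exact h _ _ (by omega) h0 h1
  · rintro ⟨h, h', h''⟩ i i' hi h0 h1
    cases i with
    | succ i =>
      obtain ⟨i', rfl⟩ : ∃ l, i' = l + 1 := ⟨i' - 1, by omega⟩
      have := h' i i' (by omega)
      rw [e2, e2] at this
      exact this h0 h1
    | zero =>
      rcases Nat.lt_or_ge i' 2 with h2 | h2
      · obtain rfl : i' = 1 := by omega
        rw [e0, e1] at h
        exact h h0 h1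
      · obtain ⟨l, rfl⟩ : ∃ l, i' = l + 2 := ⟨i' - 2, by omega⟩
        have := h'' 0 (l + 1) (by omega)
        rw [e3, e4] at this
        exact this h0 h1

/-- The digits of `c'` are those of `c`, with the elements outside `keep` blanked. -/
def IsProjection (keep : ℕ → Prop) (b c c' : ℕ) : Prop :=
  ∀ i, (digitAt b c i ≠ 0 ∧ keep (digitAt b c i - 1) → digitAt b c' i = digitAt b c i) ∧
    (¬ (digitAt b c i ≠ 0 ∧ keep (digitAt b c i - 1)) → digitAt b c' i = 0)

theorem IsProjection.inCode_iff {keep : ℕ → Prop} {b k c c' j : ℕ}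
    (h : IsProjection keep b c c') : InCode b k c' j ↔ InCode b k c j ∧ keep j := by
  constructor
  · rintro ⟨i, hi, hj⟩
    by_cases hk : digitAt b c i ≠ 0 ∧ keep (digitAt b c i - 1)
    · have h1 := (h i).1 hk
      refine ⟨⟨i, hi, h1.symm.trans hj⟩, ?_⟩
      have h2 := hk.2
      rwa [← h1, hj] at h2
    · rw [(h i).2 hk] at hj; omega
  · rintro ⟨⟨i, hi, hj⟩, hk⟩
    exact ⟨i, hi, by rw [(h i).1 ⟨by omega, by rwa [hj]⟩, hj]⟩

theorem IsProjection.goodCode {keep : ℕ → Prop} {cf : ℕ → ℕ → Prop} {b c c' : ℕ}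
    (h : IsProjection keep b c c') (hc : GoodCode cf b c) : GoodCode cf b c' := by
  intro i i' hi h0 h1
  have h2 : digitAt b c i ≠ 0 ∧ keep (digitAt b c i - 1) :=
    not_not.1 fun hk => h0 ((h i).2 hk)
  have h3 : digitAt b c i' ≠ 0 ∧ keep (digitAt b c i' - 1) :=
    not_not.1 fun hk => h1 ((h i').2 hk)
  rw [(h i).1 h2, (h i').1 h3]
  exact hc i i' hi h2.1 h3.1

theorem IsProjection.self {keep : ℕ → Prop} {b c c' : ℕ}
    (h : IsProjection keep b c c') : IsProjection keep b c' c' := by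
  refine fun i => ⟨fun _ => rfl, fun hk => ?_⟩
  by_cases h2 : digitAt b c i ≠ 0 ∧ keep (digitAt b c i - 1)
  · rw [(h i).1 h2] at hk; exact absurd h2 hk
  · exact (h i).2 h2

theorem IsProjection.unique {keep : ℕ → Prop} {b k c c' c'' : ℕ}
    (h : IsProjection keep b c c') (h' : IsProjection keep b c c'') (hc' : c' < b ^ k)
    (hc'' : c'' < b ^ k) : c' = c'' := by
  refine digitAt_ext hc' hc'' fun i _ => ?_
  by_cases h2 : digitAt b c i ≠ 0 ∧ keep (digitAt b c i - 1)
  · rw [(h i).1 h2, (h' i).1 h2]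
  · rw [(h i).2 h2, (h' i).2 h2]

/-- In a good code every element is listed once, as an element is in conflict with itself. -/
theorem GoodCode.sum_digits {cf : ℕ → ℕ → Prop} (hcf : ∀ a, cf a a) {b k c : ℕ}
    (hc : GoodCode cf b c) {S : Finset ℕ} (hS : ∀ j, j ∈ S ↔ InCode b k c j) {A : Type*}
    [AddCommMonoid A] (h : ℕ → A) (h0 : h 0 = 0) :
    ∑ i ∈ Finset.range k, h (digitAt b c i) = ∑ j ∈ S, h (j + 1) := by
  classical
  have hinj : ∀ i i', digitAt b c i ≠ 0 → digitAt b c i = digitAt b c i' → i = i' := by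
    intro i i' hi he
    rcases Nat.lt_trichotomy i i' with hlt | rfl | hlt
    · exact absurd (he ▸ hcf _) (hc i i' hlt hi (he ▸ hi))
    · rfl
    · exact absurd (he ▸ hcf _) (hc i' i hlt (he ▸ hi) hi)
  have e1 : ∑ i ∈ Finset.range k, h (digitAt b c i) =
      ∑ i ∈ (Finset.range k).filter (fun i => digitAt b c i ≠ 0), h (digitAt b c i) := by
    refine (Finset.sum_filter_of_ne (p := fun i => digitAt b c i ≠ 0) fun i _ hi h1 => ?_).symm
    rw [h1, h0] at hi
    exact hi rfl
  rw [e1]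
  refine Finset.sum_bij (fun i _ => digitAt b c i - 1) ?_ ?_ ?_ ?_
  · intro i hi
    simp only [Finset.mem_filter, Finset.mem_range] at hi
    exact (hS _).2 ⟨i, hi.1, by omega⟩
  · intro i hi i' hi' he
    simp only [Finset.mem_filter, Finset.mem_range] at hi hi'
    exact hinj i i' hi.2 (by omega)
  · intro j hj
    obtain ⟨i, hi, hij⟩ := (hS j).1 hj
    exact ⟨i, by simp [hi, hij], by simp [hij]⟩
  · intro i hi
    simp only [Finset.mem_filter, Finset.mem_range] at hi
    rw [Nat.sub_add_cancel (by omega)]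

/-- Elements of `E` that a projection forgets can be put in the blanks of a good code. -/
theorem GoodCode.exists_fill {cf : ℕ → ℕ → Prop} (hcf : ∀ a, cf a a)
    (hsymm : ∀ a b, cf a b → cf b a) {keep : ℕ → Prop} {p k c₀ : ℕ} (hc₀ : c₀ < (p + 1) ^ k)
    (hg : GoodCode cf (p + 1) c₀) {S : Finset ℕ} (hS : ∀ j, j ∈ S ↔ InCode (p + 1) k c₀ j)
    (E : Finset ℕ) (hE : ∀ j ∈ E, j < p ∧ ¬ keep j ∧ j ∉ S)
    (hind : ∀ a ∈ S ∪ E, ∀ b ∈ S ∪ E, a ≠ b → ¬ cf a b) (hcard : S.card + E.card ≤ k) :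
    ∃ c < (p + 1) ^ k, GoodCode cf (p + 1) c ∧ (∀ j, j ∈ S ∪ E ↔ InCode (p + 1) k c j) ∧
      ∀ c', IsProjection keep (p + 1) c₀ c' → IsProjection keep (p + 1) c c' := by
  classical
  induction E using Finset.induction_on with
  | empty => exact ⟨c₀, hc₀, hg, by simpa using hS, fun _ h => h⟩
  | insert e E heE ih =>
    rw [Finset.card_insert_of_notMem heE] at hcard
    obtain ⟨c, hc, hgc, hSc, hpr⟩ := ih (fun j hj => hE j (Finset.mem_insert_of_mem hj))
      (fun a ha b hb => hind a (by simp at ha ⊢; tauto) b (by simp at hb ⊢; tauto)) (by omega)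
    obtain ⟨hep, hke, heS⟩ := hE e (Finset.mem_insert_self _ _)
    -- The number of nonblank digits is the size of the set, so a blank is left.
    obtain ⟨z, hz, hz0⟩ : ∃ z < k, digitAt (p + 1) c z = 0 := by
      by_contra! hne
      have h1 := hgc.sum_digits hcf hSc (fun a => if a = 0 then 0 else 1) rfl
      have h2 : ∑ i ∈ Finset.range k, (if digitAt (p + 1) c i = 0 then 0 else 1) = k := by
        rw [Finset.sum_congr rfl fun i hi => if_neg (hne i (Finset.mem_range.1 hi))]
        simp
      rw [h2] at h1
      simp at h1
      have := Finset.card_union_le S E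
      omega
    obtain ⟨c', hc', hd⟩ := exists_digitAt_eq (b := p + 1) k
      (Function.update (digitAt (p + 1) c) z (e + 1)) (by
        intro i _
        by_cases hi : i = z
        · subst hi; simp; omega
        · rw [Function.update_of_ne hi]; exact digitAt_lt (by omega) _ _)
    have hdz : digitAt (p + 1) c' z = e + 1 := by rw [hd z hz]; simp
    have hdn : ∀ i ≠ z, digitAt (p + 1) c' i = digitAt (p + 1) c i := by
      intro i hi
      by_cases hik : i < k
      · rw [hd i hik]; simp [hi]
      · rw [digitAt_eq_zero (by omega) hc' (by omega), digitAt_eq_zero (by omega) hc (by omega)]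
    have heind : ∀ i ≠ z, digitAt (p + 1) c i ≠ 0 → ¬ cf e (digitAt (p + 1) c i - 1) := by
      intro i hi h0
      have hik : i < k := by
        by_contra hik
        exact h0 (digitAt_eq_zero (by omega) hc (by omega))
      have hmem := (hSc (digitAt (p + 1) c i - 1)).2 ⟨i, hik, by omega⟩
      have hmem' := hmem
      rw [Finset.mem_union] at hmem'
      refine hind e (by simp) _ (by simp; tauto) ?_
      rintro h1
      rw [← h1] at hmem'
      rcases hmem' with h2 | h2
      · exact heS h2
      · exact heE h2
    refine ⟨c', hc', ?_, ?_, ?_⟩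
    · intro i i' hi h0 h1
      by_cases hiz : i = z
      · subst hiz
        rw [hdn i' (by omega)] at h1 ⊢
        rw [hdz]
        exact heind i' (by omega) h1
      · rw [hdn i hiz] at h0 ⊢
        by_cases hiz' : i' = z
        · subst hiz'
          rw [hdz]
          exact fun h => heind i hiz h0 (hsymm _ _ h)
        · rw [hdn i' hiz'] at h1 ⊢
          exact hgc i i' hi h0 h1
    · intro j
      have h1 := hSc j
      simp only [Finset.mem_union, Finset.mem_insert] at h1 ⊢
      constructor
      · rintro (h | rfl | h)
        · obtain ⟨i, hi, hij⟩ := h1.1 (.inl h)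
          exact ⟨i, hi, by rw [hdn i (by rintro rfl; omega), hij]⟩
        · exact ⟨z, hz, hdz⟩
        · obtain ⟨i, hi, hij⟩ := h1.1 (.inr h)
          exact ⟨i, hi, by rw [hdn i (by rintro rfl; omega), hij]⟩
      · rintro ⟨i, hi, hij⟩
        by_cases hiz : i = z
        · subst hiz
          exact .inr (.inl (by omega))
        · rw [hdn i hiz] at hij
          have := h1.2 ⟨i, hi, hij⟩
          tauto
    · intro c'' hc'' i
      by_cases hiz : i = z
      · subst hiz
        rw [hdz]
        refine ⟨fun h => absurd h.2 (by simpa using hke), fun _ => ?_⟩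
        exact (hpr c'' hc'' i).2 (by simp [hz0])
      · rw [hdn i hiz]
        exact hpr c'' hc'' i

/-! ### Dynamic programming along an elimination order -/

/-- No two distinct elements of `I` are in conflict. -/
def IsConflictFree (cf : ℕ → ℕ → Prop) (I : Finset ℕ) : Prop :=
  ∀ a ∈ I, ∀ b ∈ I, a ≠ b → ¬ cf a b

/-- The nodes `0, …, q` without those eliminated in the first `i` steps. -/
def Remains (q : ℕ) (U : ℕ → ℕ) (i t : ℕ) : Prop := t ≤ q ∧ ∀ i' < i, U i' ≠ t

/-- A conflict relation `cf` on `0, …, p - 1`, bags `X t` for the nodes `t = 0, …, q`, and an order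
in which the nodes other than `q` can be eliminated: step `i` removes node `U i`, and every element
that `U i` shares with a remaining node is also in the bag of `V i`. Node `q` is an extra one with
empty bag. Any two conflicting elements have a common bag, and conflict-free subsets of a bag have
at most `k` elements. -/
structure EliminationScheme (p k q : ℕ) (cf X : ℕ → ℕ → Prop) (U V : ℕ → ℕ) : Prop where
  refl : ∀ a, cf a a
  symm : ∀ a b, cf a b → cf b a
  U_lt : ∀ i < q, U i < q
  U_inj : ∀ i < q, ∀ i' < q, U i = U i' → i = i'
  V_remains : ∀ i < q, Remains q U (i + 1) (V i)
  inter : ∀ i < q, ∀ j < p, X (U i) j → ∀ t, Remains q U (i + 1) t → X t j → X (V i) j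
  empty : ∀ j, ¬ X q j
  cover : ∀ j < p, ∃ t < q, X t j
  conflict : ∀ a < p, ∀ b < p, cf a b → ∃ t < q, X t a ∧ X t b
  small : ∀ t < q, ∀ S : Finset ℕ, (∀ j ∈ S, j < p ∧ X t j) → IsConflictFree cf S → S.card ≤ k

/-- `c` is a good code of the set of all `j ∈ I` in the bag `X t`. -/
structure Codes (p k : ℕ) (cf X : ℕ → ℕ → Prop) (t : ℕ) (I : Finset ℕ) (c : ℕ) : Prop where
  lt : c < (p + 1) ^ k
  good : GoodCode cf (p + 1) c
  mem : ∀ j, InCode (p + 1) k c j ↔ j ∈ I ∧ X t j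

/-- The weight of the elements of a code that are not in the bag of `v`. -/
noncomputable def gain (p k : ℕ) (X : ℕ → ℕ → Prop) (w : ℕ → ℚ) (v c : ℕ) : ℚ :=
  open Classical in
  ∑ i ∈ Finset.range k, if digitAt (p + 1) c i ≠ 0 ∧ ¬ X v (digitAt (p + 1) c i - 1) then
    w (digitAt (p + 1) c i - 1) else 0

/-- `c` is a good code of a subset of the bag of `u`. -/
def IsValid (p k : ℕ) (cf X : ℕ → ℕ → Prop) (u c : ℕ) : Prop :=
  c < (p + 1) ^ k ∧ GoodCode cf (p + 1) c ∧
    ∀ i, digitAt (p + 1) c i ≠ 0 → X u (digitAt (p + 1) c i - 1)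

open Classical in
/-- The invariant of the dynamic program after `i` eliminations: `F t c` is the largest weight of
forgotten elements that were collected at node `t` for the choice `c` in its bag. By `upper`, no
conflict-free set beats the tables, and by `lower` the values in the tables are attained. -/
structure TablesExact (p k q : ℕ) (cf X : ℕ → ℕ → Prop) (U : ℕ → ℕ) (w : ℕ → ℚ) (i : ℕ)
    (F : ℕ → ℕ → ℚ) : Prop where
  nonneg : ∀ t c, 0 ≤ F t c
  upper : ∀ I : Finset ℕ, (∀ j ∈ I, j < p) → IsConflictFree cf I → ∀ c : ℕ → ℕ,
    (∀ t, Remains q U i t → Codes p k cf X t I (c t)) →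
    ∑ j ∈ I, w j ≤ ∑ t ∈ (Finset.range (q + 1)).filter (Remains q U i), F t (c t) +
      ∑ j ∈ I.filter (fun j => ∃ t, Remains q U i t ∧ X t j), w j
  lower : ∀ I : Finset ℕ, (∀ j ∈ I, j < p) → IsConflictFree cf I →
    (∀ j ∈ I, ∃ t, Remains q U i t ∧ X t j) → ∀ c : ℕ → ℕ,
    (∀ t, Remains q U i t → Codes p k cf X t I (c t)) →
    ∃ I' : Finset ℕ, (∀ j ∈ I', j < p) ∧ IsConflictFree cf I' ∧
      (∀ j, (j ∈ I' ∧ ∃ t, Remains q U i t ∧ X t j) ↔ j ∈ I) ∧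
      ∑ j ∈ I', w j = ∑ t ∈ (Finset.range (q + 1)).filter (Remains q U i), F t (c t) +
        ∑ j ∈ I, w j

/-- The effect of one elimination step on the tables. -/
structure TablesStep (p k : ℕ) (cf X : ℕ → ℕ → Prop) (w : ℕ → ℚ) (u v : ℕ)
    (F F' : ℕ → ℕ → ℚ) (P : ℕ → ℕ) (M : ℕ → ℚ) : Prop where
  proj : ∀ c < (p + 1) ^ k, P c < (p + 1) ^ k ∧
    IsProjection (fun j => X u j ∧ X v j) (p + 1) c (P c)
  le : ∀ c, IsValid p k cf X u c → F u c + gain p k X w v c ≤ M (P c)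
  attained : ∀ c < (p + 1) ^ k, M c = 0 ∨
    ∃ c', IsValid p k cf X u c' ∧ P c' = c ∧ M c = F u c' + gain p k X w v c'
  eq_add : ∀ c < (p + 1) ^ k, F' v c = F v c + M (P c)
  eq_of_ne : ∀ t ≠ v, ∀ c, F' t c = F t c
  eq_of_le : ∀ t, ∀ c, (p + 1) ^ k ≤ c → F' t c = F t c

section

variable {p k q : ℕ} {cf X : ℕ → ℕ → Prop} {U V : ℕ → ℕ} {w : ℕ → ℚ}

theorem gain_nonneg (hw : ∀ j < p, 0 ≤ w j) (v c : ℕ) : 0 ≤ gain p k X w v c := by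
  refine Finset.sum_nonneg fun i _ => ?_
  split_ifs with h
  · have := digitAt_lt (Nat.succ_pos p) c i
    exact hw _ (by simp at this; omega)
  · exact le_rfl

open Classical in
theorem Codes.gain_eq (h : EliminationScheme p k q cf X U V) {u v c : ℕ} {I : Finset ℕ}
    (hc : Codes p k cf X u I c) :
    gain p k X w v c = ∑ j ∈ I.filter (fun j => X u j ∧ ¬ X v j), w j := by
  have := hc.good.sum_digits h.refl (S := I.filter (X u)) (k := k)
    (fun j => by rw [hc.mem j]; simp) (fun a => if a ≠ 0 ∧ ¬ X v (a - 1) then w (a - 1) else 0)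
    (by simp)
  rw [gain, this]
  simp only [ne_eq, Nat.succ_ne_zero, not_false_eq_true, true_and, Nat.add_sub_cancel]
  rw [← Finset.sum_filter, Finset.filter_filter]

theorem Codes.isValid {u c : ℕ} {I : Finset ℕ} (hc : Codes p k cf X u I c) :
    IsValid p k cf X u c := by
  refine ⟨hc.lt, hc.good, fun i h0 => ?_⟩
  have hik : i < k := by
    by_contra hik
    exact h0 (digitAt_eq_zero (by omega) hc.lt (by omega))
  exact ((hc.mem _).1 ⟨i, hik, by omega⟩).2

theorem remains_succ {i t : ℕ} : Remains q U (i + 1) t ↔ Remains q U i t ∧ U i ≠ t := by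
  constructor
  · rintro ⟨h, h'⟩
    exact ⟨⟨h, fun i' hi => h' i' (by omega)⟩, h' i (by omega)⟩
  · rintro ⟨⟨h, h'⟩, h''⟩
    refine ⟨h, fun i' hi => ?_⟩
    rcases Nat.lt_succ_iff_lt_or_eq.1 hi with h3 | rfl
    · exact h' i' h3
    · exact h''

theorem EliminationScheme.U_remains (h : EliminationScheme p k q cf X U V) {i : ℕ} (hi : i < q) :
    Remains q U i (U i) :=
  ⟨(h.U_lt i hi).le, fun i' hi' he => by have := h.U_inj i' (by omega) i hi he; omega⟩

theorem EliminationScheme.remains_final (h : EliminationScheme p k q cf X U V) (t : ℕ) :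
    Remains q U q t ↔ t = q := by
  classical
  constructor
  · rintro ⟨h1, h2⟩
    by_contra hne
    have h3 : (Finset.range q).image U = Finset.range q := by
      refine Finset.eq_of_subset_of_card_le (fun x hx => ?_) ?_
      · obtain ⟨i, hi, rfl⟩ := Finset.mem_image.1 hx
        exact Finset.mem_range.2 (h.U_lt i (Finset.mem_range.1 hi))
      · rw [Finset.card_image_of_injOn]
        intro i hi i' hi' he
        exact h.U_inj i (by simpa using hi) i' (by simpa using hi') he
    have h4 : t ∈ (Finset.range q).image U := by rw [h3]; simp; omega
    obtain ⟨i, hi, rfl⟩ := Finset.mem_image.1 h4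
    exact h2 i (by simpa using hi) rfl
  · rintro rfl
    exact ⟨le_rfl, fun i hi => (h.U_lt i hi).ne⟩

/-- Elements in conflict that both occur in remaining bags have a remaining bag in common. -/
theorem EliminationScheme.common (h : EliminationScheme p k q cf X U V) {i : ℕ} (hi : i ≤ q)
    {a b : ℕ} (ha : a < p) (hb : b < p) (hab : cf a b) (hta : ∃ t, Remains q U i t ∧ X t a)
    (htb : ∃ t, Remains q U i t ∧ X t b) : ∃ t, Remains q U i t ∧ X t a ∧ X t b := by
  induction i with
  | zero =>
    obtain ⟨t, ht, h'⟩ := h.conflict a ha b hb hab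
    exact ⟨t, ⟨ht.le, by simp⟩, h'⟩
  | succ i ih =>
    obtain ⟨ta, hta, hta'⟩ := hta
    obtain ⟨tb, htb, htb'⟩ := htb
    obtain ⟨t, ht, ha', hb'⟩ := ih (by omega) ⟨ta, (remains_succ.1 hta).1, hta'⟩
      ⟨tb, (remains_succ.1 htb).1, htb'⟩
    by_cases htu : U i = t
    · subst htu
      exact ⟨V i, h.V_remains i (by omega), h.inter i (by omega) a ha ha' ta hta hta',
        h.inter i (by omega) b hb hb' tb htb htb'⟩
    · exact ⟨t, remains_succ.2 ⟨ht, htu⟩, ha', hb'⟩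

/-- Before the first elimination every element is in a remaining bag, and nothing is forgotten. -/
theorem EliminationScheme.tablesExact_zero (h : EliminationScheme p k q cf X U V) :
    TablesExact p k q cf X U w 0 fun _ _ => 0 := by
  classical
  refine ⟨fun _ _ => le_rfl, fun I hI _ c _ => ?_, fun I hI hcf hal c _ => ⟨I, hI, hcf, ?_, ?_⟩⟩
  · have h1 : I.filter (fun j => ∃ t, Remains q U 0 t ∧ X t j) = I := by
      refine Finset.filter_true_of_mem fun j hj => ?_
      obtain ⟨t, ht, hX⟩ := h.cover j (hI j hj)
      exact ⟨t, ⟨ht.le, by simp⟩, hX⟩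
    rw [Finset.sum_const_zero, zero_add]
    convert le_of_eq (congrArg (fun S => ∑ j ∈ S, w j) h1.symm)
  · exact fun j => ⟨fun h => h.1, fun h => ⟨h, hal j h⟩⟩
  · simp

/-- A choice at the neighbour `V i` extends to a choice at `U i` without changing the projection:
the bound on conflict-free sets leaves enough blanks. -/
theorem EliminationScheme.exists_extension (h : EliminationScheme p k q cf X U V) {i : ℕ}
    (hi : i < q) {I : Finset ℕ} (hI : ∀ j ∈ I, j < p) (hcf : IsConflictFree cf I) {c c₁ : ℕ}
    (hc : Codes p k cf X (V i) I c)
    (hc₁ : IsProjection (fun j => X (U i) j ∧ X (V i) j) (p + 1) c c₁)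
    (hlt : c₁ < (p + 1) ^ k) :
    ∃ c', Codes p k cf X (U i) I c' ∧
      IsProjection (fun j => X (U i) j ∧ X (V i) j) (p + 1) c' c₁ := by
  classical
  have hm : ∀ j, j ∈ I.filter (fun j => X (U i) j ∧ X (V i) j) ↔ InCode (p + 1) k c₁ j := by
    intro j
    rw [hc₁.inCode_iff, hc.mem]
    simp; tauto
  have hun : I.filter (fun j => X (U i) j ∧ X (V i) j) ∪
      I.filter (fun j => X (U i) j ∧ ¬ X (V i) j) = I.filter (X (U i)) := by
    ext j; simp; tauto
  obtain ⟨c', h1, h2, h3, h4⟩ := (hc₁.goodCode hc.good).exists_fill h.refl h.symm hlt hm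
    (keep := fun j => X (U i) j ∧ X (V i) j)
    (I.filter (fun j => X (U i) j ∧ ¬ X (V i) j)) (by
      intro j hj
      simp only [Finset.mem_filter] at hj ⊢
      exact ⟨hI j hj.1, by tauto, by tauto⟩) (by
      rw [hun]
      intro a ha b hb
      exact hcf a (Finset.mem_filter.1 ha).1 b (Finset.mem_filter.1 hb).1) (by
      rw [← Finset.card_union_of_disjoint, hun]
      · refine h.small (U i) (h.U_lt i hi) _ (fun j hj => ?_) fun a ha b hb => ?_
        · exact ⟨hI j (Finset.mem_filter.1 hj).1, (Finset.mem_filter.1 hj).2⟩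
        · exact hcf a (Finset.mem_filter.1 ha).1 b (Finset.mem_filter.1 hb).1
      · refine Finset.disjoint_left.2 fun j hj hj' => ?_
        exact (Finset.mem_filter.1 hj').2.2 (Finset.mem_filter.1 hj).2.2)
  refine ⟨c', ⟨h1, h2, fun j => ?_⟩, h4 _ hc₁.self⟩
  rw [← h3 j, hun]
  simp

open Classical in
theorem sum_remains {i : ℕ} (h : EliminationScheme p k q cf X U V) (hi : i < q) (f : ℕ → ℚ) :
    ∑ t ∈ (Finset.range (q + 1)).filter (Remains q U i), f t =
      f (U i) + ∑ t ∈ (Finset.range (q + 1)).filter (Remains q U (i + 1)), f t := by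
  have h1 : (Finset.range (q + 1)).filter (Remains q U i) =
      insert (U i) ((Finset.range (q + 1)).filter (Remains q U (i + 1))) := by
    ext t
    simp only [Finset.mem_filter, Finset.mem_range, Finset.mem_insert, remains_succ]
    by_cases ht : t = U i
    · subst ht
      have := h.U_lt i hi
      simp [h.U_remains hi]; omega
    · simp [ht, Ne.symm ht]
  rw [h1, Finset.sum_insert]
  simp [remains_succ]

open Classical in
theorem sum_step {i : ℕ} (h : EliminationScheme p k q cf X U V) (hi : i < q)
    {F F' : ℕ → ℕ → ℚ} {P : ℕ → ℕ} {M : ℕ → ℚ}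
    (hS : TablesStep p k cf X w (U i) (V i) F F' P M) (c : ℕ → ℕ)
    (hc : c (V i) < (p + 1) ^ k) :
    ∑ t ∈ (Finset.range (q + 1)).filter (Remains q U (i + 1)), F' t (c t) =
      M (P (c (V i))) + ∑ t ∈ (Finset.range (q + 1)).filter (Remains q U (i + 1)), F t (c t) := by
  have hV : V i ∈ (Finset.range (q + 1)).filter (Remains q U (i + 1)) := by
    have := h.V_remains i hi
    simp only [Finset.mem_filter, Finset.mem_range]
    exact ⟨by have := this.1; omega, this⟩
  rw [← Finset.add_sum_erase _ _ hV, ← Finset.add_sum_erase _ _ hV, hS.eq_add _ hc]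
  rw [Finset.sum_congr rfl fun t ht => hS.eq_of_ne t (Finset.ne_of_mem_erase ht) (c t)]
  ring

/-- The step of the dynamic program. For `upper`, the choices for a conflict-free set `I` are
extended by a choice at `U i`, and the elements of `I` that are in no bag after the elimination are
paid for by the maximum. For `lower`, the elements of a maximizing choice at `U i` are added to
`I`. -/
theorem EliminationScheme.tablesExact_succ (h : EliminationScheme p k q cf X U V)
    (hw : ∀ j < p, 0 ≤ w j) {i : ℕ} (hi : i < q) {F F' : ℕ → ℕ → ℚ} {P : ℕ → ℕ} {M : ℕ → ℚ}
    (hF : TablesExact p k q cf X U w i F)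
    (hS : TablesStep p k cf X w (U i) (V i) F F' P M) :
    TablesExact p k q cf X U w (i + 1) F' := by
  classical
  have hVr := h.V_remains i hi
  have hUV : U i ≠ V i := (remains_succ.1 hVr).2
  have hM : ∀ c < (p + 1) ^ k, 0 ≤ M c := by
    intro c hc
    rcases hS.attained c hc with h0 | ⟨c', -, -, h0⟩
    · exact h0.ge
    · rw [h0]; exact add_nonneg (hF.nonneg _ _) (gain_nonneg hw _ _)
  refine ⟨?_, ?_, ?_⟩
  · intro t c
    by_cases hc : c < (p + 1) ^ k
    · by_cases ht : t = V i
      · subst ht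
        rw [hS.eq_add c hc]
        exact add_nonneg (hF.nonneg _ _) (hM _ (hS.proj c hc).1)
      · rw [hS.eq_of_ne t ht]; exact hF.nonneg _ _
    · rw [hS.eq_of_le t c (by omega)]; exact hF.nonneg _ _
  · intro I hI hcf c hc
    have hcV := hc (V i) hVr
    obtain ⟨hP, hP'⟩ := hS.proj _ hcV.lt
    obtain ⟨c', hc', hpr⟩ := h.exists_extension hi hI hcf hcV hP' hP
    have hPc : P c' = P (c (V i)) := (hS.proj c' hc'.lt).2.unique hpr (hS.proj c' hc'.lt).1 hP
    have h1 := hF.upper I hI hcf (Function.update c (U i) c') (fun t ht => by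
      by_cases htu : t = U i
      · subst htu; simpa using hc'
      · simpa [htu] using hc t (remains_succ.2 ⟨ht, Ne.symm htu⟩))
    rw [sum_remains h hi, Function.update_self] at h1
    have h2 : ∑ t ∈ (Finset.range (q + 1)).filter (Remains q U (i + 1)),
        F t (Function.update c (U i) c' t) =
        ∑ t ∈ (Finset.range (q + 1)).filter (Remains q U (i + 1)), F t (c t) := by
      refine Finset.sum_congr rfl fun t ht => ?_
      have := (remains_succ.1 (Finset.mem_filter.1 ht).2).2
      rw [Function.update_of_ne (Ne.symm this)]
    rw [h2] at h1
    rw [sum_step h hi hS c hcV.lt]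
    have h3 := hS.le c' hc'.isValid
    rw [hPc, hc'.gain_eq h] at h3
    have h4 : ∑ j ∈ I.filter (fun j => ∃ t, Remains q U i t ∧ X t j), w j ≤
        ∑ j ∈ I.filter (fun j => X (U i) j ∧ ¬ X (V i) j), w j +
        ∑ j ∈ I.filter (fun j => ∃ t, Remains q U (i + 1) t ∧ X t j), w j := by
      rw [← Finset.sum_union]
      · refine Finset.sum_le_sum_of_subset_of_nonneg (fun j hj => ?_) fun j hj _ => ?_
        · simp only [Finset.mem_filter, Finset.mem_union] at hj ⊢
          obtain ⟨hj, t, ht, hX⟩ := hj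
          by_cases hXV : X (V i) j
          · exact .inr ⟨hj, V i, hVr, hXV⟩
          · by_cases htu : U i = t
            · subst htu; exact .inl ⟨hj, hX, hXV⟩
            · exact .inr ⟨hj, t, remains_succ.2 ⟨ht, htu⟩, hX⟩
        · refine hw j (hI j ?_)
          simp only [Finset.mem_filter, Finset.mem_union] at hj
          tauto
      · refine Finset.disjoint_left.2 fun j hj hj' => ?_
        simp only [Finset.mem_filter] at hj hj'
        obtain ⟨_, t, ht, hX⟩ := hj'
        exact hj.2.2 (h.inter i hi j (hI j hj.1) hj.2.1 t ht hX)
    linarith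
  · intro I hI hcf hal c hc
    have hcV := hc (V i) hVr
    obtain ⟨hP, hP'⟩ := hS.proj _ hcV.lt
    -- The largest value for the projection is attained: the projection itself is a candidate.
    obtain ⟨c', hval, hPc, hMc⟩ : ∃ c', IsValid p k cf X (U i) c' ∧ P c' = P (c (V i)) ∧
        M (P (c (V i))) = F (U i) c' + gain p k X w (V i) c' := by
      rcases hS.attained _ hP with h0 | h0
      · have hPP : P (P (c (V i))) = P (c (V i)) :=
          (hS.proj _ hP).2.unique hP'.self (hS.proj _ hP).1 hP
        have hv : IsValid p k cf X (U i) (P (c (V i))) := by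
          refine ⟨hP, hP'.goodCode hcV.good, fun l hl => ?_⟩
          have := not_not.1 fun hk => hl ((hP'.self l).2 hk)
          exact this.2.1
        refine ⟨P (c (V i)), hv, hPP, ?_⟩
        have h1 := hS.le _ hv
        rw [hPP] at h1
        have h2 := hF.nonneg (U i) (P (c (V i)))
        have h3 := gain_nonneg (k := k) (X := X) hw (V i) (P (c (V i)))
        linarith
      · exact h0
    -- `S` is the set with code `c'`. It agrees with `I` on the bag of `V i`, and all other elements
    -- of `S` are in no remaining bag, so `I ∪ S` is again conflict-free.
    set S : Finset ℕ := (Finset.range p).filter (InCode (p + 1) k c') with hSdef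
    have hSm : ∀ j, j ∈ S ↔ InCode (p + 1) k c' j := fun j => by
      simp only [hSdef, Finset.mem_filter, Finset.mem_range, and_iff_right_iff_imp]
      exact InCode.lt
    have hSp : ∀ j ∈ S, j < p := fun j hj => ((hSm j).1 hj).lt
    have hSU : ∀ j ∈ S, X (U i) j := by
      intro j hj
      obtain ⟨l, hl, hlj⟩ := (hSm j).1 hj
      have := hval.2.2 l (by omega)
      rwa [hlj] at this
    have hSV : ∀ j, j ∈ S ∧ X (V i) j ↔ j ∈ I ∧ X (V i) j ∧ X (U i) j := by
      intro j
      have h1 := (hS.proj c' hval.1).2.inCode_iff (k := k) (j := j)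
      have h2 := hP'.inCode_iff (k := k) (j := j)
      rw [hPc] at h1
      rw [h1, ← hSm j, hcV.mem] at h2
      have := hSU j
      tauto
    have hIU : ∀ j ∈ I, X (U i) j → j ∈ S := by
      intro j hj hX
      obtain ⟨t, ht, hXt⟩ := hal j hj
      exact ((hSV j).2 ⟨hj, h.inter i hi j (hI j hj) hX t ht hXt, hX⟩).1
    have hSt : ∀ j ∈ S, ∀ t, Remains q U (i + 1) t → X t j → j ∈ I := by
      intro j hj t ht hX
      exact ((hSV j).1 ⟨hj, h.inter i hi j (hSp j hj) (hSU j hj) t ht hX⟩).1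
    have hSS : IsConflictFree cf S := by
      intro a ha b hb hab
      obtain ⟨l, hl, hla⟩ := (hSm a).1 ha
      obtain ⟨l', hl', hlb⟩ := (hSm b).1 hb
      rcases Nat.lt_trichotomy l l' with hlt | rfl | hlt
      · have := hval.2.1 l l' hlt (by omega) (by omega)
        simpa [hla, hlb] using this
      · omega
      · have := hval.2.1 l' l hlt (by omega) (by omega)
        rw [hla, hlb] at this
        exact fun hc => this (h.symm _ _ hc)
    have hcross : ∀ a ∈ I, ∀ b ∈ S, a ≠ b → ¬ cf a b := by
      intro a ha b hb hne hab
      obtain ⟨t, ht, hX⟩ := hal a ha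
      obtain ⟨t', ht', hXa, hXb⟩ := h.common hi.le (hI a ha) (hSp b hb) hab
        ⟨t, (remains_succ.1 ht).1, hX⟩ ⟨U i, h.U_remains hi, hSU b hb⟩
      by_cases htu : U i = t'
      · subst htu
        exact hSS a (hIU a ha hXa) b hb hne hab
      · exact hcf a ha b (hSt b hb t' (remains_succ.2 ⟨ht', htu⟩) hXb) hne hab
    obtain ⟨I', hI', hcf', hal', hsum⟩ := hF.lower (I ∪ S)
      (fun j hj => (Finset.mem_union.1 hj).elim (hI j) (hSp j)) (by
        intro a ha b hb hne
        rcases Finset.mem_union.1 ha with ha | ha <;> rcases Finset.mem_union.1 hb with hb | hb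
        · exact hcf a ha b hb hne
        · exact hcross a ha b hb hne
        · exact fun hab => hcross b hb a ha hne.symm (h.symm _ _ hab)
        · exact hSS a ha b hb hne)
      (fun j hj => by
        rcases Finset.mem_union.1 hj with hj | hj
        · obtain ⟨t, ht, hX⟩ := hal j hj
          exact ⟨t, (remains_succ.1 ht).1, hX⟩
        · exact ⟨U i, h.U_remains hi, hSU j hj⟩)
      (Function.update c (U i) c') (fun t ht => by
        by_cases htu : t = U i
        · subst htu
          rw [Function.update_self]
          refine ⟨hval.1, hval.2.1, fun j => ?_⟩
          rw [← hSm j, Finset.mem_union]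
          exact ⟨fun hj => ⟨.inr hj, hSU j hj⟩,
            fun hj => hj.1.elim (fun hj' => hIU j hj' hj.2) id⟩
        · rw [Function.update_of_ne htu]
          have ht' := remains_succ.2 ⟨ht, Ne.symm htu⟩
          obtain ⟨h1, h2, h3⟩ := hc t ht'
          refine ⟨h1, h2, fun j => ?_⟩
          rw [h3 j, Finset.mem_union]
          exact ⟨fun hj => ⟨.inl hj.1, hj.2⟩,
            fun hj => ⟨hj.1.elim id fun hj' => hSt j hj' t ht' hj.2, hj.2⟩⟩)
    refine ⟨I', hI', hcf', fun j => ?_, ?_⟩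
    · have h1 := hal' j
      rw [Finset.mem_union] at h1
      constructor
      · rintro ⟨hj, t, ht, hX⟩
        exact (h1.1 ⟨hj, t, (remains_succ.1 ht).1, hX⟩).elim id fun hj' => hSt j hj' t ht hX
      · intro hj
        exact ⟨(h1.2 (.inl hj)).1, hal j hj⟩
    · rw [hsum, sum_remains h hi, Function.update_self, sum_step h hi hS c hcV.lt, hMc]
      have h2 : ∑ t ∈ (Finset.range (q + 1)).filter (Remains q U (i + 1)),
          F t (Function.update c (U i) c' t) =
          ∑ t ∈ (Finset.range (q + 1)).filter (Remains q U (i + 1)), F t (c t) := by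
        refine Finset.sum_congr rfl fun t ht => ?_
        have := (remains_succ.1 (Finset.mem_filter.1 ht).2).2
        rw [Function.update_of_ne (Ne.symm this)]
      have hC : Codes p k cf X (U i) S c' :=
        ⟨hval.1, hval.2.1, fun j => by
          rw [← hSm j]; exact ⟨fun hj => ⟨hj, hSU j hj⟩, fun hj => hj.1⟩⟩
      have h3 : ∑ j ∈ I ∪ S, w j = ∑ j ∈ I, w j +
          ∑ j ∈ S.filter (fun j => X (U i) j ∧ ¬ X (V i) j), w j := by
        rw [← Finset.sum_union]
        · congr 1
          ext j
          simp only [Finset.mem_union, Finset.mem_filter]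
          have := hSU j
          have := hSV j
          tauto
        · refine Finset.disjoint_left.2 fun j hj hj' => ?_
          obtain ⟨hj1, hj2, hj3⟩ := Finset.mem_filter.1 hj'
          obtain ⟨t, ht, hX⟩ := hal j hj
          exact hj3 (h.inter i hi j (hI j hj) hj2 t ht hX)
      rw [h2, h3, hC.gain_eq h]
      ring

/-- `x` is the largest weight of a conflict-free subset of `0, …, p - 1`. -/
structure IsMaxWeight (p : ℕ) (cf : ℕ → ℕ → Prop) (w : ℕ → ℚ) (x : ℚ) : Prop where
  le : ∀ I : Finset ℕ, (∀ j ∈ I, j < p) → IsConflictFree cf I → ∑ j ∈ I, w j ≤ x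
  attained : ∃ I : Finset ℕ, (∀ j ∈ I, j < p) ∧ IsConflictFree cf I ∧ ∑ j ∈ I, w j = x

/-- After all eliminations only the extra node `q` remains, with the empty choice. -/
theorem EliminationScheme.isMaxWeight (h : EliminationScheme p k q cf X U V) {F : ℕ → ℕ → ℚ}
    (hF : TablesExact p k q cf X U w q F) : IsMaxWeight p cf w (F q 0) := by
  classical
  have hin : ∀ j, ¬ InCode (p + 1) k 0 j := by
    rintro j ⟨i, -, hi⟩
    rw [digitAt_of_zero] at hi; omega
  have hc : ∀ I : Finset ℕ, ∀ t, Remains q U q t → Codes p k cf X t I 0 := by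
    intro I t ht
    rw [h.remains_final] at ht
    subst ht
    refine ⟨by positivity, ?_, fun j => ?_⟩
    · intro i i' _ h0
      rw [digitAt_of_zero] at h0; omega
    · simp [hin, h.empty]
  have hs : (Finset.range (q + 1)).filter (Remains q U q) = {q} := by
    ext t
    simp [h.remains_final]
  refine ⟨fun I hI hcf => ?_, ?_⟩
  · have h1 := hF.upper I hI hcf (fun _ => 0) (hc I)
    rw [hs, Finset.sum_singleton, Finset.filter_false_of_mem] at h1
    · simpa using h1
    · rintro j - ⟨t, ht, hX⟩
      rw [h.remains_final] at ht
      subst ht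
      exact h.empty j hX
  · obtain ⟨I', hI', hcf', -, hsum⟩ := hF.lower ∅ (by simp) (by simp [IsConflictFree]) (by simp)
      (fun _ => 0) (hc ∅)
    rw [hs] at hsum
    exact ⟨I', hI', hcf', by simpa using hsum⟩

end

/-! ### Rooted trees -/

/-- The parent function of a tree on `0, …, q - 1`, with `q` as the parent of the root. -/
structure IsParentFunction {q : ℕ} (T : SimpleGraph (Fin q)) (root : ℕ) (par depth : ℕ → ℕ) :
    Prop where
  le : ∀ t, par t ≤ q
  of_le : ∀ t, q ≤ t → par t = q
  eq_iff : ∀ t < q, par t = q ↔ t = root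
  depth_lt : ∀ t < q, par t < q → depth (par t) < depth t
  adj_iff : ∀ s t : Fin q, T.Adj s t ↔ par s = t ∨ par t = s

/-- The parent of a node is the second node on the path to the root. -/
theorem SimpleGraph.IsTree.exists_isParentFunction {q : ℕ} {T : SimpleGraph (Fin q)}
    (hT : T.IsTree) (root : Fin q) : ∃ par depth : ℕ → ℕ, IsParentFunction T root par depth := by
  classical
  choose P hP hlen using fun t : Fin q => hT.connected.exists_path_of_dist t root
  have hchild : ∀ s t : Fin q, T.Adj s t → T.dist t root < T.dist s root → (P s).snd = t := by
    intro s t hst hlt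
    have hs : s ∉ (P t).support := by
      intro hs
      have h1 := SimpleGraph.dist_le ((P t).dropUntil s hs)
      have h2 := (P t).length_dropUntil_le_length hs
      have := hlen t
      omega
    have h1 : (SimpleGraph.Walk.cons hst (P t)).IsPath := (hP t).cons hs
    have h2 := (hT.existsUnique_path s root).unique h1 (hP s)
    rw [← h2, SimpleGraph.Walk.snd_cons]
  have hadj : ∀ s t : Fin q, s ≠ root → (P s).snd = t →
      T.Adj s t ∧ T.dist t root < T.dist s root := by
    rintro s t hs rfl
    have hnil : ¬ (P s).Nil := SimpleGraph.Walk.not_nil_of_ne hs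
    refine ⟨(P s).adj_snd hnil, ?_⟩
    have h1 := SimpleGraph.dist_le (P s).tail
    have h2 := SimpleGraph.Walk.length_tail_add_one hnil
    have := hlen s
    omega
  refine ⟨fun t => if h : t < q then if (⟨t, h⟩ : Fin q) = root then q else
    ((P ⟨t, h⟩).snd : ℕ) else q, fun t => if h : t < q then T.dist ⟨t, h⟩ root else 0,
    fun t => ?_, fun t ht => ?_, fun t ht => ?_, fun t ht h => ?_, fun s t => ?_⟩
  · split_ifs <;> omega
  · simp [Nat.not_lt.2 ht]
  · simp only [ht, dif_pos]
    split_ifs with h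
    · simp [← h]
    · simp only [Fin.ext_iff] at h
      have := (P ⟨t, ht⟩).snd.isLt
      constructor <;> intro h' <;> omega
  · simp only [ht, dif_pos] at h ⊢
    split_ifs at h ⊢ with h1
    · omega
    · exact (hadj _ _ h1 rfl).2
  · simp only [s.isLt, t.isLt, dif_pos, Fin.eta]
    constructor
    · intro h
      rcases hT.dist_eq_dist_add_one_of_adj root h with h1 | h1
      · left
        rw [SimpleGraph.dist_comm, SimpleGraph.dist_comm (v := t)] at h1
        have hs : s ≠ root := by rintro rfl; simp at h1
        rw [if_neg hs, hchild s t h (by omega)]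
      · right
        rw [SimpleGraph.dist_comm, SimpleGraph.dist_comm (v := s)] at h1
        have ht : t ≠ root := by rintro rfl; simp at h1
        rw [if_neg ht, hchild t s h.symm (by omega)]
    · rintro (h | h)
      · split_ifs at h with h1
        · have := t.isLt; omega
        · exact (hadj s t h1 (Fin.ext h)).1
      · split_ifs at h with h1
        · have := s.isLt; omega
        · exact (hadj t s h1 (Fin.ext h)).1.symm

/-- A sum over the edges of a tree is a sum over its nodes other than the root. -/
theorem IsParentFunction.sum_edges {q : ℕ} {T : SimpleGraph (Fin q)} {root : ℕ}
    {par depth : ℕ → ℕ} (hp : IsParentFunction T root par depth) {l : List (Fin q × Fin q)}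
    (hl : ListsEdges T.edgeSet l) (g : ℕ → ℕ → ℕ) (hg : ∀ a b, g a b = g b a) :
    (l.map fun e => g e.1 e.2).sum =
      ∑ s ∈ (Finset.range q).filter (· ≠ root), g s (par s) := by
  classical
  rcases Nat.eq_zero_or_pos q with rfl | hq
  · cases l with
    | nil => simp
    | cons e l => exact e.1.elim0
  obtain ⟨q, rfl⟩ : ∃ q', q = q' + 1 := ⟨q - 1, by omega⟩
  let f : Sym2 (Fin (q + 1)) → ℕ := Sym2.lift ⟨fun a b => g a b, fun a b => hg a b⟩
  have h1 : (l.map fun e => g e.1 e.2) = (l.map fun e => s(e.1, e.2)).map f := by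
    simp [f, Function.comp_def]
  rw [h1, ← List.sum_toFinset _ hl.1]
  have hval : ∀ x < q + 1, ((Fin.ofNat (q + 1) x : Fin (q + 1)) : ℕ) = x := fun x hx => by
    simp [Nat.mod_eq_of_lt hx]
  have hpar : ∀ s < q + 1, s ≠ root → par s < q + 1 := fun s hs hr =>
    lt_of_le_of_ne (hp.le s) fun h => hr ((hp.eq_iff s hs).1 h)
  refine (Finset.sum_bij (fun s _ => s(Fin.ofNat (q + 1) s, Fin.ofNat (q + 1) (par s)))
    ?_ ?_ ?_ ?_).symm
  · intro s hs
    simp only [Finset.mem_filter, Finset.mem_range] at hs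
    rw [List.mem_toFinset, hl.2, SimpleGraph.mem_edgeSet, hp.adj_iff, hval s hs.1,
      hval _ (hpar s hs.1 hs.2)]
    exact .inl rfl
  · intro s hs s' hs' h
    simp only [Finset.mem_filter, Finset.mem_range] at hs hs'
    have h2 := hpar s hs.1 hs.2
    have h3 := hpar s' hs'.1 hs'.2
    rcases Sym2.eq_iff.1 h with h | h
    · have := congrArg Fin.val h.1
      rwa [hval _ hs.1, hval _ hs'.1] at this
    · have h4 := congrArg Fin.val h.1
      have h5 := congrArg Fin.val h.2
      rw [hval _ hs.1, hval _ h3] at h4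
      rw [hval _ h2, hval _ hs'.1] at h5
      have h6 := hp.depth_lt s hs.1 h2
      have h7 := hp.depth_lt s' hs'.1 h3
      rw [h5] at h6
      rw [← h4] at h7
      omega
  · intro e he
    rw [List.mem_toFinset, hl.2] at he
    induction e with
    | h a b =>
      have hnr : ∀ a b : Fin (q + 1), par a = b → (a : ℕ) ≠ root := fun a b h h' => by
        have := (hp.eq_iff a a.isLt).2 h'
        have := b.isLt
        omega
      rcases (hp.adj_iff a b).1 he with h | h
      · exact ⟨a, Finset.mem_filter.2 ⟨Finset.mem_range.2 a.isLt, hnr a b h⟩, by simp [h]⟩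
      · exact ⟨b, Finset.mem_filter.2 ⟨Finset.mem_range.2 b.isLt, hnr b a h⟩,
          by simp [h, Sym2.eq_swap]⟩
  · intro s hs
    simp only [Finset.mem_filter, Finset.mem_range] at hs
    simp only [Sym2.lift_mk, hval s hs.1, hval _ (hpar s hs.1 hs.2)]

/-- An order of elimination in which every node comes before its parent. -/
structure IsLeafOrder (q : ℕ) (par U : ℕ → ℕ) : Prop where
  lt : ∀ i < q, U i < q
  inj : ∀ i < q, ∀ i' < q, U i = U i' → i = i'
  no_child : ∀ i < q, ∀ s < q, (∀ i' < i, U i' ≠ s) → par s ≠ U i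

theorem IsLeafOrder.parent_remains {q : ℕ} {T : SimpleGraph (Fin q)} {root : ℕ}
    {par depth U : ℕ → ℕ} (hp : IsParentFunction T root par depth) (hU : IsLeafOrder q par U)
    {i : ℕ} (hi : i < q) : Remains q U (i + 1) (par (U i)) := by
  refine ⟨hp.le _, fun i' hi' h => ?_⟩
  refine hU.no_child i' (by omega) (U i) (hU.lt i hi) (fun l hl he => ?_) h.symm
  have := hU.inj l (by omega) i hi he
  omega

/-- If a connected set of nodes contains `U i` and a node that remains after its elimination, it
contains the parent of `U i`: all other descendants of `U i` are gone. -/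
theorem IsLeafOrder.parent_mem {q : ℕ} {T : SimpleGraph (Fin q)} {root : ℕ}
    {par depth U : ℕ → ℕ} (hp : IsParentFunction T root par depth) (hU : IsLeafOrder q par U)
    {i : ℕ} (hi : i < q) {A : Set (Fin q)} {u t : Fin q} (hu : U i = u)
    (ht : Remains q U (i + 1) t)
    (hpath : Relation.ReflTransGen (fun x y => T.Adj x y ∧ y ∈ A) u t) :
    ∃ v ∈ A, par (U i) = v := by
  let Desc : ℕ → Prop := fun x => Relation.ReflTransGen (fun x y => par x = y) x u
  have hnd : ∀ x, Desc x → Remains q U (i + 1) x → False := by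
    intro x hx
    induction hx using Relation.ReflTransGen.head_induction_on with
    | refl => exact fun h => h.2 i (by omega) hu
    | @head x y hxy _ ih =>
      intro hx
      refine ih ⟨hxy ▸ hp.le x, fun i' hi' he => ?_⟩
      have hxq : x < q := by
        by_contra hxq
        have := hp.of_le x (by omega)
        have := hU.lt i' (by omega)
        omega
      refine hU.no_child i' (by omega) x hxq (fun l hl => hx.2 l (by omega)) ?_
      rw [hxy, he]
  have key : ∀ x : Fin q, Relation.ReflTransGen (fun x y => T.Adj x y ∧ y ∈ A) u x →
      Desc x ∨ ∃ v ∈ A, par (U i) = v := by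
    intro x hx
    induction hx with
    | refl => exact .inl .refl
    | @tail x y _ hxy ih =>
      rcases ih with ih | ih
      · rcases (hp.adj_iff x y).1 hxy.1 with h | h
        · rcases Relation.ReflTransGen.cases_head ih with h' | ⟨z, hz, hz'⟩
          · exact .inr ⟨y, hxy.2, by rw [hu, ← h', h]⟩
          · left
            rw [← h, hz]; exact hz'
        · exact .inl (.head h ih)
      · exact .inr ih
  exact (key t hpath).elim (fun h => (hnd _ h ht).elim) id

/-! ### Conflicts and bags of a family of subgraphs -/

section

variable {n q p : ℕ} {G : SimpleGraph (Fin n)}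

/-- `v` is at distance at most `x` from subgraph number `j`. -/
def Near (H : Fin p → G.Subgraph) (j : Fin p) (x : ℕ) (v : Fin n) : Prop :=
  ∃ u ∈ (H j).verts, G.edist u v ≤ x

/-- The subgraphs `a` and `b` are too close to be in the same packing. -/
def Conflict (d : ℕ) (H : Fin p → G.Subgraph) (a b : ℕ) : Prop :=
  a = b ∨ ∃ (ha : a < p) (hb : b < p), setDist G (H ⟨a, ha⟩).verts (H ⟨b, hb⟩).verts < d

/-- Bag `t` contains a vertex at distance at most `r` from subgraph `j`. -/
def Meets (r : ℕ) (D : TreeDecomposition G (Fin q)) (H : Fin p → G.Subgraph) (t j : ℕ) : Prop :=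
  ∃ (ht : t < q) (hj : j < p), ∃ v ∈ D.bag ⟨t, ht⟩, Near H ⟨j, hj⟩ r v

theorem setDist_lt_iff {V : Type*} {G : SimpleGraph V} {A B : Set V} {d : ℕ∞} :
    setDist G A B < d ↔ ∃ u ∈ A, ∃ v ∈ B, G.edist u v < d := by
  simp [setDist, iInf_lt_iff]

theorem setDist_comm {V : Type*} (G : SimpleGraph V) (A B : Set V) :
    setDist G A B = setDist G B A := by
  have h : ∀ A B : Set V, setDist G A B ≤ setDist G B A := fun A B => by
    refine le_iInf₂ fun u hu => le_iInf₂ fun v hv => ?_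
    rw [SimpleGraph.edist_comm]
    exact iInf₂_le_of_le v hv (iInf₂_le u hu)
  exact le_antisymm (h A B) (h B A)

/-- Vertices at distance at most `2 r + 1` are within distance `r` of two vertices that are equal
or adjacent. -/
theorem exists_middle {V : Type*} {G : SimpleGraph V} {u v : V} {r : ℕ}
    (h : G.edist u v < (2 * r + 2 : ℕ)) :
    ∃ x y, (x = y ∨ G.Adj x y) ∧ G.edist u x ≤ r ∧ G.edist v y ≤ r := by
  obtain ⟨w, hw⟩ := SimpleGraph.exists_walk_of_edist_ne_top (ne_top_of_lt h)
  rw [← hw] at h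
  have hlen : w.length < 2 * r + 2 := by exact_mod_cast h
  refine ⟨w.getVert r, w.getVert (r + 1), ?_, ?_, ?_⟩
  · by_cases hr : r < w.length
    · exact .inr (w.adj_getVert_succ hr)
    · left
      rw [w.getVert_of_length_le (by omega), w.getVert_of_length_le (by omega)]
  · refine (SimpleGraph.edist_le (w.take r)).trans ?_
    simp
  · rw [SimpleGraph.edist_comm]
    refine (SimpleGraph.edist_le (w.drop (r + 1))).trans ?_
    simp
    norm_cast
    omega

theorem Near.edist_lt {H : Fin p → G.Subgraph} {a b : Fin p} {r : ℕ} {x y : Fin n}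
    (hx : Near H a r x) (hy : Near H b r y) (hxy : x = y ∨ G.Adj x y) :
    setDist G (H a).verts (H b).verts < (2 * r + 2 : ℕ) := by
  obtain ⟨u, hu, hux⟩ := hx
  obtain ⟨v, hv, hvy⟩ := hy
  rw [setDist_lt_iff]
  refine ⟨u, hu, v, hv, ?_⟩
  have h1 : G.edist x y ≤ 1 := SimpleGraph.edist_le_one_iff_adj_or_eq.2 hxy.symm
  have h2 : G.edist u v ≤ G.edist u x + (G.edist x y + G.edist y v) :=
    SimpleGraph.edist_triangle.trans (by gcongr; exact SimpleGraph.edist_triangle)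
  rw [SimpleGraph.edist_comm (u := y)] at h2
  refine lt_of_le_of_lt (h2.trans (add_le_add hux (add_le_add h1 hvy))) ?_
  norm_cast
  omega

/-- The nodes whose bags meet a ball around a connected subgraph form a connected set. -/
theorem reflTransGen_meets (D : TreeDecomposition G (Fin q)) (H : Fin p → G.Subgraph) {j : ℕ}
    (hj : j < p) (hH : (H ⟨j, hj⟩).Connected) {r : ℕ} {s t : Fin q} (hs : Meets r D H s j)
    (ht : Meets r D H t j) :
    Relation.ReflTransGen (fun x y => D.tree.Adj x y ∧ y ∈ {y : Fin q | Meets r D H y j}) s t := by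
  set A : Set (Fin q) := {y : Fin q | Meets r D H y j} with hA
  -- All nodes with `u` in their bags are joined within `A` to all those with `v` in their bags.
  let Linked : Fin n → Fin n → Prop := fun u v => ∀ s t : Fin q, u ∈ D.bag s → v ∈ D.bag t →
    Relation.ReflTransGen (fun x y => D.tree.Adj x y ∧ y ∈ A) s t
  have htrans : ∀ u v w, Linked u v → Linked v w → Linked u w := by
    intro u v w h1 h2 s t hs ht
    obtain ⟨x, hx⟩ := D.vertex_mem v
    exact (h1 s x hs hx).trans (h2 x t hx ht)
  have hself : ∀ v, Near H ⟨j, hj⟩ r v → Linked v v := by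
    intro v hv s t hs ht
    have h1 := (D.connected v).preconnected ⟨s, hs⟩ ⟨t, ht⟩
    rw [SimpleGraph.reachable_iff_reflTransGen] at h1
    refine h1.lift (fun x : {t : Fin q | v ∈ D.bag t} => (x : Fin q)) fun x y hxy => ⟨?_, ?_⟩
    · exact hxy
    · exact ⟨y.1.isLt, hj, v, y.2, hv⟩
  have hadj : ∀ u v, Near H ⟨j, hj⟩ r u → Near H ⟨j, hj⟩ r v → G.Adj u v → Linked u v := by
    intro u v hu hv huv s t hs ht
    obtain ⟨x, hxu, hxv⟩ := D.edge_mem u v huv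
    exact (hself u hu s x hs hxu).trans (hself v hv x t hxv ht)
  have hnear : ∀ u ∈ (H ⟨j, hj⟩).verts, Near H ⟨j, hj⟩ r u := fun u hu => ⟨u, hu, by simp⟩
  have hsub : ∀ u v, u ∈ (H ⟨j, hj⟩).verts → v ∈ (H ⟨j, hj⟩).verts → Linked u v := by
    intro u v hu hv
    obtain ⟨w⟩ := hH.coe.preconnected ⟨u, hu⟩ ⟨v, hv⟩
    have : ∀ (x y : (H ⟨j, hj⟩).verts) (w : (H ⟨j, hj⟩).coe.Walk x y), Linked x y := by
      intro x y w
      induction w with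
      | nil => exact hself _ (hnear _ (Subtype.mem _))
      | cons h _ ih =>
        exact htrans _ _ _ (hadj _ _ (hnear _ (Subtype.mem _)) (hnear _ (Subtype.mem _))
          ((H ⟨j, hj⟩).adj_sub h)) ih
    exact this _ _ w
  have hball : ∀ v, Near H ⟨j, hj⟩ r v →
      ∃ u ∈ (H ⟨j, hj⟩).verts, Linked u v ∧ Linked v u := by
    rintro v ⟨u, hu, huv⟩
    have hne : G.edist u v ≠ ⊤ := ne_top_of_le_ne_top (by simp) huv
    obtain ⟨w, hw⟩ := SimpleGraph.exists_walk_of_edist_ne_top hne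
    rw [← hw] at huv
    have hlen : w.length ≤ r := by exact_mod_cast huv
    refine ⟨u, hu, ?_⟩
    have : ∀ i ≤ w.length, Near H ⟨j, hj⟩ r (w.getVert i) ∧ Linked u (w.getVert i) ∧
        Linked (w.getVert i) u := by
      intro i
      induction i with
      | zero =>
        intro _
        rw [w.getVert_zero]
        exact ⟨hnear u hu, hself u (hnear u hu), hself u (hnear u hu)⟩
      | succ i ih =>
        intro hi
        obtain ⟨h1, h2, h3⟩ := ih (by omega)
        have h4 := w.adj_getVert_succ (i := i) (by omega)
        have h5 : Near H ⟨j, hj⟩ r (w.getVert (i + 1)) := by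
          refine ⟨u, hu, (SimpleGraph.edist_le (w.take (i + 1))).trans ?_⟩
          simp
          omega
        exact ⟨h5, htrans _ _ _ h2 (hadj _ _ h1 h5 h4), htrans _ _ _ (hadj _ _ h5 h1 h4.symm) h3⟩
    have h := this w.length le_rfl
    rw [w.getVert_length] at h
    exact h.2
  obtain ⟨_, _, u, hu, hu'⟩ := hs
  obtain ⟨_, _, v, hv, hv'⟩ := ht
  obtain ⟨u', hu1, -, hu2⟩ := hball u hu'
  obtain ⟨v', hv1, hv2, -⟩ := hball v hv'
  exact htrans _ _ _ hu2 (htrans _ _ _ (hsub u' v' hu1 hv1) hv2) s t hu hv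

/-- Representatives in bag `t` of the members of a packing are an independent set, so there are at
most `k` of them. -/
theorem card_le_of_meets {k r : ℕ} (D : TreeDecomposition G (Fin q)) (H : Fin p → G.Subgraph)
    (hk : D.indepNumber ≤ k) {t : ℕ} (ht : t < q) (S : Finset ℕ)
    (hS : ∀ j ∈ S, j < p ∧ Meets r D H t j) (hcf : IsConflictFree (Conflict (2 * r + 2) H) S) :
    S.card ≤ k := by
  classical
  choose hjp hmeet using hS
  choose _ _ f hf hnear using hmeet
  let g : {j // j ∈ S} → (D.bag ⟨t, ht⟩ : Set (Fin n)) := fun j => ⟨f j.1 j.2, hf j.1 j.2⟩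
  have hsep : ∀ a b : {j // j ∈ S}, a ≠ b → ¬ ((g a : Fin n) = g b ∨ G.Adj (g a) (g b)) := by
    intro a b hab h
    refine hcf a a.2 b b.2 (fun h => hab (Subtype.ext h)) (.inr ⟨hjp a a.2, hjp b b.2, ?_⟩)
    exact (hnear a a.2).edist_lt (hnear b b.2) h
  have hinj : Function.Injective g := by
    intro a b h
    by_contra hab
    exact hsep a b hab (.inl (congrArg Subtype.val h))
  have h1 : (G.induce (D.bag ⟨t, ht⟩ : Set (Fin n))).IsIndepSet
      ((Finset.univ.image g : Finset _) : Set (D.bag ⟨t, ht⟩ : Set (Fin n))) := by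
    intro x hx y hy hxy
    simp only [Finset.coe_image, Finset.coe_univ, Set.image_univ, Set.mem_range] at hx hy
    obtain ⟨a, rfl⟩ := hx
    obtain ⟨b, rfl⟩ := hy
    exact fun h => hsep a b (fun h => hxy (by rw [h])) (.inr h)
  have h2 := h1.card_le_indepNum
  rw [Finset.card_image_of_injective _ hinj, Finset.card_univ, Fintype.card_coe] at h2
  refine h2.trans (le_trans ?_ hk)
  exact Finset.le_sup (f := fun t : Fin q => (G.induce (D.bag t : Set (Fin n))).indepNum)
    (Finset.mem_univ _)

/-- Eliminating the leaves of the tree one after another eliminates the bags of the family. -/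
theorem IsLeafOrder.eliminationScheme {k r : ℕ} (D : TreeDecomposition G (Fin q))
    (H : Fin p → G.Subgraph) (hk : D.indepNumber ≤ k) (hH : ∀ j, (H j).Connected)
    {root : ℕ} {par depth U : ℕ → ℕ} (hp : IsParentFunction D.tree root par depth)
    (hU : IsLeafOrder q par U) :
    EliminationScheme p k q (Conflict (2 * r + 2) H) (Meets r D H) U fun i => par (U i) where
  refl a := .inl rfl
  symm a b h := by
    rcases h with rfl | ⟨ha, hb, h⟩
    · exact .inl rfl
    · exact .inr ⟨hb, ha, by rwa [setDist_comm]⟩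
  U_lt := hU.lt
  U_inj := hU.inj
  V_remains i hi := hU.parent_remains hp hi
  inter i hi j hj hX t ht hXt := by
    have htq : t < q := hXt.1
    obtain ⟨v, hv, hv'⟩ := hU.parent_mem hp hi (u := ⟨U i, hU.lt i hi⟩) (t := ⟨t, htq⟩)
      (A := {y : Fin q | Meets r D H y j}) rfl ht
      (reflTransGen_meets D H hj (hH ⟨j, hj⟩) (s := ⟨U i, hU.lt i hi⟩) (t := ⟨t, htq⟩) hX hXt)
    rw [hv']; exact hv
  empty j h := absurd h.1 (lt_irrefl q)
  cover j hj := by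
    obtain ⟨v, hv⟩ := (hH ⟨j, hj⟩).nonempty
    obtain ⟨t, ht⟩ := D.vertex_mem v
    exact ⟨t, t.isLt, t.isLt, hj, v, ht, v, hv, by simp⟩
  conflict a ha b hb hab := by
    have hcov : ∀ j (hj : j < p), ∃ t < q, Meets r D H t j := by
      intro j hj
      obtain ⟨v, hv⟩ := (hH ⟨j, hj⟩).nonempty
      obtain ⟨t, ht⟩ := D.vertex_mem v
      exact ⟨t, t.isLt, t.isLt, hj, v, ht, v, hv, by simp⟩
    rcases hab with rfl | ⟨_, _, h⟩
    · obtain ⟨t, ht, h⟩ := hcov a ha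
      exact ⟨t, ht, h, h⟩
    · obtain ⟨u, hu, v, hv, huv⟩ := setDist_lt_iff.1 h
      obtain ⟨x, y, hxy, hx, hy⟩ := exists_middle huv
      obtain ⟨t, htx, hty⟩ : ∃ t, x ∈ D.bag t ∧ y ∈ D.bag t := by
        rcases hxy with rfl | hxy
        · obtain ⟨t, ht⟩ := D.vertex_mem x
          exact ⟨t, ht, ht⟩
        · exact D.edge_mem x y hxy
      exact ⟨t, t.isLt, ⟨t.isLt, ha, x, htx, u, hu, hx⟩, ⟨t.isLt, hb, y, hty, v, hv, hy⟩⟩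
  small t ht S hS hcf := card_le_of_meets D H hk ht S hS hcf

end

/-! ### Pruning leaves -/

/-- The children of `t` that are not among the first `i` entries of the queue `U`. -/
def remainingChildren (q : ℕ) (par U : ℕ → ℕ) (i t : ℕ) : Finset ℕ :=
  (Finset.range q).filter fun s => par s = t ∧ ∀ i' < i, U i' ≠ s

theorem mem_remainingChildren {q : ℕ} {par U : ℕ → ℕ} {i t s : ℕ} :
    s ∈ remainingChildren q par U i t ↔ s < q ∧ par s = t ∧ ∀ i' < i, U i' ≠ s := by
  simp [remainingChildren]

theorem remainingChildren_congr {q : ℕ} {par U U' : ℕ → ℕ} {i : ℕ} (t : ℕ)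
    (h : ∀ i' < i, U i' = U' i') :
    remainingChildren q par U i t = remainingChildren q par U' i t := by
  ext s
  simp only [mem_remainingChildren]
  constructor <;> rintro ⟨h1, h2, h3⟩ <;> refine ⟨h1, h2, fun i' hi' => ?_⟩
  · rw [← h i' hi']; exact h3 i' hi'
  · rw [h i' hi']; exact h3 i' hi'

/-- The invariant of the elimination of leaves, after `i` steps: the queue `U` holds, in its first
`T` cells, all nodes without remaining children, `deg` and `sum` hold the number and the sum of the
remaining neighbours (the root has the additional neighbour `q`), and `up` the parents of the
eliminated nodes. -/
structure PruneInvariant (q : ℕ) (par : ℕ → ℕ) (i : ℕ) (U : ℕ → ℕ) (T : ℕ)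
    (deg sum up : ℕ → ℕ) : Prop where
  le : i ≤ T
  lt : ∀ x < T, U x < q
  inj : ∀ x < T, ∀ x' < T, U x = U x' → x = x'
  mem_iff : ∀ t < q, (∃ x < T, U x = t) ↔ remainingChildren q par U i t = ∅
  deg_eq : ∀ t < q, deg t = 1 + (remainingChildren q par U i t).card
  sum_eq : ∀ t < q, sum t = par t + ∑ s ∈ remainingChildren q par U i t, s
  deg_root : deg q = 0
  up_eq : ∀ x < i, up x = par (U x)
  leaf : ∀ x < i, remainingChildren q par U x (U x) = ∅

theorem PruneInvariant.isLeafOrder {q : ℕ} {par : ℕ → ℕ} {U : ℕ → ℕ} {T : ℕ}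
    {deg sum up : ℕ → ℕ} (h : PruneInvariant q par q U T deg sum up) : IsLeafOrder q par U := by
  refine ⟨fun i hi => h.lt i (hi.trans_le h.le),
    fun i hi i' hi' => h.inj i (hi.trans_le h.le) i' (hi'.trans_le h.le), fun i hi s hs hr he => ?_⟩
  have := h.leaf i hi
  rw [Finset.eq_empty_iff_forall_notMem] at this
  exact this s (mem_remainingChildren.2 ⟨hs, he, hr⟩)

/-- While nodes remain, a deepest one is a leaf, so the queue is not exhausted. -/
theorem PruneInvariant.lt_tail {q : ℕ} {T : SimpleGraph (Fin q)} {root : ℕ}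
    {par depth : ℕ → ℕ} (hp : IsParentFunction T root par depth) {i : ℕ} {U : ℕ → ℕ} {tail : ℕ}
    {deg sum up : ℕ → ℕ} (h : PruneInvariant q par i U tail deg sum up) (hi : i < q) :
    i < tail := by
  classical
  have hne : ((Finset.range q).filter fun t => ∀ i' < i, U i' ≠ t).Nonempty := by
    by_contra hne
    rw [Finset.not_nonempty_iff_eq_empty, Finset.filter_eq_empty_iff] at hne
    have h1 : Finset.range q ⊆ (Finset.range i).image U := by
      intro t ht
      have := hne ht
      push Not at this
      obtain ⟨i', hi', rfl⟩ := this
      exact Finset.mem_image_of_mem _ (Finset.mem_range.2 hi')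
    have h2 := (Finset.card_le_card h1).trans Finset.card_image_le
    simp at h2
    omega
  obtain ⟨t, ht, hmax⟩ := Finset.exists_max_image _ depth hne
  simp only [Finset.mem_filter, Finset.mem_range] at ht hmax
  have hleaf : remainingChildren q par U i t = ∅ := by
    rw [Finset.eq_empty_iff_forall_notMem]
    intro s hs
    obtain ⟨hs, hst, hr⟩ := mem_remainingChildren.1 hs
    have h1 := hp.depth_lt s hs (by rw [hst]; exact ht.1)
    rw [hst] at h1
    have h2 := hmax s ⟨hs, hr⟩
    omega
  obtain ⟨x, hx, hxt⟩ := (h.mem_iff t ht.1).2 hleaf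
  by_contra hle
  exact ht.2 x (by omega) hxt

/-- The node at the front of the queue has no remaining child, so the sum of its remaining
neighbours is its parent, which joins the queue if it has no other remaining child. -/
theorem PruneInvariant.step {q : ℕ} {T : SimpleGraph (Fin q)} {root : ℕ}
    {par depth : ℕ → ℕ} (hp : IsParentFunction T root par depth) {i : ℕ} {U : ℕ → ℕ} {tail : ℕ}
    {deg sum up : ℕ → ℕ} (h : PruneInvariant q par i U tail deg sum up) (hi : i < q) :
    (deg (sum (U i)) - 1 = 1 → PruneInvariant q par (i + 1)
        (Function.update U tail (sum (U i))) (tail + 1)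
        (Function.update deg (sum (U i)) (deg (sum (U i)) - 1))
        (Function.update sum (sum (U i)) (sum (sum (U i)) - U i))
        (Function.update up i (sum (U i)))) ∧
    (deg (sum (U i)) - 1 ≠ 1 → PruneInvariant q par (i + 1) U tail
        (Function.update deg (sum (U i)) (deg (sum (U i)) - 1))
        (Function.update sum (sum (U i)) (sum (sum (U i)) - U i))
        (Function.update up i (sum (U i)))) := by
  classical
  have hlt := h.lt_tail hp hi
  have huq := h.lt i hlt
  have hleaf : remainingChildren q par U i (U i) = ∅ := (h.mem_iff _ huq).1 ⟨i, hlt, rfl⟩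
  have hsum : sum (U i) = par (U i) := by rw [h.sum_eq _ huq, hleaf]; simp
  rw [hsum]
  set u := U i with hu
  have hur : ∀ i' < i, U i' ≠ u := fun i' hi' he => by
    have := h.inj i' (by omega) i hlt he
    omega
  have hmem : u ∈ remainingChildren q par U i (par u) :=
    mem_remainingChildren.2 ⟨huq, rfl, hur⟩
  have hself : remainingChildren q par U (i + 1) (par u) =
      (remainingChildren q par U i (par u)).erase u := by
    ext s
    simp only [mem_remainingChildren, Finset.mem_erase]
    constructor
    · rintro ⟨h1, h2, h3⟩
      exact ⟨(h3 i (by omega)).symm, h1, h2, fun i' hi' => h3 i' (by omega)⟩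
    · rintro ⟨h0, h1, h2, h3⟩
      refine ⟨h1, h2, fun i' hi' => ?_⟩
      rcases Nat.lt_succ_iff_lt_or_eq.1 hi' with h4 | rfl
      · exact h3 i' h4
      · exact h0.symm
  have hother : ∀ t ≠ par u, remainingChildren q par U (i + 1) t =
      remainingChildren q par U i t := by
    intro t ht
    ext s
    simp only [mem_remainingChildren]
    constructor
    · rintro ⟨h1, h2, h3⟩
      exact ⟨h1, h2, fun i' hi' => h3 i' (by omega)⟩
    · rintro ⟨h1, h2, h3⟩
      refine ⟨h1, h2, fun i' hi' => ?_⟩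
      rcases Nat.lt_succ_iff_lt_or_eq.1 hi' with h4 | rfl
      · exact h3 i' h4
      · rintro rfl
        exact ht h2.symm
  have hcard := Finset.card_erase_of_mem hmem
  have hpos : 0 < (remainingChildren q par U i (par u)).card := Finset.card_pos.2 ⟨u, hmem⟩
  have hsumer := Finset.add_sum_erase _ (fun s => s) hmem
  have hdeg : ∀ t < q, Function.update deg (par u) (deg (par u) - 1) t =
      1 + (remainingChildren q par U (i + 1) t).card := by
    intro t ht
    by_cases htv : t = par u
    · subst htv
      rw [Function.update_self, h.deg_eq _ ht, hself, hcard]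
      omega
    · rw [Function.update_of_ne htv, h.deg_eq t ht, hother t htv]
  have hsum' : ∀ t < q, Function.update sum (par u) (sum (par u) - u) t =
      par t + ∑ s ∈ remainingChildren q par U (i + 1) t, s := by
    intro t ht
    by_cases htv : t = par u
    · subst htv
      rw [Function.update_self, h.sum_eq _ ht, hself]
      omega
    · rw [Function.update_of_ne htv, h.sum_eq t ht, hother t htv]
  -- The entry of the extra neighbour `q` stays `0`, since subtraction is truncated; so `q` never
  -- joins the queue.
  have hroot : Function.update deg (par u) (deg (par u) - 1) q = 0 := by
    by_cases hq : q = par u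
    · rw [← hq, Function.update_self, h.deg_root]
    · rw [Function.update_of_ne hq, h.deg_root]
  have hup : ∀ x < i + 1, Function.update up i (par u) x = par (U x) := by
    intro x hx
    rcases Nat.lt_succ_iff_lt_or_eq.1 hx with h4 | rfl
    · rw [Function.update_of_ne h4.ne, h.up_eq x h4]
    · rw [Function.update_self]
  have hleaf' : ∀ x < i + 1, remainingChildren q par U x (U x) = ∅ := by
    intro x hx
    rcases Nat.lt_succ_iff_lt_or_eq.1 hx with h4 | rfl
    · exact h.leaf x h4
    · exact hleaf
  have hnotin : ∀ x < tail, U x ≠ par u := by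
    intro x hx he
    have h1 := (h.mem_iff (par u) (he ▸ h.lt x hx)).1 ⟨x, hx, he⟩
    rw [h1] at hmem
    simp at hmem
  constructor
  · intro hd
    have hvq : par u < q := by
      rcases (hp.le u).lt_or_eq with h1 | h1
      · exact h1
      · rw [h1, h.deg_root] at hd; omega
    have hempty : remainingChildren q par U (i + 1) (par u) = ∅ := by
      have := hdeg _ hvq
      rw [Function.update_self] at this
      rw [← Finset.card_eq_zero]
      omega
    have hold : ∀ x < tail, Function.update U tail (par u) x = U x := fun x hx =>
      Function.update_of_ne hx.ne _ _
    have hcg : ∀ l ≤ tail, ∀ t, remainingChildren q par (Function.update U tail (par u)) l t =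
        remainingChildren q par U l t := fun l hl t =>
      remainingChildren_congr t fun i' hi' => hold i' (by omega)
    refine ⟨by omega, fun x hx => ?_, fun x hx x' hx' he => ?_, fun t ht => ?_, fun t ht => ?_,
      fun t ht => ?_, hroot, fun x hx => ?_, fun x hx => ?_⟩
    · rcases Nat.lt_succ_iff_lt_or_eq.1 hx with h4 | rfl
      · rw [hold x h4]; exact h.lt x h4
      · rwa [Function.update_self]
    · rcases Nat.lt_succ_iff_lt_or_eq.1 hx with h4 | rfl <;>
      rcases Nat.lt_succ_iff_lt_or_eq.1 hx' with h5 | rfl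
      · rw [hold x h4, hold x' h5] at he; exact h.inj x h4 x' h5 he
      · rw [hold x h4, Function.update_self] at he; exact absurd he (hnotin x h4)
      · rw [hold x' h5, Function.update_self] at he; exact absurd he.symm (hnotin x' h5)
      · rfl
    · rw [hcg _ hlt]
      by_cases htv : t = par u
      · subst htv
        exact iff_of_true ⟨tail, by omega, by simp⟩ hempty
      · rw [hother t htv, ← h.mem_iff t ht]
        constructor
        · rintro ⟨x, hx, rfl⟩
          rcases Nat.lt_succ_iff_lt_or_eq.1 hx with h4 | rfl
          · exact ⟨x, h4, (hold x h4).symm⟩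
          · exact absurd (Function.update_self _ _ _) htv
        · rintro ⟨x, hx, rfl⟩
          exact ⟨x, by omega, hold x hx⟩
    · rw [hcg _ hlt]; exact hdeg t ht
    · rw [hcg _ hlt]; exact hsum' t ht
    · rw [hold x (by omega)]; exact hup x hx
    · rw [hold x (by omega), hcg x (by omega)]; exact hleaf' x hx
  · intro hd
    refine ⟨hlt, h.lt, h.inj, fun t ht => ?_, hdeg, hsum', hroot, hup, hleaf'⟩
    rw [h.mem_iff t ht]
    by_cases htv : t = par u
    · subst htv
      have h1 := hdeg _ ht
      rw [Function.update_self] at h1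
      have h2 : (remainingChildren q par U (i + 1) (par u)).card ≠ 0 := by omega
      refine iff_of_false (fun h3 => ?_) (fun h3 => h2 (by rw [h3]; rfl))
      rw [h3] at hmem
      simp at hmem
    · rw [hother t htv]

theorem sum_range_getElem {α : Type*} (l : List α) (f : ℕ → ℕ) (g : α → ℕ)
    (h : ∀ i (hi : i < l.length), f i = g l[i]) :
    ∑ i ∈ Finset.range l.length, f i = (l.map g).sum := by
  induction l generalizing f with
  | nil => simp
  | cons a l ih =>
    rw [List.length_cons, Finset.sum_range_succ', ih (fun i => f (i + 1))
      (fun i hi => h (i + 1) (by simpa using hi)), h 0 (by simp)]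
    simp [Nat.add_comm]

/-- The number and the sum of the neighbours of a node, counting the extra neighbour `q` of the
root `0`. -/
theorem IsParentFunction.neighbours {q : ℕ} {T : SimpleGraph (Fin q)}
    {par depth : ℕ → ℕ} (hp : IsParentFunction T 0 par depth) {l : List (Fin q × Fin q)}
    (hl : ListsEdges T.edgeSet l) (U : ℕ → ℕ) {t : ℕ} (ht : t < q) :
    (if t = 0 then 1 else 0) +
      (l.map fun e => (if (e.1 : ℕ) = t then 1 else 0) + if (e.2 : ℕ) = t then 1 else 0).sum =
      1 + (remainingChildren q par U 0 t).card ∧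
    (if t = 0 then q else 0) +
      (l.map fun e => (if (e.1 : ℕ) = t then (e.2 : ℕ) else 0) +
        if (e.2 : ℕ) = t then (e.1 : ℕ) else 0).sum =
      par t + ∑ s ∈ remainingChildren q par U 0 t, s := by
  classical
  have hc : ∀ f : ℕ → ℕ, ∑ s ∈ (Finset.range q).filter (· ≠ 0), (if par s = t then f s else 0) =
      ∑ s ∈ remainingChildren q par U 0 t, f s := by
    intro f
    rw [← Finset.sum_filter, Finset.filter_filter]
    refine Finset.sum_congr ?_ fun _ _ => rfl
    ext s
    simp only [Finset.mem_filter, Finset.mem_range, mem_remainingChildren]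
    constructor
    · rintro ⟨h1, -, h2⟩; exact ⟨h1, h2, by simp⟩
    · rintro ⟨h1, h2, -⟩
      refine ⟨h1, fun h0 => ?_, h2⟩
      have := (hp.eq_iff s h1).2 h0
      omega
  have hs : ∀ f : ℕ → ℕ, ∑ s ∈ (Finset.range q).filter (· ≠ 0), (if s = t then f s else 0) =
      if t = 0 then 0 else f t := by
    intro f
    rw [Finset.sum_ite_eq']
    simp [ht]
  rw [hp.sum_edges hl (fun a b => (if a = t then 1 else 0) + if b = t then 1 else 0)
      (fun a b => Nat.add_comm _ _),
    hp.sum_edges hl (fun a b => (if a = t then b else 0) + if b = t then a else 0)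
      (fun a b => Nat.add_comm _ _)]
  simp only [Finset.sum_add_distrib]
  rw [hc fun _ => 1, hc fun s => s, hs fun _ => 1, hs fun s => par s]
  have := hp.eq_iff t ht
  constructor
  · split_ifs <;> simp
  · split_ifs with h0
    · rw [this.2 h0]; omega
    · omega

/-! ### Tables for codes -/

namespace RAM

/-- Sets `CODES` to `BASE ^ WIDTH`. -/
def countCodes : Program :=
  .seq (setVar CODES 1) <| forLoop IA (var WIDTH) <|
    .seq (setVar ACC 0) <| .seq (forLoop IB (var BASE) (setVar ACC (var ACC + var CODES))) <|
    setVar CODES (var ACC)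

theorem halts_countCodes {s : State} {b k : ℕ} (hb : s.nat BASE 0 = b) (hk : s.nat WIDTH 0 = k) :
    Halts countCodes s (100 * ((k + 1) * (b + 2))) fun s' => s'.nat CODES 0 = b ^ k := by
  refine (Halts.exec_seq rfl (Halts.forLoop (c := 3 + ((b + 1) * 30 + 10)) k
    (fun m s' => s'.nat CODES 0 = b ^ m) (by decide) ?_ ?_ ?_)).mono ?_ fun _ _ h => h
  · intro s' hs'
    simp [hs'.nat WIDTH (by decide), hk]
  · simp
  · intro m hm s₁ hs₁ hi hI
    refine (Halts.exec_seq rfl (Halts.seq (Halts.forLoop (c := 16) b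
      (fun l s' => s'.nat ACC 0 = l * b ^ m) (by decide) ?_ ?_ ?_)
      fun s' hs' hI' => Halts.of_loopFree rfl ?_)).mono ?_ fun _ _ h => h
    · intro s' hs'
      simp [hs'.nat BASE (by decide), hs₁.nat BASE (by decide), hb]
    · simp
    · intro l hl s' hs' hi' hI'
      refine (Halts.of_loopFree rfl ?_).mono (by simp) fun _ _ h => h
      simp [hI', hs'.nat CODES (by decide), hI]
      ring
    · simp [hI', pow_succ, Nat.mul_comm]
    · simp
  · simp
    nlinarith [Nat.zero_le (k * b)]

/-- Tabulates `c / b`, `c % b` and `c * b` for all codes `c`, where `b` is the content of `BASE`. -/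
def digitTables : Program :=
  forLoop IA (var CODES) <|
    .seq (.branch (.natEq (rd LAST (var IA) + 1) (var BASE))
      (.seq (.setNat PREF (var IA + 1) (rd PREF (var IA) + 1)) (.setNat LAST (var IA + 1) 0))
      (.seq (.setNat PREF (var IA + 1) (rd PREF (var IA)))
        (.setNat LAST (var IA + 1) (rd LAST (var IA) + 1)))) <|
    .setNat MULB (var IA + 1) (rd MULB (var IA) + var BASE)

theorem halts_digitTables {s : State} {b K : ℕ} (hb : s.nat BASE 0 = b) (hb0 : 0 < b)
    (hK : s.nat CODES 0 = K)
    (hP : s.nat PREF 0 = 0) (hL : s.nat LAST 0 = 0) (hM : s.nat MULB 0 = 0) :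
    Halts digitTables s (100 * (K + 1)) fun s' => ∀ c < K, s'.nat PREF c = c / b ∧
      s'.nat LAST c = c % b ∧ s'.nat MULB c = c * b := by
  refine (Halts.forLoop (c := 60) K (fun m s' => ∀ c ≤ m, s'.nat PREF c = c / b ∧
      s'.nat LAST c = c % b ∧ s'.nat MULB c = c * b) (by decide) ?_ ?_ ?_).mono ?_
      fun _ _ h => fun c hc => h c hc.le
  · intro s' hs'
    simp [hs'.nat CODES (by decide), hK]
  · intro c hc
    obtain rfl : c = 0 := by omega
    simp [hP, hL, hM]
  · intro m hm s' hs' hi hI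
    refine (Halts.of_loopFree rfl ?_).mono (by simp) fun _ _ h => h
    obtain ⟨h1, h2, h3⟩ := hI m le_rfl
    have hdm := Nat.div_add_mod m b
    have hml := Nat.mod_lt m hb0
    intro c hc
    by_cases hcm : c = m + 1
    · subst hcm
      have e3 : (m + 1) * b = m * b + b := by ring
      by_cases hlast : m % b + 1 = b
      · obtain ⟨e1, e2⟩ := (Nat.div_mod_unique (a := m + 1) (d := m / b + 1) (c := 0) hb0).2
          ⟨by rw [Nat.mul_add]; omega, hb0⟩
        simp [h1, h2, h3, hi, hs'.nat BASE (by decide), hb, hlast, e1, e2, e3]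
      · obtain ⟨e1, e2⟩ := (Nat.div_mod_unique (a := m + 1) (d := m / b) (c := m % b + 1) hb0).2
          ⟨by omega, by omega⟩
        simp [h1, h2, h3, hi, hs'.nat BASE (by decide), hb, hlast, e1, e2, e3]
    · have := hI c (by omega)
      by_cases hlast : m % b + 1 = b <;>
      simpa [h1, h2, h3, hi, hs'.nat BASE (by decide), hb, hlast, hcm] using this
  · simp
    omega

/-- Tabulates the multiples of `CODES`, by which the rows of the tables of all nodes are found. -/
def rowTable : Program :=
  forLoop IA (rd 0 1 + 1) (.setNat MULK (var IA + 1) (rd MULK (var IA) + var CODES))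

theorem halts_rowTable {s : State} {q K : ℕ} (hq : s.nat 0 1 = q) (hK : s.nat CODES 0 = K)
    (hM : s.nat MULK 0 = 0) :
    Halts rowTable s (60 * (q + 2)) fun s' => ∀ t ≤ q + 1, s'.nat MULK t = t * K := by
  refine (Halts.forLoop (c := 20) (q + 1) (fun m s' => ∀ t ≤ m, s'.nat MULK t = t * K)
    (by decide) ?_ ?_ ?_).mono ?_ fun _ _ h => h
  · intro s' hs'
    simp [hs'.nat 0 (by decide), hq]
  · simp [hM]
  · intro m hm s' hs' hi hI
    refine (Halts.of_loopFree rfl ?_).mono (by simp) fun _ _ h => h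
    intro t ht
    by_cases htm : t = m + 1
    · simp [htm, hI m le_rfl, hi, hs'.nat CODES (by decide), hK]; ring
    · simp [htm, hi, hI t (by omega)]
  · simp; omega

/-- Finds the codes with two digits in conflict. A code is good if it is so without digit `0` and
without digit `1`, and these two digits are not in conflict. -/
def badCodes : Program :=
  forLoop IA (var CODES) <| .branch
    (.and (.and (.not (.natEq (rd LAST (var IA)) 0))
      (.not (.natEq (rd LAST (rd PREF (var IA))) 0)))
      (.natLe (rd DIST (rd MUL (rd LAST (var IA) - 1) +
        (rd 0 1 + 1 + (rd LAST (rd PREF (var IA)) - 1))) + 1) (var LIMIT)))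
    (.setNat BAD (var IA) 1)
    (.setNat BAD (var IA) (rd BAD (rd PREF (var IA)) +
      rd BAD (rd MULB (rd PREF (rd PREF (var IA))) + rd LAST (var IA))))

theorem halts_badCodes {s : State} {p q d K N : ℕ} {cf : ℕ → ℕ → Prop}
    (hp : 0 < p) (hq : s.nat 0 1 = q) (hd : s.nat LIMIT 0 = d) (hK : s.nat CODES 0 = K)
    (hMUL : ∀ x < p, s.nat MUL x = x * N)
    (hdig : ∀ c < K, s.nat PREF c = c / (p + 1) ∧ s.nat LAST c = c % (p + 1) ∧
      s.nat MULB c = c * (p + 1))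
    (hcf : ∀ a < p, ∀ b < p, s.nat DIST (a * N + (q + 1 + b)) + 1 ≤ d ↔ cf a b)
    (hB : ∀ c, s.nat BAD c = 0) :
    Halts badCodes s (100 * (K + 1)) fun s' =>
      ∀ c < K, s'.nat BAD c = 0 ↔ GoodCode cf (p + 1) c := by
  refine (Halts.forLoop (c := 80) K (fun m s' =>
    (∀ c < m, s'.nat BAD c = 0 ↔ GoodCode cf (p + 1) c) ∧ ∀ c, m ≤ c → s'.nat BAD c = 0)
    (by decide) ?_ ?_ ?_).mono ?_ fun _ _ h => h.1
  · intro s' hs'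
    simp [hs'.nat CODES (by decide), hK]
  · simp [hB]
  · intro c hc s' hs' hi hI
    refine (Halts.of_loopFree rfl ?_).mono (by simp) fun _ _ h => h
    have hb : 0 < p + 1 := by omega
    have hle1 : c / (p + 1) ≤ c := Nat.div_le_self _ _
    have hle2 : c / (p + 1) / (p + 1) ≤ c := (Nat.div_le_self _ _).trans hle1
    obtain ⟨h1, h2, -⟩ := hdig c hc
    obtain ⟨h3, h4, -⟩ := hdig (c / (p + 1)) (by omega)
    obtain ⟨-, -, h5⟩ := hdig (c / (p + 1) / (p + 1)) (by omega)
    have hdm := Nat.div_add_mod c (p + 1)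
    have hdm' := Nat.div_add_mod (c / (p + 1)) (p + 1)
    have hm := Nat.mod_lt c hb
    have hm' := Nat.mod_lt (c / (p + 1)) hb
    -- The entries for the two shorter codes are known; this also covers the codes with one digit.
    have hone : ∀ x, x < p + 1 → GoodCode cf (p + 1) x := by
      intro x hx i i' hii _ h
      rw [digitAt_eq_zero (k := 1) hb (by simpa using hx) (by omega)] at h
      exact absurd rfl h
    have e1 : s'.nat BAD (c / (p + 1)) = 0 ↔ GoodCode cf (p + 1) (c / (p + 1)) := by
      rcases Nat.lt_or_ge (c / (p + 1)) c with h | h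
      · exact hI.1 _ h
      · have h0 : c = 0 := by
          by_contra h0
          have := Nat.div_lt_self (n := c) (k := p + 1) (by omega) (by omega)
          omega
        exact iff_of_true (hI.2 _ h) (hone _ (by simp [h0]))
    have e2 : s'.nat BAD (c / (p + 1) / (p + 1) * (p + 1) + c % (p + 1)) = 0 ↔
        GoodCode cf (p + 1) (c / (p + 1) / (p + 1) * (p + 1) + c % (p + 1)) := by
      rcases Nat.lt_or_ge (c / (p + 1) / (p + 1) * (p + 1) + c % (p + 1)) c with h | h
      · exact hI.1 _ h
      · have h0 : c / (p + 1) = 0 := by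
          by_contra h0
          have h1 := Nat.div_lt_self (n := c / (p + 1)) (k := p + 1) (by omega) (by omega)
          have h2 := Nat.mul_lt_mul_of_pos_right h1 hb
          rw [Nat.mul_comm (p + 1)] at hdm
          omega
        refine iff_of_true (hI.2 _ h) (hone _ ?_)
        rw [h0]
        simpa using hm
    have hrec := goodCode_iff (cf := cf) (c := c) hb
    have hset : ∀ y, (y = 0 ↔ GoodCode cf (p + 1) c) →
        (∀ c' < c + 1, Function.update (s'.nat BAD) c y c' = 0 ↔ GoodCode cf (p + 1) c') ∧
        ∀ c', c + 1 ≤ c' → Function.update (s'.nat BAD) c y c' = 0 := by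
      intro y hy
      refine ⟨fun c' hc' => ?_, fun c' hc' => ?_⟩
      · rcases Nat.lt_succ_iff_lt_or_eq.1 hc' with h | rfl
        · simpa [h.ne] using hI.1 c' h
        · simpa using hy
      · simpa [show c' ≠ c by omega] using hI.2 c' (by omega)
    have hcond : s'.nat LAST c ≠ 0 → s'.nat LAST (s'.nat PREF c) ≠ 0 →
        (s'.nat DIST (s'.nat MUL (s'.nat LAST c - 1) +
          (s'.nat 0 1 + 1 + (s'.nat LAST (s'.nat PREF c) - 1))) + 1 ≤ s'.nat LIMIT 0 ↔
        cf (c % (p + 1) - 1) (c / (p + 1) % (p + 1) - 1)) := by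
      rw [hs'.nat LAST (by decide), hs'.nat PREF (by decide), h1, h2, h4]
      intro g1 g2
      rw [← hcf _ (by omega) _ (by omega), hs'.nat MUL (by decide), hMUL _ (by omega),
        hs'.nat DIST (by decide), hs'.nat 0 (by decide), hs'.nat LIMIT (by decide), hq, hd]
    have e3 : s'.nat LAST c = c % (p + 1) := by rw [hs'.nat LAST (by decide), h2]
    have e4 : s'.nat PREF c = c / (p + 1) := by rw [hs'.nat PREF (by decide), h1]
    have e5 : s'.nat LAST (c / (p + 1)) = c / (p + 1) % (p + 1) := by
      rw [hs'.nat LAST (by decide), h4]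
    have e6 : s'.nat PREF (c / (p + 1)) = c / (p + 1) / (p + 1) := by
      rw [hs'.nat PREF (by decide), h3]
    have e7 : s'.nat MULB (c / (p + 1) / (p + 1)) = c / (p + 1) / (p + 1) * (p + 1) := by
      rw [hs'.nat MULB (by decide), h5]
    rw [e3, e4, e5] at hcond
    simp only [Program.exec, Test.eval, NatExpr.eval, NatExpr.eval_sub',
      hi, e3, e4, e5, e6, e7]
    split_ifs with h
    · simp only [State.writeNat_nat_of_ne _ _ _ (show BAD ≠ IA by decide),
        State.writeNat_nat_self]
      refine hset _ (iff_of_false one_ne_zero fun hg => ?_)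
      exact (hrec.1 hg).1 h.1.1 h.1.2 ((hcond h.1.1 h.1.2).1 h.2)
    · simp only [State.writeNat_nat_of_ne _ _ _ (show BAD ≠ IA by decide),
        State.writeNat_nat_self]
      refine hset _ ?_
      rw [Nat.add_eq_zero_iff, e1, e2, hrec]
      refine ⟨fun hg => ⟨fun g1 g2 g3 => h ⟨⟨g1, g2⟩, (hcond g1 g2).2 g3⟩, hg⟩, fun hg => hg.2⟩
  · simp
    omega

end RAM

/-! ### Computing the elimination order -/

namespace RAM

/-- Computes the degrees in the tree and the sums of the neighbours, where the root `0` has the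
additional neighbour `q`. -/
def treeDegrees : Program :=
  .seq (.seq (.setNat DEG 0 1) (.setNat SUM 0 (rd 0 1))) <|
  forLoop IA (rd 0 (var TEDGES - 1)) <|
    .seq (.seq (setVar NODE (rd 0 (var TEDGES + var IA + var IA)))
      (setVar NEXT (rd 0 (var TEDGES + var IA + var IA + 1)))) <|
    .seq (.seq (.setNat DEG (var NODE) (rd DEG (var NODE) + 1))
      (.setNat SUM (var NODE) (rd SUM (var NODE) + var NEXT)))
    (.seq (.setNat DEG (var NEXT) (rd DEG (var NEXT) + 1))
      (.setNat SUM (var NEXT) (rd SUM (var NEXT) + var NODE)))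

theorem halts_treeDegrees {s : State} {q m te : ℕ} {ea eb : ℕ → ℕ} (hq : s.nat 0 1 = q)
    (hte : s.nat TEDGES 0 = te) (hm : s.nat 0 (te - 1) = m)
    (hea : ∀ i < m, s.nat 0 (te + i + i) = ea i) (heb : ∀ i < m, s.nat 0 (te + i + i + 1) = eb i)
    (hne : ∀ i < m, ea i ≠ eb i)
    (hD : ∀ t, s.nat DEG t = 0) (hS : ∀ t, s.nat SUM t = 0) :
    Halts treeDegrees s (100 * (m + 2)) fun s' => ∀ t,
      s'.nat DEG t = (if t = 0 then 1 else 0) +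
        ∑ i ∈ Finset.range m, ((if ea i = t then 1 else 0) + if eb i = t then 1 else 0) ∧
      s'.nat SUM t = (if t = 0 then q else 0) +
        ∑ i ∈ Finset.range m, ((if ea i = t then eb i else 0) + if eb i = t then ea i else 0) := by
  refine (Halts.exec_seq rfl (Halts.forLoop (c := 70) m (fun m s' => ∀ t,
      s'.nat DEG t = (if t = 0 then 1 else 0) +
        ∑ i ∈ Finset.range m, ((if ea i = t then 1 else 0) + if eb i = t then 1 else 0) ∧
      s'.nat SUM t = (if t = 0 then q else 0) +
        ∑ i ∈ Finset.range m, ((if ea i = t then eb i else 0) + if eb i = t then ea i else 0))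
      (by decide) ?_ ?_ ?_)).mono ?_ fun _ _ h => h
  · intro s' hs'
    simp [hs'.nat 0 (by decide), hs'.nat TEDGES (by decide), hte, hm]
  · intro t
    by_cases ht : t = 0 <;> simp [ht, hD, hS, hq]
  · intro i hi s' hs' hi' hI
    refine (Halts.of_loopFree rfl ?_).mono (by simp) fun _ _ h => h
    intro t
    have h1 := hI t
    have h2 := hne i hi
    rw [Finset.sum_range_succ, Finset.sum_range_succ]
    by_cases ha : ea i = t
    · have hb : eb i ≠ t := fun hb => h2 (ha.trans hb.symm)
      simp [hs'.nat 0 (by decide), hs'.nat TEDGES (by decide), hte, hi', hea i hi, heb i hi, ha,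
        hb, hb.symm, h1]
      omega
    · by_cases hb : eb i = t
      · simp [hs'.nat 0 (by decide), hs'.nat TEDGES (by decide), hte, hi', hea i hi, heb i hi, ha,
          hb, Ne.symm ha, h1]
        omega
      · simp [hs'.nat 0 (by decide), hs'.nat TEDGES (by decide), hte, hi', hea i hi, heb i hi, ha,
          hb, Ne.symm ha, Ne.symm hb, h1]
  · simp; omega

/-- Puts all leaves into the queue. -/
def initQueue : Program :=
  .seq (setVar TAIL 0) <| forLoop IA (rd 0 1) <| .branch (.natEq (rd DEG (var IA)) 1)
    (.seq (.setNat QUEUE (var TAIL) (var IA)) (setVar TAIL (var TAIL + 1))) .skip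

theorem halts_initQueue {s : State} {q : ℕ} (hq : s.nat 0 1 = q) :
    Halts initQueue s (60 * (q + 2)) fun s' =>
      (∀ x < s'.nat TAIL 0, s'.nat QUEUE x < q) ∧
      (∀ x < s'.nat TAIL 0, ∀ x' < s'.nat TAIL 0,
        s'.nat QUEUE x = s'.nat QUEUE x' → x = x') ∧
      ∀ t < q, (∃ x < s'.nat TAIL 0, s'.nat QUEUE x = t) ↔ s.nat DEG t = 1 := by
  refine (Halts.exec_seq rfl (Halts.forLoop (c := 40) q (fun m s' =>
      (∀ x < s'.nat TAIL 0, s'.nat QUEUE x < m) ∧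
      (∀ x < s'.nat TAIL 0, ∀ x' < s'.nat TAIL 0,
        s'.nat QUEUE x = s'.nat QUEUE x' → x = x') ∧
      ∀ t < m, (∃ x < s'.nat TAIL 0, s'.nat QUEUE x = t) ↔ s.nat DEG t = 1)
      (by decide) ?_ ?_ ?_)).mono ?_ fun _ _ h => h
  · intro s' hs'
    simp [hs'.nat 0 (by decide), hq]
  · simp
  · intro m hm s' hs' hi ⟨h1, h2, h3⟩
    refine (Halts.of_loopFree rfl ?_).mono (by simp) fun _ _ h => h
    have hD : s'.nat DEG m = s.nat DEG m := by simp [hs'.nat DEG (by decide)]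
    simp only [Program.exec, Test.eval, NatExpr.eval, hi, hD]
    split_ifs with hdeg
    · have hold : ∀ x < s'.nat TAIL 0,
          Function.update (s'.nat QUEUE) (s'.nat TAIL 0) m x = s'.nat QUEUE x :=
        fun x hx => Function.update_of_ne hx.ne _ _
      have hnew : Function.update (s'.nat QUEUE) (s'.nat TAIL 0) m (s'.nat TAIL 0) = m :=
        Function.update_self _ _ _
      simp
      refine ⟨fun x hx => ?_, fun x hx x' hx' he => ?_, fun t ht => ?_⟩
      · rcases Nat.lt_or_eq_of_le hx with h4 | rfl
        · rw [hold x h4]; exact (h1 x h4).le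
        · rw [hnew]
      · rcases Nat.lt_or_eq_of_le hx with h4 | rfl <;>
        rcases Nat.lt_or_eq_of_le hx' with h5 | rfl
        · rw [hold x h4, hold x' h5] at he; exact h2 x h4 x' h5 he
        · rw [hold x h4, hnew] at he; exact absurd he (h1 x h4).ne
        · rw [hold x' h5, hnew] at he; exact absurd he.symm (h1 x' h5).ne
        · rfl
      · rcases Nat.lt_or_eq_of_le ht with h4 | rfl
        · rw [← h3 t h4]
          constructor
          · rintro ⟨x, hx, rfl⟩
            rcases Nat.lt_or_eq_of_le hx with h5 | rfl
            · exact ⟨x, h5, (hold x h5).symm⟩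
            · rw [hnew] at h4; omega
          · rintro ⟨x, hx, rfl⟩
            exact ⟨x, hx.le, hold x hx⟩
        · exact iff_of_true ⟨s'.nat TAIL 0, le_rfl, hnew⟩ hdeg
    · simp
      refine ⟨fun x hx => (h1 x hx).le, h2, fun t ht => ?_⟩
      rcases Nat.lt_or_eq_of_le ht with h4 | rfl
      · exact h3 t h4
      · refine iff_of_false ?_ hdeg
        rintro ⟨x, hx, he⟩
        exact (h1 x hx).ne he
  · simp; omega

/-- Eliminates the leaves one after another, in the order of the queue. The parent of a leaf is
the sum of its remaining neighbours. -/
def pruneLeaves : Program :=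
  forLoop IA (rd 0 1) <|
    .seq (.seq (setVar NODE (rd QUEUE (var IA))) (setVar NEXT (rd SUM (var NODE)))) <|
    .seq (.seq (.setNat UP (var IA) (var NEXT))
      (.setNat SUM (var NEXT) (rd SUM (var NEXT) - var NODE))) <|
    .seq (.setNat DEG (var NEXT) (rd DEG (var NEXT) - 1)) <|
    .branch (.natEq (rd DEG (var NEXT)) 1)
      (.seq (.setNat QUEUE (var TAIL) (var NEXT)) (setVar TAIL (var TAIL + 1))) .skip

theorem halts_pruneLeaves {s : State} {q : ℕ} {T : SimpleGraph (Fin q)} {root : ℕ}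
    {par depth : ℕ → ℕ} (hp : IsParentFunction T root par depth) (hq : s.nat 0 1 = q)
    (h : PruneInvariant q par 0 (s.nat QUEUE) (s.nat TAIL 0) (s.nat DEG) (s.nat SUM) (s.nat UP)) :
    Halts pruneLeaves s (100 * (q + 1)) fun s' =>
      PruneInvariant q par q (s'.nat QUEUE) (s'.nat TAIL 0) (s'.nat DEG) (s'.nat SUM)
        (s'.nat UP) := by
  refine (Halts.forLoop (c := 70) q (fun m s' => PruneInvariant q par m (s'.nat QUEUE)
    (s'.nat TAIL 0) (s'.nat DEG) (s'.nat SUM) (s'.nat UP)) (by decide) ?_ ?_ ?_).mono ?_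
    fun _ _ h => h
  · intro s' hs'
    simp [hs'.nat 0 (by decide), hq]
  · simpa using h
  · intro m hm s' hs' hi hI
    refine (Halts.of_loopFree rfl ?_).mono (by simp) fun _ _ h => h
    obtain ⟨h1, h2⟩ := hI.step hp hm
    simp [hi]
    split_ifs with hd
    · simpa using h1 (by omega)
    · simpa using h2 (by omega)
  · simp; omega

/-- Computes an elimination order of the nodes of the tree. -/
def eliminationOrder : Program := .seq treeDegrees (.seq initQueue pruneLeaves)

theorem halts_eliminationOrder {s : State} {q te : ℕ} {T : SimpleGraph (Fin q)}
    {par depth : ℕ → ℕ} (hp : IsParentFunction T 0 par depth) {l : List (Fin q × Fin q)}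
    (hl : ListsEdges T.edgeSet l) (hq0 : 0 < q) (hq : s.nat 0 1 = q)
    (hte : s.nat TEDGES 0 = te) (hm : s.nat 0 (te - 1) = l.length)
    (hpairs : HoldsAt (s.nat 0) te (l.flatMap fun e => [(e.1 : ℕ), (e.2 : ℕ)]))
    (hD : ∀ t, s.nat DEG t = 0) (hS : ∀ t, s.nat SUM t = 0) :
    Halts eliminationOrder s (100 * (l.length + 2) + 200 * (q + 2)) fun s' =>
      IsLeafOrder q par (s'.nat QUEUE) ∧ ∀ i < q, s'.nat UP i = par (s'.nat QUEUE i) := by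
  have hne : ∀ i (hi : i < l.length), (l[i].1 : ℕ) ≠ l[i].2 := by
    intro i hi h
    have h1 : s(l[i].1, l[i].2) ∈ T.edgeSet :=
      (hl.2 _).1 (List.mem_map.2 ⟨l[i], List.getElem_mem hi, rfl⟩)
    exact (SimpleGraph.mem_edgeSet T).1 h1 |>.ne (Fin.ext h)
  have e1 : ∀ i (hi : i < l.length), s.nat 0 (te + i + i) = l[i].1 := fun i hi =>
    (hpairs.pairs i hi).1
  have e2 : ∀ i (hi : i < l.length), s.nat 0 (te + i + i + 1) = l[i].2 := fun i hi =>
    (hpairs.pairs i hi).2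
  refine (Halts.seq (halts_treeDegrees (ea := fun i => s.nat 0 (te + i + i))
    (eb := fun i => s.nat 0 (te + i + i + 1)) hq hte hm (fun _ _ => rfl) (fun _ _ => rfl)
    (fun i hi => by rw [e1 i hi, e2 i hi]; exact hne i hi) hD hS) fun s₁ hs₁ h₁ =>
    Halts.seq (halts_initQueue (q := q) (by rw [hs₁.nat 0 (by decide), hq])) fun s₂ hs₂ h₂ =>
    (halts_pruneLeaves hp ?_ ?_).mono le_rfl fun s' _ h' => ⟨h'.isLeafOrder, h'.up_eq⟩).mono ?_
      fun _ _ h => h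
  · rw [hs₂.nat 0 (by decide), hs₁.nat 0 (by decide), hq]
  · have hdeg : ∀ t < q, s₂.nat DEG t = 1 + (remainingChildren q par (s₂.nat QUEUE) 0 t).card := by
      intro t ht
      rw [hs₂.nat DEG (by decide), (h₁ t).1, ← (hp.neighbours hl (s₂.nat QUEUE) ht).1]
      congr 1
      refine sum_range_getElem l _ _ fun i hi => ?_
      rw [e1 i hi, e2 i hi]
    have hsum : ∀ t < q, s₂.nat SUM t =
        par t + ∑ s ∈ remainingChildren q par (s₂.nat QUEUE) 0 t, s := by
      intro t ht
      rw [hs₂.nat SUM (by decide), (h₁ t).2, ← (hp.neighbours hl (s₂.nat QUEUE) ht).2]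
      congr 1
      refine sum_range_getElem l _ _ fun i hi => ?_
      rw [e1 i hi, e2 i hi]
    refine ⟨Nat.zero_le _, h₂.1, h₂.2.1, fun t ht => ?_, hdeg, hsum, ?_, by simp, by simp⟩
    · rw [h₂.2.2 t ht, ← hs₂.nat DEG (by decide), hdeg t ht, ← Finset.card_eq_zero]
      omega
    · rw [hs₂.nat DEG (by decide), (h₁ q).1, if_neg hq0.ne', Nat.zero_add]
      refine Finset.sum_eq_zero fun i hi => ?_
      have hi := Finset.mem_range.1 hi
      rw [e1 i hi, e2 i hi, if_neg (by omega), if_neg (by omega)]; rfl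
  · simp; omega

end RAM

/-! ### The dynamic program -/

/-! Names for the arrays of rational numbers. Array `0` holds the weights. The tables of the dynamic
program are stored in `FTAB`, one row for every node, with one entry for every code. -/

notation "FTAB" => 1
notation "MTAB" => 2
notation "GAIN" => 3
notation "SAVED" => 4
notation "BEST" => 5
notation "TOTAL" => 6

theorem IsProjection.of_div {keep : ℕ → Prop} {b c x a : ℕ} (hb : 0 < b)
    (hx : IsProjection keep b (c / b) x)
    (h1 : c % b ≠ 0 ∧ keep (c % b - 1) → a = c % b)
    (h2 : ¬ (c % b ≠ 0 ∧ keep (c % b - 1)) → a = 0) : IsProjection keep b c (x * b + a) := by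
  have ha : a < b := by
    have := Nat.mod_lt c hb
    by_cases h : c % b ≠ 0 ∧ keep (c % b - 1)
    · rw [h1 h]; exact this
    · rw [h2 h]; exact hb
  intro i
  cases i with
  | zero =>
    rw [digitAt_mul_add_zero _ ha, digitAt_zero]
    exact ⟨h1, h2⟩
  | succ i =>
    rw [digitAt_mul_add_succ _ _ ha, digitAt_succ]
    exact hx i

/-- The recursion by which `gain` is tabulated. -/
theorem gain_div {p k c : ℕ} {X : ℕ → ℕ → Prop} {w : ℕ → ℚ} {v : ℕ} (hc : c < (p + 1) ^ k) :
    (c % (p + 1) ≠ 0 ∧ ¬ X v (c % (p + 1) - 1) →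
      gain p k X w v c = gain p k X w v (c / (p + 1)) + w (c % (p + 1) - 1)) ∧
    (¬ (c % (p + 1) ≠ 0 ∧ ¬ X v (c % (p + 1) - 1)) →
      gain p k X w v c = gain p k X w v (c / (p + 1))) := by
  classical
  have hb : 0 < p + 1 := by omega
  have e : gain p k X w v c = gain p k X w v (c / (p + 1)) +
      if c % (p + 1) ≠ 0 ∧ ¬ X v (c % (p + 1) - 1) then w (c % (p + 1) - 1) else 0 := by
    have h1 := Finset.sum_range_succ (fun i => if digitAt (p + 1) c i ≠ 0 ∧
      ¬ X v (digitAt (p + 1) c i - 1) then w (digitAt (p + 1) c i - 1) else 0) k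
    have h2 := Finset.sum_range_succ' (fun i => if digitAt (p + 1) c i ≠ 0 ∧
      ¬ X v (digitAt (p + 1) c i - 1) then w (digitAt (p + 1) c i - 1) else 0) k
    rw [h1] at h2
    rw [digitAt_eq_zero hb hc le_rfl] at h2
    simp only [digitAt_succ, digitAt_zero] at h2
    simpa [gain] using h2
  constructor <;> intro h
  · rw [e, if_pos h]
  · rw [e, if_neg h, add_zero]

/-- The values tabulated for a code `c` when node `u` with parent `v` is eliminated: the code `x`
that remains at `v`, the number `y` that is `0` if all elements of `c` are in the bag of `u`, and
the weight `g` of the elements that are not in the bag of `v`. -/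
structure CodeValues (p k : ℕ) (X : ℕ → ℕ → Prop) (w : ℕ → ℚ) (u v c x y : ℕ) (g : ℚ) : Prop where
  le : x ≤ c
  proj : IsProjection (fun j => X u j ∧ X v j) (p + 1) c x
  inside : y = 0 ↔ ∀ i, digitAt (p + 1) c i ≠ 0 → X u (digitAt (p + 1) c i - 1)
  gain_eq : g = gain p k X w v c

section

variable {p k : ℕ} {X : ℕ → ℕ → Prop} {w : ℕ → ℚ} {u v c x y : ℕ} {g : ℚ}

theorem codeValues_zero : CodeValues p k X w u v 0 0 0 0 := by
  refine ⟨le_rfl, fun i => ?_, ?_, ?_⟩ <;> simp [digitAt_of_zero, gain]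

theorem inside_iff : (∀ i, digitAt (p + 1) c i ≠ 0 → X u (digitAt (p + 1) c i - 1)) ↔
    (c % (p + 1) ≠ 0 → X u (c % (p + 1) - 1)) ∧
    ∀ i, digitAt (p + 1) (c / (p + 1)) i ≠ 0 → X u (digitAt (p + 1) (c / (p + 1)) i - 1) := by
  constructor
  · intro h
    exact ⟨by simpa [digitAt_zero] using h 0, fun i => by simpa [digitAt_succ] using h (i + 1)⟩
  · rintro ⟨h, h'⟩ i
    cases i with
    | zero => simpa [digitAt_zero] using h
    | succ i => simpa [digitAt_succ] using h' i

/-- The recursion by which the values of `CodeValues` are tabulated: `a`, `y'` and `g'` account for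
the last digit of `c`. -/
theorem CodeValues.of_div (hc : c < (p + 1) ^ k)
    (h : CodeValues p k X w u v (c / (p + 1)) x y g) {a y' : ℕ} {g' : ℚ}
    (h1 : c % (p + 1) ≠ 0 ∧ X u (c % (p + 1) - 1) ∧ X v (c % (p + 1) - 1) → a = c % (p + 1))
    (h2 : ¬ (c % (p + 1) ≠ 0 ∧ X u (c % (p + 1) - 1) ∧ X v (c % (p + 1) - 1)) → a = 0)
    (h3 : (c % (p + 1) ≠ 0 → X u (c % (p + 1) - 1)) → y' = y)
    (h4 : ¬ (c % (p + 1) ≠ 0 → X u (c % (p + 1) - 1)) → y' = 1)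
    (h5 : c % (p + 1) ≠ 0 ∧ ¬ X v (c % (p + 1) - 1) → g' = g + w (c % (p + 1) - 1))
    (h6 : ¬ (c % (p + 1) ≠ 0 ∧ ¬ X v (c % (p + 1) - 1)) → g' = g) :
    CodeValues p k X w u v c (x * (p + 1) + a) y' g' := by
  have hac : a ≤ c % (p + 1) := by
    by_cases h : c % (p + 1) ≠ 0 ∧ X u (c % (p + 1) - 1) ∧ X v (c % (p + 1) - 1)
    · exact (h1 h).le
    · rw [h2 h]; exact Nat.zero_le _
  refine ⟨?_, h.proj.of_div (Nat.succ_pos p) h1 h2, ?_, ?_⟩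
  · calc x * (p + 1) + a ≤ c / (p + 1) * (p + 1) + c % (p + 1) :=
        Nat.add_le_add (Nat.mul_le_mul_right _ h.le) hac
      _ = c := Nat.div_add_mod' c (p + 1)
  · rw [inside_iff, ← h.inside]
    by_cases h' : c % (p + 1) ≠ 0 → X u (c % (p + 1) - 1)
    · rw [h3 h']; exact ⟨fun hy => ⟨h', hy⟩, fun hy => hy.2⟩
    · rw [h4 h']; exact iff_of_false one_ne_zero fun hy => h' hy.1
  · by_cases h' : c % (p + 1) ≠ 0 ∧ ¬ X v (c % (p + 1) - 1)
    · rw [h5 h', (gain_div hc).1 h', h.gain_eq]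
    · rw [h6 h', (gain_div hc).2 h', h.gain_eq]

end

namespace RAM

/-- The memory holds the tables that the dynamic program reads. -/
structure IsPrepared (p k q r N : ℕ) (cf X : ℕ → ℕ → Prop) (U V : ℕ → ℕ) (s : State) : Prop where
  nodes : s.nat 0 1 = q
  members : s.nat 0 2 = p
  codes : s.nat CODES 0 = (p + 1) ^ k
  radius : s.nat RADIUS 0 = r
  mul : ∀ x < p, s.nat MUL x = x * N
  digits : ∀ c < (p + 1) ^ k, s.nat PREF c = c / (p + 1) ∧ s.nat LAST c = c % (p + 1) ∧
    s.nat MULB c = c * (p + 1)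
  rows : ∀ t ≤ q + 1, s.nat MULK t = t * (p + 1) ^ k
  good : ∀ c < (p + 1) ^ k, s.nat BAD c = 0 ↔ GoodCode cf (p + 1) c
  meets : ∀ j < p, ∀ t ≤ q, s.nat DIST (j * N + t) ≤ r ↔ X t j
  order : ∀ i < q, s.nat QUEUE i = U i
  parent : ∀ i < q, s.nat UP i = V i

/-- `IsPrepared` depends on the listed arrays only. -/
theorem IsPrepared.congr {p k q r N : ℕ} {cf X : ℕ → ℕ → Prop} {U V : ℕ → ℕ} {s s' : State}
    (h : IsPrepared p k q r N cf X U V s)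
    (hs : ∀ a ∈ [0, CODES, RADIUS, MUL, PREF, LAST, MULB, MULK, BAD, DIST, QUEUE, UP],
      s'.nat a = s.nat a) : IsPrepared p k q r N cf X U V s' := by
  obtain ⟨h1, h2, h3, h4, h5, h6, h7, h8, h9, h10, h11⟩ := h
  constructor <;> simpa [hs]

/-- Sets all entries of the tables to zero. -/
def resetTables : Program :=
  forLoop IA (rd MULK (rd 0 1 + 1)) (.setRat FTAB (var IA) (.const 0))

theorem halts_resetTables {s : State} {q K : ℕ} (hq : s.nat 0 1 = q)
    (hM : s.nat MULK (q + 1) = (q + 1) * K) :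
    Halts resetTables s (30 * ((q + 1) * K + 1)) fun s' =>
      ∀ x < (q + 1) * K, s'.rat FTAB x = 0 := by
  refine (Halts.forLoop (c := 4) ((q + 1) * K) (fun m s' => ∀ x < m, s'.rat FTAB x = 0)
    (by decide) ?_ ?_ ?_).mono ?_ fun _ _ h => h
  · intro s' hs'
    simp [hs'.nat 0 (by decide), hs'.nat MULK (by decide), hq, hM]
  · simp
  · intro m hm s' hs' hi hI
    refine (Halts.of_loopFree rfl ?_).mono (by simp) fun _ _ h => h
    intro x hx
    by_cases hxm : x = m
    · simp [hi, hxm]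
    · simp [hi, hxm, hI x (by omega)]
  · simp; omega

/-- Tabulates the values of `CodeValues` for all codes. -/
def projectCodes : Program :=
  .seq (.seq (.setNat PROJ 0 0) (.seq (.setNat OUTX 0 0) (.setRat GAIN 0 (.const 0)))) <|
  forLoop IB (var CODES) <|
  .seq (.setRat MTAB (var IB) (.const 0)) <|
  .branch (.natEq (rd LAST (var IB)) 0)
    (.seq (.setNat PROJ (var IB) (rd MULB (rd PROJ (rd PREF (var IB)))))
      (.seq (.setNat OUTX (var IB) (rd OUTX (rd PREF (var IB))))
        (.setRat GAIN (var IB) (.get GAIN (rd PREF (var IB)))))) <|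
  .branch (.natLe (rd DIST (rd MUL (rd LAST (var IB) - 1) + var NEXT)) (var RADIUS))
    (.seq (.setRat GAIN (var IB) (.get GAIN (rd PREF (var IB)))) <|
      .branch (.natLe (rd DIST (rd MUL (rd LAST (var IB) - 1) + var NODE)) (var RADIUS))
        (.seq (.setNat PROJ (var IB) (rd MULB (rd PROJ (rd PREF (var IB))) + rd LAST (var IB)))
          (.setNat OUTX (var IB) (rd OUTX (rd PREF (var IB)))))
        (.seq (.setNat PROJ (var IB) (rd MULB (rd PROJ (rd PREF (var IB)))))
          (.setNat OUTX (var IB) 1)))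
    (.seq (.setRat GAIN (var IB)
        (.add (.get GAIN (rd PREF (var IB))) (.get 0 (rd LAST (var IB) - 1)))) <|
      .seq (.setNat PROJ (var IB) (rd MULB (rd PROJ (rd PREF (var IB))))) <|
      .branch (.natLe (rd DIST (rd MUL (rd LAST (var IB) - 1) + var NODE)) (var RADIUS))
        (.setNat OUTX (var IB) (rd OUTX (rd PREF (var IB))))
        (.setNat OUTX (var IB) 1))

/-- Codes are treated in increasing order; the code `c / (p + 1)` without the last digit of `c`
comes before `c`, unless `c` is zero. -/
theorem halts_projectCodes {s : State} {p k q r N u v : ℕ} {cf X : ℕ → ℕ → Prop} {U V : ℕ → ℕ}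
    {w : ℕ → ℚ} (h : IsPrepared p k q r N cf X U V s) (hw : ∀ j < p, s.rat 0 j = w j)
    (hu : s.nat NODE 0 = u) (hv : s.nat NEXT 0 = v) (huq : u ≤ q) (hvq : v ≤ q) :
    Halts projectCodes s (200 * ((p + 1) ^ k + 1)) fun s' => ∀ c < (p + 1) ^ k,
      s'.rat MTAB c = 0 ∧
      CodeValues p k X w u v c (s'.nat PROJ c) (s'.nat OUTX c) (s'.rat GAIN c) := by
  set K := (p + 1) ^ k with hK
  refine (Halts.exec_seq rfl (Halts.forLoop (c := 120) K (fun m s' =>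
    (∀ c < m, s'.rat MTAB c = 0) ∧ ∀ c, c < m ∨ c = 0 →
      CodeValues p k X w u v c (s'.nat PROJ c) (s'.nat OUTX c) (s'.rat GAIN c))
    (by decide) ?_ ?_ ?_)).mono ?_ fun _ _ h => fun c hc => ⟨h.1 c hc, h.2 c (.inl hc)⟩
  · intro s' hs'
    simp [hs'.nat CODES (by decide), h.codes, hK]
  · refine ⟨by simp, ?_⟩
    rintro c (hc | rfl)
    · omega
    · simpa using codeValues_zero
  · intro c hc s' hs' hi hI
    refine (Halts.of_loopFree rfl ?_).mono (by simp) fun _ _ h => h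
    have hb : 0 < p + 1 := by omega
    obtain ⟨h1, h2, -⟩ := h.digits c hc
    have hle := Nat.div_le_self c (p + 1)
    have hprev := hI.2 (c / (p + 1)) (by
      rcases Nat.lt_or_ge (c / (p + 1)) c with h | h
      · exact .inl h
      · right
        by_contra h0
        have h3 : 0 < c := by omega
        have h4 : 1 < p + 1 := by
          by_contra hp1
          have : p = 0 := by omega
          subst this
          simp at hK
          omega
        have := Nat.div_lt_self h3 h4
        omega)
    have hmulb := (h.digits (s'.nat PROJ (c / (p + 1))) (by have := hprev.le; omega)).2.2
    have e1 : s'.nat LAST c = c % (p + 1) := by rw [hs'.nat LAST (by decide)]; simpa using h2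
    have e2 : s'.nat PREF c = c / (p + 1) := by rw [hs'.nat PREF (by decide)]; simpa using h1
    have e3 : s'.nat MULB (s'.nat PROJ (c / (p + 1))) = s'.nat PROJ (c / (p + 1)) * (p + 1) := by
      rw [hs'.nat MULB (by decide)]; simpa using hmulb
    have e4 : s'.nat NODE 0 = u := by rw [hs'.nat NODE (by decide)]; simpa using hu
    have e5 : s'.nat NEXT 0 = v := by rw [hs'.nat NEXT (by decide)]; simpa using hv
    have e6 : s'.nat RADIUS 0 = r := by rw [hs'.nat RADIUS (by decide)]; simpa using h.radius
    have e7 : c % (p + 1) ≠ 0 → ∀ t ≤ q,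
        (s'.nat DIST (s'.nat MUL (c % (p + 1) - 1) + t) ≤ r ↔ X t (c % (p + 1) - 1)) := by
      intro h0 t ht
      have hj : c % (p + 1) - 1 < p := by have := Nat.mod_lt c hb; omega
      rw [← h.meets _ hj t ht, ← h.mul _ hj, hs'.nat DIST (by decide), hs'.nat MUL (by decide)]
      simp
    have e8 : c % (p + 1) ≠ 0 → s'.rat 0 (c % (p + 1) - 1) = w (c % (p + 1) - 1) := by
      intro h0
      have hj : c % (p + 1) - 1 < p := by have := Nat.mod_lt c hb; omega
      rw [hs'.rat 0 (by decide), ← hw _ hj]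
      simp
    have hset : ∀ x y g, CodeValues p k X w u v c x y g →
        (∀ c' < c + 1, Function.update (s'.rat MTAB) c 0 c' = 0) ∧
        ∀ c', c' < c + 1 ∨ c' = 0 → CodeValues p k X w u v c'
          (Function.update (s'.nat PROJ) c x c') (Function.update (s'.nat OUTX) c y c')
          (Function.update (s'.rat GAIN) c g c') := by
      intro x y g hxy
      refine ⟨fun c' hc' => ?_, fun c' hc' => ?_⟩
      · by_cases h : c' = c
        · simp [h]
        · simp [h, hI.1 c' (by omega)]
      · by_cases h : c' = c
        · subst h; simpa using hxy
        · simpa [h] using hI.2 c' (by omega)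
    by_cases h0 : c % (p + 1) = 0
    · have := hset _ _ _ (hprev.of_div (a := 0) (y' := s'.nat OUTX (c / (p + 1)))
        (g' := s'.rat GAIN (c / (p + 1))) hc (by simp [h0]) (by simp) (by simp) (by simp [h0])
        (by simp [h0]) (by simp))
      simpa [hi, e1, e2, e3, h0] using this
    · have e9 := e7 h0 v hvq
      have e10 := e7 h0 u huq
      have e11 := e8 h0
      by_cases hX : X v (c % (p + 1) - 1) <;> by_cases hX' : X u (c % (p + 1) - 1)
      · have := hset _ _ _ (hprev.of_div (a := c % (p + 1)) (y' := s'.nat OUTX (c / (p + 1)))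
          (g' := s'.rat GAIN (c / (p + 1))) hc (by simp) (by simp [*]) (by simp) (by simp [*])
          (by simp [*]) (by simp))
        simpa [hi, e1, e2, e3, e4, e5, e6, h0, e9, e10, hX, hX'] using this
      · have := hset _ _ _ (hprev.of_div (a := 0) (y' := 1)
          (g' := s'.rat GAIN (c / (p + 1))) hc (by simp [*]) (by simp) (by simp [*]) (by simp)
          (by simp [*]) (by simp))
        simpa [hi, e1, e2, e3, e4, e5, e6, h0, e9, e10, hX, hX'] using this
      · have := hset _ _ _ (hprev.of_div (a := 0) (y' := s'.nat OUTX (c / (p + 1)))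
          (g' := s'.rat GAIN (c / (p + 1)) + w (c % (p + 1) - 1)) hc (by simp [*]) (by simp)
          (by simp) (by simp [*]) (by simp) (by simp [*]))
        simpa [hi, e1, e2, e3, e4, e5, e6, h0, e9, e10, e11, hX, hX'] using this
      · have := hset _ _ _ (hprev.of_div (a := 0) (y' := 1)
          (g' := s'.rat GAIN (c / (p + 1)) + w (c % (p + 1) - 1)) hc (by simp [*]) (by simp)
          (by simp [*]) (by simp) (by simp) (by simp [*]))
        simpa [hi, e1, e2, e3, e4, e5, e6, h0, e9, e10, e11, hX, hX'] using this
  · simp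
    omega

/-- Maximizes over all valid codes with the same projection. -/
def maximize : Program :=
  forLoop IB (var CODES) <| .branch
    (.and (.and (.natEq (rd BAD (var IB)) 0) (.natEq (rd OUTX (var IB)) 0))
      (.not (.ratLe (.add (.get FTAB (rd MULK (var NODE) + var IB)) (.get GAIN (var IB)))
        (.get MTAB (rd PROJ (var IB))))))
    (.setRat MTAB (rd PROJ (var IB))
      (.add (.get FTAB (rd MULK (var NODE) + var IB)) (.get GAIN (var IB)))) .skip

theorem halts_maximize {s : State} {K row : ℕ} {valid : ℕ → Prop} (hK : s.nat CODES 0 = K)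
    (hrow : s.nat MULK (s.nat NODE 0) = row)
    (hval : ∀ c < K, valid c ↔ s.nat BAD c = 0 ∧ s.nat OUTX c = 0)
    (hM : ∀ c < K, s.rat MTAB c = 0) :
    Halts maximize s (100 * (K + 1)) fun s' =>
      (∀ c < K, valid c → s.rat FTAB (row + c) + s.rat GAIN c ≤ s'.rat MTAB (s.nat PROJ c)) ∧
      ∀ c < K, s'.rat MTAB c = 0 ∨ ∃ c' < K, valid c' ∧ s.nat PROJ c' = c ∧
        s'.rat MTAB c = s.rat FTAB (row + c') + s.rat GAIN c' := by
  refine (Halts.forLoop (c := 70) K (fun m s' =>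
      (∀ c < m, valid c → s.rat FTAB (row + c) + s.rat GAIN c ≤ s'.rat MTAB (s.nat PROJ c)) ∧
      ∀ c < K, s'.rat MTAB c = 0 ∨ ∃ c' < K, valid c' ∧ s.nat PROJ c' = c ∧
        s'.rat MTAB c = s.rat FTAB (row + c') + s.rat GAIN c') (by decide) ?_ ?_ ?_).mono ?_
    fun _ _ h => h
  · intro s' hs'
    simp [hs'.nat CODES (by decide), hK]
  · refine ⟨by simp, fun c hc => .inl ?_⟩
    simpa using hM c hc
  · intro m hm s' hs' hi hI
    refine (Halts.of_loopFree rfl ?_).mono (by simp) fun _ _ h => h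
    have e1 := hs'.nat BAD (by decide)
    have e2 := hs'.nat OUTX (by decide)
    have e3 := hs'.nat MULK (by decide)
    have e4 := hs'.nat NODE (by decide)
    have e5 := hs'.nat PROJ (by decide)
    have e6 := hs'.rat FTAB (by decide)
    have e7 := hs'.rat GAIN (by decide)
    have hv := hval m hm
    rw [Program.exec]
    split_ifs with hif
    · simp only [Test.eval, NatExpr.eval,
        RatExpr.eval, hi, e1, e2, e3, e4, e5, e6, e7, hrow, ← hv] at hif
      simp only [Program.exec, NatExpr.eval, RatExpr.eval, hi, e3, e4, e5, e6,
        e7, hrow, State.writeNat_rat, State.writeRat_rat_self]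
      refine ⟨fun c hc hvc => ?_, fun c hc => ?_⟩
      · by_cases hPc : s.nat PROJ c = s.nat PROJ m
        · rw [hPc, Function.update_self]
          rcases Nat.lt_succ_iff_lt_or_eq.1 hc with h | rfl
          · have h1 := hI.1 c h hvc
            rw [hPc] at h1
            exact h1.trans (le_of_not_ge hif.2)
          · exact le_rfl
        · rw [Function.update_of_ne hPc]
          rcases Nat.lt_succ_iff_lt_or_eq.1 hc with h | rfl
          · exact hI.1 c h hvc
          · exact absurd rfl hPc
      · by_cases hPc : c = s.nat PROJ m
        · rw [hPc, Function.update_self]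
          exact .inr ⟨m, hm, hif.1, rfl, rfl⟩
        · rw [Function.update_of_ne hPc]
          exact hI.2 c hc
    · simp only [Test.eval, NatExpr.eval,
        RatExpr.eval, hi, e1, e2, e3, e4, e5, e6, e7, hrow, ← hv] at hif
      refine ⟨fun c hc hvc => ?_, hI.2⟩
      rcases Nat.lt_succ_iff_lt_or_eq.1 hc with h | rfl
      · exact hI.1 c h hvc
      · by_contra hle
        exact hif ⟨hvc, hle⟩
  · simp
    omega

/-- Adds the maxima to the table of the parent. -/
def addMaxima : Program :=
  forLoop IB (var CODES) <| .setRat FTAB (rd MULK (var NEXT) + var IB)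
    (.add (.get FTAB (rd MULK (var NEXT) + var IB)) (.get MTAB (rd PROJ (var IB))))

theorem halts_addMaxima {s : State} {K v : ℕ} (hK : s.nat CODES 0 = K) (hv : s.nat NEXT 0 = v)
    (hrow : s.nat MULK v = v * K) :
    Halts addMaxima s (50 * (K + 1)) fun s' => ∀ t, ∀ c < K,
      (t = v → s'.rat FTAB (t * K + c) = s.rat FTAB (t * K + c) + s.rat MTAB (s.nat PROJ c)) ∧
      (t ≠ v → s'.rat FTAB (t * K + c) = s.rat FTAB (t * K + c)) := by
  refine (Halts.forLoop (c := 30) K (fun m s' => ∀ t, ∀ c < K,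
      (t = v ∧ c < m →
        s'.rat FTAB (t * K + c) = s.rat FTAB (t * K + c) + s.rat MTAB (s.nat PROJ c)) ∧
      (¬ (t = v ∧ c < m) → s'.rat FTAB (t * K + c) = s.rat FTAB (t * K + c))) (by decide)
      ?_ ?_ ?_).mono ?_
    fun _ _ h t c hc => ⟨fun ht => (h t c hc).1 ⟨ht, hc⟩, fun ht => (h t c hc).2 fun h' => ht h'.1⟩
  · intro s' hs'
    simp [hs'.nat CODES (by decide), hK]
  · simp
  · intro m hm s' hs' hi hI
    refine (Halts.of_loopFree rfl ?_).mono (by simp) fun _ _ h => h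
    have hold := (hI v m hm).2 (by simp)
    intro t c hc
    by_cases h : t * K + c = v * K + m
    · obtain ⟨rfl, rfl⟩ := (rowCol_inj hc hm).1 h
      simp [hi, hs'.nat NEXT (by decide), hs'.nat MULK (by decide), hs'.nat PROJ (by decide), hv,
        hrow, hold, hs'.rat MTAB (by decide)]
    · have h' : ¬ (t = v ∧ c = m) := fun h' => h ((rowCol_inj hc hm).2 h')
      have h1 : (t = v ∧ c < m + 1) ↔ (t = v ∧ c < m) := by
        constructor
        · rintro ⟨h1, h2⟩; exact ⟨h1, by omega⟩
        · rintro ⟨h1, h2⟩; exact ⟨h1, by omega⟩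
      rw [h1]
      simpa [hi, hs'.nat NEXT (by decide), hs'.nat MULK (by decide), hv, hrow, h] using hI t c hc
  · simp
    omega

end RAM

namespace RAM

/-- The tables in the memory, by nodes and codes. -/
def State.tables (s : State) (q K t c : ℕ) : ℚ :=
  if t ≤ q ∧ c < K then s.rat FTAB (t * K + c) else 0

/-- Eliminates the node at position `IA` of the elimination order. -/
def eliminateNode : Program :=
  .seq (.seq (setVar NODE (rd QUEUE (var IA))) (setVar NEXT (rd UP (var IA)))) <|
  .seq projectCodes (.seq maximize addMaxima)

theorem halts_eliminateNode {s : State} {p k q r N i : ℕ} {cf X : ℕ → ℕ → Prop} {U V : ℕ → ℕ}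
    {w : ℕ → ℚ} (h : IsPrepared p k q r N cf X U V s) (hw : ∀ j < p, s.rat 0 j = w j)
    (hi : s.nat IA 0 = i) (hiq : i < q) (hu : U i ≤ q) (hv : V i ≤ q) :
    Halts eliminateNode s (400 * ((p + 1) ^ k + 1)) fun s' => ∃ P M,
      TablesStep p k cf X w (U i) (V i) (s.tables q ((p + 1) ^ k)) (s'.tables q ((p + 1) ^ k))
        P M := by
  set K := (p + 1) ^ k with hK
  set s₀ := (Program.seq (setVar NODE (rd QUEUE (var IA))) (setVar NEXT (rd UP (var IA)))).exec s
    with hs₀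
  have h₀ : IsPrepared p k q r N cf X U V s₀ := by
    refine h.congr fun a ha => ?_
    simp only [List.mem_cons, List.not_mem_nil, or_false] at ha
    rcases ha with rfl | rfl | rfl | rfl | rfl | rfl | rfl | rfl | rfl | rfl | rfl | rfl <;>
    simp [hs₀]
  have hN₀ : s₀.nat NODE 0 = U i := by simp [hs₀, hi, h.order i hiq]
  have hV₀ : s₀.nat NEXT 0 = V i := by simp [hs₀, hi, h.parent i hiq]
  have hF₀ : s₀.rat = s.rat := by simp [hs₀]
  refine (Halts.exec_seq rfl (Halts.seq (halts_projectCodes h₀ (w := w)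
    (fun j hj => by rw [hF₀]; exact hw j hj) hN₀ hV₀ hu hv) fun s₁ hs₁ h₁ =>
    Halts.seq (halts_maximize (K := K) (row := U i * K) (valid := IsValid p k cf X (U i))
      ?_ ?_ ?_ ?_) fun s₂ hs₂ h₂ =>
    (halts_addMaxima (K := K) (v := V i) ?_ ?_ ?_).mono le_rfl fun s₃ hs₃ h₃ =>
      ⟨s₁.nat PROJ, s₂.rat MTAB, ?_⟩)).mono ?_ fun _ _ h => h
  · rw [hs₁.nat CODES (by decide), h₀.codes]
  · rw [hs₁.nat MULK (by decide), hs₁.nat NODE (by decide), hN₀, h₀.rows _ (by omega)]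
  · intro c hc
    rw [IsValid, hs₁.nat BAD (by decide), h₀.good c hc, (h₁ c hc).2.inside]
    exact ⟨fun h => h.2, fun h => ⟨hc, h⟩⟩
  · exact fun c hc => (h₁ c hc).1
  · rw [hs₂.nat CODES (by decide), hs₁.nat CODES (by decide), h₀.codes]
  · rw [hs₂.nat NEXT (by decide), hs₁.nat NEXT (by decide), hV₀]
  · rw [hs₂.nat MULK (by decide), hs₁.nat MULK (by decide), h₀.rows _ (by omega)]
  · simp
    omega
  · have hF : ∀ t c, t ≤ q → c < K → s.tables q K t c = s₁.rat FTAB (t * K + c) := by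
      intro t c ht hc
      rw [State.tables, if_pos ⟨ht, hc⟩, hs₁.rat FTAB (by decide), hF₀]
    have hF₂ : s₂.rat FTAB = s₁.rat FTAB := hs₂.rat FTAB (by decide)
    have hP : s₂.nat PROJ = s₁.nat PROJ := hs₂.nat PROJ (by decide)
    rw [hF₂, hP] at h₃
    refine ⟨fun c hc => ⟨(h₁ c hc).2.le.trans_lt hc, (h₁ c hc).2.proj⟩, fun c hc => ?_,
      fun c hc => ?_, fun c hc => ?_, fun t ht c => ?_, fun t c hc => ?_⟩
    · rw [hF _ _ hu hc.1, ← (h₁ c hc.1).2.gain_eq]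
      exact h₂.1 c hc.1 hc
    · rcases h₂.2 c hc with h | ⟨c', hc', hval, hPc, hM⟩
      · exact .inl h
      · refine .inr ⟨c', hval, hPc, ?_⟩
        rw [hM, hF _ _ hu hc', (h₁ c' hc').2.gain_eq]
    · rw [hF _ _ hv hc, State.tables, if_pos ⟨hv, hc⟩]
      exact (h₃ (V i) c hc).1 rfl
    · by_cases htc : t ≤ q ∧ c < K
      · rw [hF _ _ htc.1 htc.2, State.tables, if_pos htc]
        exact (h₃ t c htc.2).2 ht
      · rw [State.tables, State.tables, if_neg htc, if_neg htc]
    · rw [State.tables, State.tables, if_neg (by omega), if_neg (by omega)]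

/-- Computes the largest weight of a packing, for the weights in array `0`. -/
def dynamicProgram : Program :=
  .seq resetTables <| .seq (forLoop IA (rd 0 1) eliminateNode) <|
  .setRat BEST 0 (.get FTAB (rd MULK (rd 0 1)))

theorem IsPrepared.of_dynamicProgram {p k q r N : ℕ} {cf X : ℕ → ℕ → Prop} {U V : ℕ → ℕ}
    {s s' : State} (h : IsPrepared p k q r N cf X U V s) (hs : Frame dynamicProgram s s') :
    IsPrepared p k q r N cf X U V s' := by
  refine h.congr fun a ha => hs.nat a ?_
  revert a
  decide

theorem halts_dynamicProgram {s : State} {p k q r N : ℕ} {cf X : ℕ → ℕ → Prop} {U V : ℕ → ℕ}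
    {w : ℕ → ℚ} (h : IsPrepared p k q r N cf X U V s) (hE : EliminationScheme p k q cf X U V)
    (hw : ∀ j < p, s.rat 0 j = w j) (hw0 : ∀ j < p, 0 ≤ w j) :
    Halts dynamicProgram s (1000 * ((q + 1) * ((p + 1) ^ k + 1))) fun s' =>
      IsMaxWeight p cf w (s'.rat BEST 0) := by
  have hK0 : 0 < (p + 1) ^ k := by positivity
  set K := (p + 1) ^ k with hK
  refine (Halts.seq (halts_resetTables h.nodes (h.rows (q + 1) le_rfl)) fun s₁ hs₁ h₁ =>
    Halts.seq (Halts.forLoop (c := 400 * (K + 1)) q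
      (fun i s' => TablesExact p k q cf X U w i (s'.tables q K)) (by decide) ?_ ?_ ?_)
    fun s₂ hs₂ h₂ => Halts.of_loopFree rfl ?_).mono ?_ fun _ _ h => h
  · intro s' hs'
    simp [hs'.nat 0 (by decide), hs₁.nat 0 (by decide), h.nodes]
  · have : (s₁.writeNat IA 0 0).tables q K = fun _ _ => 0 := by
      funext t c
      rw [State.tables]
      split_ifs with htc
      · refine h₁ _ ?_
        change _ < (q + 1) * K
        have := Nat.mul_le_mul_right K htc.1
        rw [Nat.add_mul]; omega
      · rfl
    rw [this]
    exact hE.tablesExact_zero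
  · intro i hi s' hs' hi' hI
    have h' : IsPrepared p k q r N cf X U V s' := by
      refine h.congr fun a ha => ?_
      rw [hs'.nat a (by revert a; decide), hs₁.nat a (by revert a; decide)]
    refine (halts_eliminateNode h' (w := w) (fun j hj => ?_) hi' hi (hE.U_lt i hi).le
      (hE.V_remains i hi).1).mono le_rfl fun s'' _ ⟨P, M, hS⟩ => ?_
    · rw [hs'.rat 0 (by decide), hs₁.rat 0 (by decide), hw j hj]
    · exact hE.tablesExact_succ hw0 hi hI hS
  · have h3 := hE.isMaxWeight h₂
    have e0 : s₂.nat 0 1 = q := by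
      rw [hs₂.nat 0 (by decide), hs₁.nat 0 (by decide), h.nodes]
    have e1 : s₂.nat MULK q = q * K := by
      rw [hs₂.nat MULK (by decide), hs₁.nat MULK (by decide), h.rows q (by omega)]
    rw [State.tables, if_pos ⟨le_rfl, hK0⟩] at h3
    simpa [e0, e1] using h3
  · simp
    nlinarith [Nat.zero_le (q * K)]

end RAM

/-! ### From the largest weight to a packing -/

/-- The invariant of the selection of a packing of largest weight `x`, when the members before `m`
have been decided: the weights `w'` arise from `w` by setting the weights of the members that were
not selected to zero, this does not change the largest weight, and every conflict-free set of
weight `x` contains all selected members. -/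
structure SelectionInvariant (p : ℕ) (cf : ℕ → ℕ → Prop) (w : ℕ → ℚ) (x : ℚ) (m : ℕ)
    (w' : ℕ → ℚ) (out : ℕ → ℕ) : Prop where
  nonneg : ∀ j < p, 0 ≤ w' j
  max : IsMaxWeight p cf w' x
  selected : ∀ j < m, out j = 1 → w' j = w j ∧ ∀ I : Finset ℕ, (∀ i ∈ I, i < p) →
    IsConflictFree cf I → j ∉ I → ∑ i ∈ I, w' i < x
  dropped : ∀ j < m, out j ≠ 1 → w' j = 0
  rest : ∀ j, m ≤ j → j < p → w' j = w j
  out_rest : ∀ j, m ≤ j → out j = 0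

section

variable {p m : ℕ} {cf : ℕ → ℕ → Prop} {w w' : ℕ → ℚ} {x : ℚ} {out : ℕ → ℕ}

theorem sum_update_zero_le (h : ∀ j < p, 0 ≤ w' j) {I : Finset ℕ} (hI : ∀ i ∈ I, i < p) :
    ∑ i ∈ I, Function.update w' m 0 i ≤ ∑ i ∈ I, w' i := by
  refine Finset.sum_le_sum fun i hi => ?_
  by_cases him : i = m
  · subst him; simpa using h i (hI i hi)
  · simp [him]

theorem SelectionInvariant.drop (h : SelectionInvariant p cf w x m w' out) (hm : m < p) {x' : ℚ}
    (hx' : IsMaxWeight p cf (Function.update w' m 0) x') (hx : x ≤ x') :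
    SelectionInvariant p cf w x (m + 1) (Function.update w' m 0) out := by
  obtain ⟨I, hI, hcf, hsum⟩ := hx'.attained
  have hle : x' ≤ x := hsum ▸ (sum_update_zero_le h.nonneg hI).trans (h.max.le I hI hcf)
  obtain rfl : x = x' := le_antisymm hx hle
  refine ⟨fun j hj => ?_, hx', fun j hj ho => ?_, fun j hj ho => ?_, fun j hj hjp => ?_,
    fun j hj => h.out_rest j (by omega)⟩
  · by_cases hjm : j = m
    · simp [hjm]
    · simpa [hjm] using h.nonneg j hj
  · have hjm : j ≠ m := by
      rintro rfl
      rw [h.out_rest j le_rfl] at ho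
      exact zero_ne_one ho
    obtain ⟨h1, h2⟩ := h.selected j (by omega) ho
    refine ⟨by simpa [hjm] using h1, fun I hI hcf hjI => ?_⟩
    exact (sum_update_zero_le h.nonneg hI).trans_lt (h2 I hI hcf hjI)
  · by_cases hjm : j = m
    · simp [hjm]
    · simpa [hjm] using h.dropped j (by omega) ho
  · simpa [show j ≠ m by omega] using h.rest j (by omega) hjp

theorem SelectionInvariant.select (h : SelectionInvariant p cf w x m w' out) (hm : m < p) {x' : ℚ}
    (hx' : IsMaxWeight p cf (Function.update w' m 0) x') (hx : x' < x) :
    SelectionInvariant p cf w x (m + 1) w' (Function.update out m 1) := by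
  refine ⟨h.nonneg, h.max, fun j hj ho => ?_, fun j hj ho => ?_,
    fun j hj hjp => h.rest j (by omega) hjp, fun j hj => ?_⟩
  · by_cases hjm : j = m
    · subst hjm
      refine ⟨h.rest j le_rfl hm, fun I hI hcf hjI => ?_⟩
      refine lt_of_le_of_lt ?_ hx
      refine le_trans (le_of_eq (Finset.sum_congr rfl fun i hi => ?_)) (hx'.le I hI hcf)
      rw [Function.update_of_ne]
      rintro rfl
      exact hjI hi
    · exact h.selected j (by omega) (by simpa [hjm] using ho)
  · have hjm : j ≠ m := by
      rintro rfl
      simp at ho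
    exact h.dropped j (by omega) (by simpa [hjm] using ho)
  · simpa [show j ≠ m by omega] using h.out_rest j (by omega)

theorem SelectionInvariant.final (h : SelectionInvariant p cf w x p w' out) :
    IsConflictFree cf ((Finset.range p).filter fun j => out j = 1) ∧
      ∑ j ∈ (Finset.range p).filter (fun j => out j = 1), w j = x := by
  obtain ⟨I, hI, hcf, hsum⟩ := h.max.attained
  have hsub : (Finset.range p).filter (fun j => out j = 1) ⊆ I := by
    intro j hj
    obtain ⟨hjp, ho⟩ := Finset.mem_filter.1 hj
    by_contra hjI
    exact ((h.selected j (Finset.mem_range.1 hjp) ho).2 I hI hcf hjI).ne hsum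
  refine ⟨fun a ha b hb => hcf a (hsub ha) b (hsub hb), ?_⟩
  rw [← hsum, ← Finset.sum_subset hsub fun j hj hj' => h.dropped j (hI j hj) fun ho =>
    hj' (Finset.mem_filter.2 ⟨Finset.mem_range.2 (hI j hj), ho⟩)]
  refine Finset.sum_congr rfl fun j hj => ?_
  obtain ⟨hjp, ho⟩ := Finset.mem_filter.1 hj
  exact ((h.selected j (Finset.mem_range.1 hjp) ho).1).symm

end

namespace RAM

/-- Decides the members one after another. A member is dropped, by setting its weight to zero, if
this does not change the largest weight. -/
def selectPacking : Program :=
  .seq dynamicProgram <| .seq (.setRat TOTAL 0 (.get BEST 0)) <| forLoop IC (rd 0 2) <|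
  .seq (.seq (.setRat SAVED 0 (.get 0 (var IC))) (.setRat 0 (var IC) (.const 0))) <|
  .seq dynamicProgram <|
  .branch (.ratLe (.get TOTAL 0) (.get BEST 0)) .skip
    (.seq (.setRat 0 (var IC) (.get SAVED 0)) (.setNat OUT (var IC) 1))

theorem halts_selectPacking {s : State} {p k q r N : ℕ} {cf X : ℕ → ℕ → Prop} {U V : ℕ → ℕ}
    {w : ℕ → ℚ} (h : IsPrepared p k q r N cf X U V s) (hE : EliminationScheme p k q cf X U V)
    (hw : ∀ j < p, s.rat 0 j = w j) (hw0 : ∀ j < p, 0 ≤ w j) (hout : ∀ j, s.nat OUT j = 0) :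
    Halts selectPacking s (1100 * ((p + 2) * ((q + 1) * ((p + 1) ^ k + 1)))) fun s' =>
      IsConflictFree cf ((Finset.range p).filter fun j => s'.nat OUT j = 1) ∧
      IsMaxWeight p cf w (∑ j ∈ (Finset.range p).filter (fun j => s'.nat OUT j = 1), w j) := by
  set K := (p + 1) ^ k with hK
  refine (Halts.seq (halts_dynamicProgram h hE hw hw0) fun s₁ hs₁ h₁ =>
    Halts.exec_seq rfl ((Halts.forLoop (c := 1000 * ((q + 1) * (K + 1)) + 30) p
      (fun m s' => SelectionInvariant p cf w (s₁.rat BEST 0) m (s'.rat 0) (s'.nat OUT))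
      (by decide) ?_ ?_ ?_).mono le_rfl fun s' _ h' => ?_)).mono ?_ fun _ _ h => h
  · intro s' hs'
    simp [hs'.nat 0 (by decide), hs₁.nat 0 (by decide), h.members]
  · have e1 : s₁.rat 0 = s.rat 0 := hs₁.rat 0 (by decide)
    have e2 : s₁.nat OUT = s.nat OUT := hs₁.nat OUT (by decide)
    have hmax : IsMaxWeight p cf (s.rat 0) (s₁.rat BEST 0) := by
      have hc : ∀ I : Finset ℕ, (∀ j ∈ I, j < p) → ∑ j ∈ I, s.rat 0 j = ∑ j ∈ I, w j :=
        fun I hI => Finset.sum_congr rfl fun j hj => hw j (hI j hj)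
      obtain ⟨I, hI, hcf, hsum⟩ := h₁.attained
      exact ⟨fun I hI hcf => (hc I hI).trans_le (h₁.le I hI hcf), I, hI, hcf,
        (hc I hI).trans hsum⟩
    have : SelectionInvariant p cf w (s₁.rat BEST 0) 0 (s.rat 0) (s.nat OUT) :=
      ⟨fun j hj => by rw [hw j hj]; exact hw0 j hj, hmax, by simp, by simp,
        fun j _ hj => hw j hj, fun j _ => hout j⟩
    simpa [e1, e2] using this
  · intro m hm s' hs' hi hI
    set s₀ := (Program.seq (.setRat SAVED 0 (.get 0 (var IC)))
      (.setRat 0 (var IC) (.const 0))).exec s' with hs₀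
    have e1 : s₀.rat 0 = Function.update (s'.rat 0) m 0 := by simp [hs₀, hi]
    have e2 : s₀.nat = s'.nat := by simp [hs₀]
    have e3 : s₀.rat SAVED 0 = s'.rat 0 m := by simp [hs₀, hi]
    have e4 : s₀.rat TOTAL 0 = s₁.rat BEST 0 := by simp [hs₀, hs'.rat TOTAL (by decide)]
    have hp₀ : IsPrepared p k q r N cf X U V s₀ := by
      refine (h.of_dynamicProgram hs₁).congr fun a ha => ?_
      rw [e2, hs'.nat a (by revert a; decide)]
      simp
    refine (Halts.exec_seq rfl (Halts.seq (halts_dynamicProgram hp₀ hE (w := s₀.rat 0)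
      (fun _ _ => rfl) fun j hj => ?_) fun s₂ hs₂ h₂ => Halts.of_loopFree rfl ?_)).mono ?_
      fun _ _ h => h
    · rw [e1]
      by_cases hjm : j = m
      · simp [hjm]
      · simpa [hjm] using hI.nonneg j hj
    · rw [e1] at h₂
      have f1 : s₂.rat TOTAL 0 = s₁.rat BEST 0 := by rw [hs₂.rat TOTAL (by decide)]; exact e4
      have f2 : s₂.rat 0 = Function.update (s'.rat 0) m 0 := by
        rw [hs₂.rat 0 (by decide)]; exact e1
      have f3 : s₂.rat SAVED 0 = s'.rat 0 m := by rw [hs₂.rat SAVED (by decide)]; exact e3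
      have f4 : s₂.nat OUT = s'.nat OUT := by rw [hs₂.nat OUT (by decide)]; exact congrFun e2 _
      have f5 : s₂.nat IC 0 = m := by
        rw [hs₂.nat IC (by decide)]; exact (congrFun (congrFun e2 _) _).trans hi
      by_cases hle : s₁.rat BEST 0 ≤ s₂.rat BEST 0
      · simpa [f1, f2, f4, hle] using hI.drop hm h₂ hle
      · have := hI.select hm h₂ (lt_of_not_ge hle)
        simpa [f1, f2, f3, f4, f5, hle] using this
    · rw [← hK]
      simp
      omega
  · obtain ⟨h2, h3⟩ := h'.final
    exact ⟨h2, by rw [h3]; exact h₁⟩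
  · have h0 : 1 ≤ (q + 1) * (K + 1) := Nat.mul_pos (by omega) (by omega)
    simp
    nlinarith [Nat.mul_le_mul_left p h0]

end RAM

/-! ### The layout of the input -/

section

variable {n q p : ℕ} {G : SimpleGraph (Fin n)} {D : TreeDecomposition G (Fin q)}
  {H : Fin p → G.Subgraph}

/-- The rows of the incidence table: the bags, an empty row, and the subgraphs of the family. -/
def InputLists.row (x : InputLists D H) (ρ : ℕ) : List ℕ :=
  if h : ρ < q then (x.bags ⟨ρ, h⟩).map Fin.val else
  if h : ρ - (q + 1) < p ∧ q < ρ then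
    (x.subVerts ⟨ρ - (q + 1), h.1⟩).map Fin.val else []

/-- The edges of subgraph `j`, as a sequence of ends. -/
def InputLists.ends (x : InputLists D H) (j : ℕ) : List ℕ :=
  if h : j < p then (x.subEdges ⟨j, h⟩).flatMap fun e => [(e.1 : ℕ), (e.2 : ℕ)] else []

theorem InputLists.row_bag (x : InputLists D H) (t : Fin q) :
    x.row t = (x.bags t).map Fin.val := by
  simp [InputLists.row]

theorem InputLists.row_sub (x : InputLists D H) (j : Fin p) :
    x.row (q + 1 + j) = (x.subVerts j).map Fin.val := by
  have h1 : ¬ q + 1 + (j : ℕ) < q := by omega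
  have h2 : q + 1 + (j : ℕ) - (q + 1) = j := by omega
  have h3 : q + 1 + (j : ℕ) - (q + 1) < p ∧ q < q + 1 + j := by omega
  rw [InputLists.row, dif_neg h1, dif_pos h3]
  simp [h2]

theorem InputLists.row_empty (x : InputLists D H) : x.row q = [] := by
  simp [InputLists.row]

theorem InputLists.row_lt (x : InputLists D H) (ρ : ℕ) : ∀ v ∈ x.row ρ, v < n := by
  intro v hv
  unfold InputLists.row at hv
  split_ifs at hv
  · obtain ⟨u, -, rfl⟩ := List.mem_map.1 hv; exact u.isLt
  · obtain ⟨u, -, rfl⟩ := List.mem_map.1 hv; exact u.isLt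
  · simp at hv

theorem InputLists.length_row_le (x : InputLists D H) (ρ : ℕ) : (x.row ρ).length ≤ n := by
  unfold InputLists.row
  split_ifs with h1 h2
  · simpa using (x.bags_spec ⟨ρ, h1⟩).1.length_le_card
  · simpa using (x.subVerts_spec ⟨ρ - (q + 1), h2.1⟩).1.length_le_card
  · simp

theorem InputLists.even_length_ends (x : InputLists D H) (j : ℕ) : Even (x.ends j).length := by
  unfold InputLists.ends
  split_ifs with h
  · rw [length_flatMap_pair]; exact ⟨_, rfl⟩
  · simp

theorem flatMap_finRange {α : Type*} (q : ℕ) (f : Fin q → List α) (g : ℕ → List α)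
    (h : ∀ t : Fin q, f t = g t) : (List.finRange q).flatMap f = (List.range q).flatMap g := by
  rw [← List.map_coe_finRange_eq_range, List.flatMap_map]
  congr 1
  funext t
  exact h t

theorem encodeVertices_eq (l : List (Fin n)) :
    encodeVertices l = l.length :: l.map Fin.val := by
  rw [List.map_eq_flatMap]
  simp [encodeVertices]

/-- The array `a` holds the encoded input; `te` is the position of the edges of the tree. -/
structure IsEncoded (x : InputLists D H) (a : ℕ → ℕ) (te : ℕ) : Prop where
  numVertices : a 0 = n
  numNodes : a 1 = q
  numMembers : a 2 = p
  numEdges : a 3 = x.edges.length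
  edges : HoldsAt a 4 (x.edges.flatMap fun e => [(e.1 : ℕ), (e.2 : ℕ)])
  te_eq : te = x.edges.length + x.edges.length + 5
  numTreeEdges : a (te - 1) = x.treeEdges.length
  treeEdges : HoldsAt a te (x.treeEdges.flatMap fun e => [(e.1 : ℕ), (e.2 : ℕ)])
  bags : HoldsAt a (te + x.treeEdges.length + x.treeEdges.length)
    ((List.range q).flatMap fun t => (x.row t).length :: x.row t)
  subs : HoldsAt a (te + x.treeEdges.length + x.treeEdges.length +
    ((List.range q).flatMap fun t => (x.row t).length :: x.row t).length)
    ((List.range p).flatMap fun j => ((x.row (q + 1 + j)).length :: x.row (q + 1 + j)) ++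
      (x.ends j).length / 2 :: x.ends j)

theorem InputLists.isEncoded (x : InputLists D H) {a : ℕ → ℕ}
    (ha : ∀ i, a i = x.encode.getD i 0) :
    IsEncoded x a (x.edges.length + x.edges.length + 5) := by
  have h : HoldsAt a 0 x.encode := by
    intro i hi
    rw [Nat.zero_add, ha, List.getD_eq_getElem _ _ hi]
  have hb : (List.finRange q).flatMap (fun t => encodeVertices (x.bags t)) =
      (List.range q).flatMap fun t => (x.row t).length :: x.row t :=
    flatMap_finRange q _ _ fun t => by
      rw [x.row_bag, encodeVertices_eq, List.length_map]
  have hs : (List.finRange p).flatMap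
      (fun j => encodeVertices (x.subVerts j) ++ encodeEdges (x.subEdges j)) =
      (List.range p).flatMap fun j => ((x.row (q + 1 + j)).length :: x.row (q + 1 + j)) ++
      (x.ends j).length / 2 :: x.ends j := by
    refine flatMap_finRange p _ _ fun j => ?_
    have h1 : x.ends j = (x.subEdges j).flatMap fun e => [(e.1 : ℕ), (e.2 : ℕ)] := by
      simp [InputLists.ends]
    have h2 : ((x.subEdges j).length + (x.subEdges j).length) / 2 = (x.subEdges j).length := by
      omega
    rw [x.row_sub, h1, length_flatMap_pair, h2]
    rw [encodeVertices_eq, encodeEdges, List.length_map]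
  rw [InputLists.encode, hb, hs] at h
  simp only [holdsAt_append, encodeEdges, holdsAt_cons, List.length_append, List.length_cons,
    List.length_nil, length_flatMap_pair] at h
  obtain ⟨⟨⟨⟨⟨h0, h1, h2, -⟩, h3, h4⟩, h5, h6⟩, h7⟩, h8⟩ := h
  refine ⟨h0, h1, h2, h3, h4, rfl, ?_, ?_, ?_, ?_⟩
  · rw [← h5]; congr 1; omega
  · convert h6 using 1; omega
  · convert h7 using 1; omega
  · convert h8 using 1; omega

variable {x : InputLists D H} {a : ℕ → ℕ} {te : ℕ}

theorem IsEncoded.joined_iff (h : IsEncoded x a te) {u v : ℕ} (hu : u < n) (hv : v < n) :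
    RAM.Joined (fun i => a (4 + i + i)) (fun i => a (5 + i + i)) x.edges.length u v ↔
      G.Adj ⟨u, hu⟩ ⟨v, hv⟩ := by
  have h1 : ∀ i (hi : i < x.edges.length), a (4 + i + i) = x.edges[i].1 ∧
      a (5 + i + i) = x.edges[i].2 := fun i hi => by
    have := h.edges.pairs i hi
    refine ⟨this.1, ?_⟩
    rw [← this.2]; congr 1; omega
  rw [← SimpleGraph.mem_edgeSet, ← x.edges_spec.2, List.mem_map]
  constructor
  · rintro ⟨i, hi, hor⟩
    refine ⟨x.edges[i], List.getElem_mem hi, ?_⟩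
    simp only [(h1 i hi).1, (h1 i hi).2] at hor
    rw [Sym2.eq_iff]
    simpa [Fin.ext_iff] using hor
  · rintro ⟨e, he, hor⟩
    obtain ⟨i, hi, rfl⟩ := List.getElem_of_mem he
    refine ⟨i, hi, ?_⟩
    simp only [(h1 i hi).1, (h1 i hi).2]
    rw [Sym2.eq_iff] at hor
    simpa [Fin.ext_iff] using hor

theorem IsEncoded.joined_lt (h : IsEncoded x a te) :
    ∀ i < x.edges.length, a (4 + i + i) < n ∧ a (5 + i + i) < n := by
  intro i hi
  have := h.edges.pairs i hi
  rw [this.1, show 5 + i + i = 4 + i + i + 1 by omega, this.2]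
  exact ⟨Fin.isLt _, Fin.isLt _⟩

end

theorem SimpleGraph.edist_le_add_one_iff {V : Type*} {G : SimpleGraph V} {u v : V} {l : ℕ} :
    G.edist u v ≤ (l + 1 : ℕ) ↔ G.edist u v ≤ l ∨ ∃ w, G.edist u w ≤ l ∧ G.Adj w v := by
  constructor
  · intro h
    by_cases hl : G.edist u v ≤ l
    · exact .inl hl
    right
    obtain ⟨W, hW⟩ := SimpleGraph.exists_walk_of_edist_ne_top
      (ne_top_of_le_ne_top (ENat.natCast_ne_top _) h)
    rw [← hW] at h hl
    have h1 : W.length ≤ l + 1 := by exact_mod_cast h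
    have h2 : ¬ W.length ≤ l := by exact_mod_cast hl
    refine ⟨W.getVert l, (SimpleGraph.edist_le (W.take l)).trans (by simp), ?_⟩
    have h3 := W.adj_getVert_succ (i := l) (by omega)
    rwa [show l + 1 = W.length by omega, W.getVert_length] at h3
  · rintro (h | ⟨w, h, hw⟩)
    · exact h.trans (by norm_cast; omega)
    · have h1 : G.edist w v ≤ 1 := SimpleGraph.edist_le_one_iff_adj_or_eq.2 (.inl hw)
      calc G.edist u v ≤ G.edist u w + G.edist w v := SimpleGraph.edist_triangle
        _ ≤ l + 1 := add_le_add h h1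
        _ = ((l + 1 : ℕ) : ℕ∞) := by norm_cast

section

variable {n q p : ℕ} {G : SimpleGraph (Fin n)} {D : TreeDecomposition G (Fin q)}
  {H : Fin p → G.Subgraph} {x : InputLists D H} {a : ℕ → ℕ} {te : ℕ}

theorem InputLists.mem_row_sub (x : InputLists D H) (j : Fin p) (v : Fin n) :
    (v : ℕ) ∈ x.row (q + 1 + j) ↔ v ∈ (H j).verts := by
  rw [x.row_sub, ← (x.subVerts_spec j).2]
  simp [Fin.val_inj]

theorem InputLists.mem_row_bag (x : InputLists D H) (t : Fin q) (v : Fin n) :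
    (v : ℕ) ∈ x.row t ↔ v ∈ D.bag t := by
  rw [x.row_bag, ← Finset.mem_coe, ← (x.bags_spec t).2]
  simp [Fin.val_inj]

theorem IsEncoded.stepReach_iff (h : IsEncoded x a te) (j : Fin p) (l : ℕ) {v : ℕ} (hv : v < n) :
    StepReach (· ∈ x.row (q + 1 + j))
      (RAM.Joined (fun i => a (4 + i + i)) (fun i => a (5 + i + i)) x.edges.length) l v ↔
      Near H j l ⟨v, hv⟩ := by
  induction l generalizing v with
  | zero =>
    refine (x.mem_row_sub j ⟨v, hv⟩).trans ?_
    simp [Near]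
  | succ l ih =>
    have hlt : ∀ u, RAM.Joined (fun i => a (4 + i + i)) (fun i => a (5 + i + i))
        x.edges.length u v → u < n := by
      rintro u ⟨i, hi, ⟨rfl, -⟩ | ⟨-, rfl⟩⟩
      · exact (h.joined_lt i hi).1
      · exact (h.joined_lt i hi).2
    change _ ∨ _ ↔ _
    simp only [Near, SimpleGraph.edist_le_add_one_iff]
    constructor
    · rintro (h1 | ⟨u, h1, h2⟩)
      · obtain ⟨y, hy, hyv⟩ := (ih hv).1 h1
        exact ⟨y, hy, .inl hyv⟩
      · obtain ⟨y, hy, hyu⟩ := (ih (hlt u h2)).1 h1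
        exact ⟨y, hy, .inr ⟨_, hyu, (h.joined_iff (hlt u h2) hv).1 h2⟩⟩
    · rintro ⟨y, hy, hyv | ⟨u, hyu, huv⟩⟩
      · exact .inl ((ih hv).2 ⟨y, hy, hyv⟩)
      · exact .inr ⟨u, (ih u.isLt).2 ⟨y, hy, hyu⟩, (h.joined_iff u.isLt hv).2 huv⟩

end

/-! ### The algorithm -/

namespace RAM

variable {n q p : ℕ} {G : SimpleGraph (Fin n)} {D : TreeDecomposition G (Fin q)}
  {H : Fin p → G.Subgraph} {x : InputLists D H}

/-- Reads the input and computes all distances. -/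
def measure : Program := .seq setup (.seq loadRows distances)

/-- The distances are correct below the limit `d`: the entry for `j` and row `ρ` is at most `y` if
and only if row `ρ` contains a vertex at distance at most `y` from subgraph `j`. -/
theorem halts_measure {s : State} {d te : ℕ} (hx : IsEncoded x (s.nat 0) te)
    (hd : s.nat LIMIT 0 = d) (hM : s.nat MUL 0 = 0) (hI : ∀ i, s.nat INC i = 0) :
    Halts measure s (40 * (n + q + p + 3) + (100 * ((q + p + 2) * (n + 2)) +
      500 * ((p + 1) * ((d + 1) * (x.edges.length + n + 2) + (q + p + 2) * (n + 2))))) fun s' =>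
      s'.nat BASE 0 = p + 1 ∧ s'.nat TEDGES 0 = te ∧
      (∀ y ≤ n + q + p + 2, s'.nat MUL y = y * (n + q + p + 2)) ∧
      ∀ j : Fin p, ∀ ρ < q + 1 + p, ∀ y < d, s'.nat DIST (j * (n + q + p + 2) + ρ) ≤ y ↔
        ∃ v : Fin n, (v : ℕ) ∈ x.row ρ ∧ Near H j y v := by
  refine Halts.seq (halts_setup hx.numVertices hx.numNodes hx.numMembers hM) fun s₁ hs₁ h₁ =>
    Halts.seq (halts_loadRows (n := n) (q := q) (p := p) (R := x.row) (E := x.ends)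
      (pos := te + x.treeEdges.length + x.treeEdges.length) rfl ?_ ?_ h₁.2.2
      ?_ ?_ ?_ ?_ x.even_length_ends x.row_lt x.length_row_le x.row_empty) fun s₂ hs₂ h₂ =>
    (halts_distances (d := d) (R := fun ρ v => v ∈ x.row ρ) rfl ?_ ?_ ?_ ?_ ?_
      (eu := fun i => s.nat 0 (4 + i + i)) (ev := fun i => s.nat 0 (5 + i + i)) ?_ ?_
      (fun i hi => (hx.joined_lt i hi).1) (fun i hi => (hx.joined_lt i hi).2) ?_ ?_).mono le_rfl
      fun s₃ hs₃ h₃ => ⟨?_, ?_, ?_, fun j ρ hρ y hy => ?_⟩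
  all_goals have e1 : s₁.nat 0 = s.nat 0 := hs₁.nat 0 (by decide)
  · rw [e1, hx.numNodes]
  · rw [e1, hx.numMembers]
  · intro i; rw [hs₁.nat INC (by decide), hI]
  · have h1 := hx.te_eq
    have h2 := hx.numTreeEdges
    rw [e1, hx.numEdges, show x.edges.length + x.edges.length + 4 = te - 1 by omega, h2]
    omega
  · rw [e1]; exact hx.bags
  · rw [e1]; exact hx.subs
  all_goals have e2 : s₂.nat 0 = s.nat 0 := (hs₂.nat 0 (by decide)).trans e1
  · rw [hs₂.nat LIMIT (by decide), hs₁.nat LIMIT (by decide), hd]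
  · rw [e2, hx.numVertices]
  · rw [e2, hx.numNodes]
  · rw [e2, hx.numMembers]
  · rw [e2, hx.numEdges]
  · intro i _; rw [e2]
  · intro i _; rw [e2]
  · rw [hs₂.nat MUL (by decide)]; exact h₁.2.2
  · intro ρ hρ v hv
    rw [h₂.2 ρ v (by omega)]
    exact ⟨fun h => h.2, fun h => ⟨hρ, h⟩⟩
  · rw [hs₃.nat BASE (by decide), hs₂.nat BASE (by decide), h₁.2.1]
  · rw [hs₃.nat TEDGES (by decide), h₂.1, e1, hx.numEdges, hx.te_eq]
  · rw [hs₃.nat MUL (by decide), hs₂.nat MUL (by decide)]; exact h₁.2.2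
  · rw [h₃ j j.isLt ρ hρ y hy]
    constructor
    · rintro ⟨v, hv, h1, h2⟩
      exact ⟨⟨v, hv⟩, h1, (hx.stepReach_iff j y hv).1 h2⟩
    · rintro ⟨v, h1, h2⟩
      exact ⟨v, v.isLt, h1, (hx.stepReach_iff j y v.isLt).2 h2⟩

/-- Computes the tables for codes. -/
def tabulateCodes : Program := .seq countCodes (.seq digitTables (.seq rowTable badCodes))

theorem halts_tabulateCodes {s : State} {p k q d N : ℕ} {cf : ℕ → ℕ → Prop} (hp : 0 < p)
    (hb : s.nat BASE 0 = p + 1) (hk : s.nat WIDTH 0 = k) (hq : s.nat 0 1 = q)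
    (hd : s.nat LIMIT 0 = d) (hMUL : ∀ y < p, s.nat MUL y = y * N)
    (hcf : ∀ a < p, ∀ b < p, s.nat DIST (a * N + (q + 1 + b)) + 1 ≤ d ↔ cf a b)
    (hz : ∀ a ∈ [PREF, LAST, MULB, MULK, BAD], ∀ i, s.nat a i = 0) :
    Halts tabulateCodes s (100 * ((k + 1) * (p + 1 + 2)) + (100 * ((p + 1) ^ k + 1) +
      (60 * (q + 2) + 100 * ((p + 1) ^ k + 1)))) fun s' =>
      s'.nat CODES 0 = (p + 1) ^ k ∧
      (∀ c < (p + 1) ^ k, s'.nat PREF c = c / (p + 1) ∧ s'.nat LAST c = c % (p + 1) ∧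
        s'.nat MULB c = c * (p + 1)) ∧
      (∀ t ≤ q + 1, s'.nat MULK t = t * (p + 1) ^ k) ∧
      ∀ c < (p + 1) ^ k, s'.nat BAD c = 0 ↔ GoodCode cf (p + 1) c := by
  refine Halts.seq (halts_countCodes hb hk) fun s₁ hs₁ h₁ =>
    Halts.seq (halts_digitTables (b := p + 1) ?_ (Nat.succ_pos p) h₁ ?_ ?_ ?_) fun s₂ hs₂ h₂ =>
    Halts.seq (halts_rowTable (q := q) (K := (p + 1) ^ k) ?_ ?_ ?_) fun s₃ hs₃ h₃ =>
    (halts_badCodes (q := q) (d := d) (N := N) (cf := cf) (K := (p + 1) ^ k) hp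
      ?_ ?_ ?_ ?_ ?_ ?_ ?_).mono le_rfl fun s₄ hs₄ h₄ => ⟨?_, ?_, ?_, h₄⟩
  · rw [hs₁.nat BASE (by decide), hb]
  · rw [hs₁.nat PREF (by decide), hz _ (by decide)]
  · rw [hs₁.nat LAST (by decide), hz _ (by decide)]
  · rw [hs₁.nat MULB (by decide), hz _ (by decide)]
  · rw [hs₂.nat 0 (by decide), hs₁.nat 0 (by decide), hq]
  · rw [hs₂.nat CODES (by decide), h₁]
  · rw [hs₂.nat MULK (by decide), hs₁.nat MULK (by decide), hz _ (by decide)]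
  · rw [hs₃.nat 0 (by decide), hs₂.nat 0 (by decide), hs₁.nat 0 (by decide), hq]
  · rw [hs₃.nat LIMIT (by decide), hs₂.nat LIMIT (by decide), hs₁.nat LIMIT (by decide), hd]
  · rw [hs₃.nat CODES (by decide), hs₂.nat CODES (by decide), h₁]
  · rw [hs₃.nat MUL (by decide), hs₂.nat MUL (by decide), hs₁.nat MUL (by decide)]
    exact hMUL
  · rw [hs₃.nat PREF (by decide), hs₃.nat LAST (by decide), hs₃.nat MULB (by decide)]
    exact h₂
  · rw [hs₃.nat DIST (by decide), hs₂.nat DIST (by decide), hs₁.nat DIST (by decide)]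
    exact hcf
  · rw [hs₃.nat BAD (by decide), hs₂.nat BAD (by decide), hs₁.nat BAD (by decide)]
    exact hz _ (by decide)
  · rw [hs₄.nat CODES (by decide), hs₃.nat CODES (by decide), hs₂.nat CODES (by decide), h₁]
  · rw [hs₄.nat PREF (by decide), hs₄.nat LAST (by decide), hs₄.nat MULB (by decide),
      hs₃.nat PREF (by decide), hs₃.nat LAST (by decide), hs₃.nat MULB (by decide)]
    exact h₂
  · rw [hs₄.nat MULK (by decide)]; exact h₃

/-- The case `a = b` in `Conflict` is covered by the distance, as no subgraph is empty. -/
theorem conflict_iff {d : ℕ} (hd : 0 < d) (hH : ∀ j, (H j).Connected) {a b : ℕ} (ha : a < p)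
    (hb : b < p) :
    Conflict d H a b ↔ setDist G (H ⟨a, ha⟩).verts (H ⟨b, hb⟩).verts < d := by
  constructor
  · rintro (rfl | ⟨_, _, h⟩)
    · obtain ⟨v, hv⟩ := (hH ⟨a, ha⟩).nonempty
      rw [setDist_lt_iff]
      exact ⟨v, hv, v, hv, by simpa using hd⟩
    · exact h
  · exact fun h => .inr ⟨ha, hb, h⟩

/-- Computes all tables that the dynamic program reads. -/
def prepare : Program := .seq measure (.seq tabulateCodes eliminationOrder)

theorem halts_prepare {s : State} {r k te : ℕ} {par depth : ℕ → ℕ}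
    (hx : IsEncoded x (s.nat 0) te) (hp : 0 < p) (hq : 0 < q) (hH : ∀ j, (H j).Connected)
    (hpar : IsParentFunction D.tree 0 par depth)
    (hd : s.nat LIMIT 0 = 2 * r + 2) (hr : s.nat RADIUS 0 = r) (hk : s.nat WIDTH 0 = k)
    (hz : ∀ a ∈ [MUL, INC, PREF, LAST, MULB, MULK, BAD, DEG, SUM], ∀ i, s.nat a i = 0) :
    Halts prepare s ((40 * (n + q + p + 3) + (100 * ((q + p + 2) * (n + 2)) +
      500 * ((p + 1) * ((2 * r + 2 + 1) * (x.edges.length + n + 2) + (q + p + 2) * (n + 2))))) +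
      ((100 * ((k + 1) * (p + 1 + 2)) + (100 * ((p + 1) ^ k + 1) +
      (60 * (q + 2) + 100 * ((p + 1) ^ k + 1)))) +
      (100 * (x.treeEdges.length + 2) + 200 * (q + 2)))) fun s' =>
      IsLeafOrder q par (s'.nat QUEUE) ∧
      IsPrepared p k q r (n + q + p + 2) (Conflict (2 * r + 2) H) (Meets r D H) (s'.nat QUEUE)
        (fun i => par (s'.nat QUEUE i)) s' := by
  set N := n + q + p + 2 with hN
  refine Halts.seq (halts_measure hx hd (hz _ (by decide) 0) (hz _ (by decide)))
    fun s₁ hs₁ h₁ => Halts.seq (halts_tabulateCodes (k := k) (q := q) (d := 2 * r + 2) (N := N)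
      (cf := Conflict (2 * r + 2) H) hp h₁.1 ?_ ?_ ?_ (fun y hy => h₁.2.2.1 y (by omega)) ?_ ?_)
    fun s₂ hs₂ h₂ => (halts_eliminationOrder (te := te) hpar x.treeEdges_spec hq ?_ ?_ ?_ ?_ ?_
      ?_).mono le_rfl fun s₃ hs₃ h₃ => ⟨h₃.1, ?_⟩
  · rw [hs₁.nat WIDTH (by decide), hk]
  · rw [hs₁.nat 0 (by decide), hx.numNodes]
  · rw [hs₁.nat LIMIT (by decide), hd]
  · intro a ha b hb
    rw [conflict_iff (by omega) hH ha hb,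
      Nat.add_le_add_iff_right (n := 1) (m := _) (k := 2 * r + 1),
      h₁.2.2.2 ⟨a, ha⟩ (q + 1 + b) (by omega) (2 * r + 1) (by omega), setDist_lt_iff]
    have hlt : ∀ u v, G.edist u v < (2 * r + 2 : ℕ) ↔ G.edist u v ≤ (2 * r + 1 : ℕ) := by
      intro u v
      exact ENat.lt_natCast_add_one_iff (m := G.edist u v) (n := 2 * r + 1)
    simp only [x.mem_row_sub ⟨b, hb⟩, Near, hlt]
    constructor
    · rintro ⟨v, hv, u, hu, huv⟩
      exact ⟨u, hu, v, hv, huv⟩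
    · rintro ⟨u, hu, v, hv, huv⟩
      exact ⟨v, hv, u, hu, huv⟩
  · intro a ha i
    rw [hs₁.nat a (by revert a; decide), hz a (by revert a; decide)]
  all_goals have e1 : s₂.nat 0 = s.nat 0 := (hs₂.nat 0 (by decide)).trans (hs₁.nat 0 (by decide))
  · rw [e1, hx.numNodes]
  · rw [hs₂.nat TEDGES (by decide), h₁.2.1]
  · rw [e1, hx.numTreeEdges]
  · rw [e1]; exact hx.treeEdges
  · rw [hs₂.nat DEG (by decide), hs₁.nat DEG (by decide)]; exact hz _ (by decide)
  · rw [hs₂.nat SUM (by decide), hs₁.nat SUM (by decide)]; exact hz _ (by decide)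
  have e2 : s₃.nat 0 = s.nat 0 := (hs₃.nat 0 (by decide)).trans e1
  refine ⟨?_, ?_, ?_, ?_, ?_, ?_, ?_, ?_, ?_, fun _ _ => rfl, h₃.2⟩
  · rw [e2, hx.numNodes]
  · rw [e2, hx.numMembers]
  · rw [hs₃.nat CODES (by decide), h₂.1]
  · rw [hs₃.nat RADIUS (by decide), hs₂.nat RADIUS (by decide), hs₁.nat RADIUS (by decide), hr]
  · rw [hs₃.nat MUL (by decide), hs₂.nat MUL (by decide)]
    exact fun y hy => h₁.2.2.1 y (by omega)
  · rw [hs₃.nat PREF (by decide), hs₃.nat LAST (by decide), hs₃.nat MULB (by decide)]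
    exact h₂.2.1
  · rw [hs₃.nat MULK (by decide)]; exact h₂.2.2.1
  · rw [hs₃.nat BAD (by decide)]; exact h₂.2.2.2
  · intro j hj t ht
    rw [hs₃.nat DIST (by decide), hs₂.nat DIST (by decide),
      h₁.2.2.2 ⟨j, hj⟩ t (by omega) r (by omega)]
    rcases Nat.lt_or_eq_of_le ht with htq | rfl
    · simp only [x.mem_row_bag ⟨t, htq⟩]
      exact ⟨fun ⟨v, hv, h⟩ => ⟨htq, hj, v, hv, h⟩, fun ⟨_, _, v, hv, h⟩ => ⟨v, hv, h⟩⟩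
    · rw [x.row_empty]
      exact iff_of_false (by simp) fun h => absurd h.1 (lt_irrefl t)

/-- Solves the problem for distance `2 * r + 2` and independence number at most `k`. -/
def maxWeightPacking (r k : ℕ) : Program :=
  .seq (.seq (setVar LIMIT (.const (2 * r + 2)))
    (.seq (setVar RADIUS (.const r)) (setVar WIDTH (.const k)))) <|
  .branch (.natEq (rd 0 2) 0) .skip (.seq prepare selectPacking)

end RAM

/-- A tree has fewer edges than nodes. -/
theorem length_treeEdges_le {q : ℕ} {T : SimpleGraph (Fin q)} {root : ℕ} {par depth : ℕ → ℕ}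
    (hp : IsParentFunction T root par depth) {l : List (Fin q × Fin q)}
    (hl : ListsEdges T.edgeSet l) : l.length ≤ q := by
  have h := hp.sum_edges hl (fun _ _ => 1) (fun _ _ => rfl)
  have h2 := Finset.card_filter_le (Finset.range q) (· ≠ root)
  simp at h h2
  omega

theorem ListsEdges.length_le {n : ℕ} {G : SimpleGraph (Fin n)} {l : List (Fin n × Fin n)}
    (h : ListsEdges G.edgeSet l) : l.length ≤ n * n := by
  have h1 : l.Nodup := h.1.of_map _
  simpa using h1.length_le_card

/-- The sum of the time bounds of all parts of the program. -/
theorem time_le {n q p m l r k : ℕ} (hn : 0 < n) (hq : 0 < q) (hp : 0 < p) (hm : m ≤ n * n)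
    (hl : l ≤ q) :
    (40 * (n + q + p + 3) + (100 * ((q + p + 2) * (n + 2)) +
      500 * ((p + 1) * ((2 * r + 2 + 1) * (m + n + 2) + (q + p + 2) * (n + 2))))) +
      ((100 * ((k + 1) * (p + 1 + 2)) + (100 * ((p + 1) ^ k + 1) +
      (60 * (q + 2) + 100 * ((p + 1) ^ k + 1)))) +
      (100 * (l + 2) + 200 * (q + 2))) +
      1100 * ((p + 2) * ((q + 1) * ((p + 1) ^ k + 1))) + 100 ≤
    (100000 * (r + k + 2 ^ k + 1)) * (p * n * ((p + q + n) + p ^ (k + 1) * q)) := by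
  set P := p ^ k with hP
  set B := p * n * ((p + q + n) + p ^ (k + 1) * q) with hB
  have hP0 : 1 ≤ P := Nat.one_le_pow _ _ hp
  have hpn : 1 ≤ p * n := Nat.mul_pos hp hn
  have hK : (p + 1) ^ k + 1 ≤ 2 * (2 ^ k * P) := by
    have h1 : (p + 1) ^ k ≤ (2 * p) ^ k := Nat.pow_le_pow_left (by omega) k
    have h2 : 1 ≤ 2 ^ k * P := Nat.mul_pos (by positivity) hP0
    rw [mul_pow, ← hP] at h1
    omega
  -- Every term is at most a constant times one of `p * n * (p + q + n)` and `p * q * P`.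
  have b1 : p * n * (p + q + n) ≤ B := Nat.mul_le_mul_left _ (Nat.le_add_right _ _)
  have b2 : p * q * P ≤ B := by
    calc p * q * P ≤ (p * n) * (p * q * P) := Nat.le_mul_of_pos_left _ hpn
      _ = p * n * (p ^ (k + 1) * q) := by rw [pow_succ]; ring
      _ ≤ B := Nat.mul_le_mul_left _ (Nat.le_add_left _ _)
  have b3 : p + q + n ≤ B := (Nat.le_mul_of_pos_left _ hpn).trans b1
  have b4 : (q + p + 2) * (n + 2) ≤ 6 * (n * (p + q + n)) := by
    calc (q + p + 2) * (n + 2) ≤ (2 * (p + q + n)) * (3 * n) :=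
          Nat.mul_le_mul (by omega) (by omega)
      _ = 6 * (n * (p + q + n)) := by ring
  have b5 : n * (p + q + n) ≤ B := by
    refine le_trans ?_ b1
    rw [Nat.mul_assoc]
    exact Nat.le_mul_of_pos_left _ hp
  have b6 : (p + 1) * ((q + p + 2) * (n + 2)) ≤ 12 * B := by
    calc (p + 1) * ((q + p + 2) * (n + 2)) ≤ (2 * p) * (6 * (n * (p + q + n))) :=
          Nat.mul_le_mul (by omega) b4
      _ = 12 * (p * n * (p + q + n)) := by ring
      _ ≤ 12 * B := Nat.mul_le_mul_left _ b1
  have b7 : (p + 1) * ((2 * r + 2 + 1) * (m + n + 2)) ≤ (16 * r + 24) * B := by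
    have h1 : m + n + 2 ≤ 4 * (n * n) := by nlinarith
    calc (p + 1) * ((2 * r + 2 + 1) * (m + n + 2)) ≤ (2 * p) * ((2 * r + 3) * (4 * (n * n))) :=
          Nat.mul_le_mul (by omega) (Nat.mul_le_mul (by omega) h1)
      _ = (16 * r + 24) * (p * n * n) := by ring
      _ ≤ (16 * r + 24) * B := Nat.mul_le_mul_left _
          (le_trans (Nat.mul_le_mul_left _ (by omega)) b1)
  have b8 : (k + 1) * (p + 1 + 2) ≤ (4 * k + 4) * B := by
    calc (k + 1) * (p + 1 + 2) ≤ (k + 1) * (4 * B) := Nat.mul_le_mul_left _ (by omega)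
      _ = (4 * k + 4) * B := by ring
  have b9 : 2 ^ k * P ≤ 2 ^ k * B := by
    refine Nat.mul_le_mul_left _ (le_trans ?_ b2)
    exact Nat.le_mul_of_pos_left _ (Nat.mul_pos hp hq)
  have b10 : (p + 2) * ((q + 1) * ((p + 1) ^ k + 1)) ≤ 12 * (2 ^ k * B) := by
    calc (p + 2) * ((q + 1) * ((p + 1) ^ k + 1)) ≤ (3 * p) * ((2 * q) * (2 * (2 ^ k * P))) :=
          Nat.mul_le_mul (by omega) (Nat.mul_le_mul (by omega) hK)
      _ = 12 * (2 ^ k * (p * q * P)) := by ring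
      _ ≤ 12 * (2 ^ k * B) := by gcongr
  have e1 : (16 * r + 24) * B = 16 * (r * B) + 24 * B := by ring
  have e2 : (4 * k + 4) * B = 4 * (k * B) + 4 * B := by ring
  have e3 : (100000 * (r + k + 2 ^ k + 1)) * B =
      100000 * (r * B) + 100000 * (k * B) + 100000 * (2 ^ k * B) + 100000 * B := by ring
  rw [e1] at b7
  rw [e2] at b8
  rw [e3, Nat.mul_add (p + 1)]
  omega

namespace RAM

theorem halts_maxWeightPacking {n q p : ℕ} {G : SimpleGraph (Fin n)}
    {D : TreeDecomposition G (Fin q)} {H : Fin p → G.Subgraph} (w : Fin p → ℚ≥0)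
    (x : InputLists D H) {r k : ℕ} (hk : D.indepNumber ≤ k) (hH : ∀ j, (H j).Connected) :
    Halts (maxWeightPacking r k) (x.initialState w)
      ((100000 * (r + k + 2 ^ k + 1)) * (p * n * ((p + q + n) + p ^ (k + 1) * q)) + 100)
      fun s' => IsMaxWeightDistPacking (2 * r + 2) H w (s'.output p) := by
  set s := x.initialState w with hs
  set s₀ := (Program.seq (setVar LIMIT (.const (2 * r + 2)))
    (.seq (setVar RADIUS (.const r)) (setVar WIDTH (.const k)))).exec s with hs₀
  have hx : IsEncoded x (s₀.nat 0) (x.edges.length + x.edges.length + 5) := by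
    refine x.isEncoded fun i => ?_
    simp [hs₀, hs, InputLists.initialState]
  have hz : ∀ a ∈ [MUL, INC, PREF, LAST, MULB, MULK, BAD, DEG, SUM, OUT], ∀ i,
      s₀.nat a i = 0 := by
    intro a ha i
    simp only [List.mem_cons, List.not_mem_nil, or_false] at ha
    rcases ha with rfl | rfl | rfl | rfl | rfl | rfl | rfl | rfl | rfl | rfl <;>
    simp [hs₀, hs, InputLists.initialState]
  have hw : ∀ j : Fin p, s₀.rat 0 j = w j := by
    intro j
    simp [hs₀, hs, InputLists.initialState]
  have e2 : s.nat 0 2 = p := by simpa [hs₀] using hx.numMembers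
  -- An empty family is a case of its own, since then `n` and `q` may be zero.
  rcases Nat.eq_zero_or_pos p with rfl | hp
  · refine (Halts.exec_seq (T := 5 + 1 + 1) rfl ?_).mono (by simp) fun _ _ h => h
    refine ⟨_, _, .branch_true ?_ (.skip _), by simp, fun i => i.elim0, fun I _ => ?_⟩
    · simpa using e2
    · rw [Finset.eq_empty_of_isEmpty I]; simp
  have hn : 0 < n := by
    obtain ⟨v, -⟩ := (hH ⟨0, hp⟩).nonempty
    exact v.pos
  have hq : 0 < q := by
    obtain ⟨t, -⟩ := D.vertex_mem ⟨0, hn⟩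
    exact t.pos
  obtain ⟨par, depth, hpar⟩ := D.isTree.exists_isParentFunction ⟨0, hq⟩
  have hw0 : ∀ j < p, 0 ≤ s₀.rat 0 j := by
    intro j hj
    rw [hw ⟨j, hj⟩]
    exact (w ⟨j, hj⟩).2
  have hT := time_le (r := r) (k := k) hn hq hp x.edges_spec.length_le
    (length_treeEdges_le hpar x.treeEdges_spec)
  refine (Halts.exec_seq rfl (Halts.branch (fun h => absurd h ?_) fun _ =>
    Halts.seq (halts_prepare (r := r) (k := k) hx hp hq hH hpar ?_ ?_ ?_ fun a ha =>
      hz a (by revert a; decide)) fun s₁ hs₁ h₁ =>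
    (halts_selectPacking h₁.2 (h₁.1.eliminationScheme D H hk hH hpar) (w := s₀.rat 0)
      ?_ hw0 ?_).mono le_rfl fun s₂ _ h₂ => ?_)).mono ?_ fun _ _ h => h
  · simp [e2]; omega
  · simp
  · simp
  · simp
  · intro j _; rw [hs₁.rat 0 (by decide)]
  · rw [hs₁.nat OUT (by decide)]; exact hz _ (by decide)
  · obtain ⟨hcf, hmax⟩ := h₂
    have hsum : ∀ I : Finset (Fin p),
        ∑ j ∈ I.map Fin.valEmbedding, s₀.rat 0 j = ((∑ j ∈ I, w j : ℚ≥0) : ℚ) := by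
      intro I
      rw [Finset.sum_map]
      push_cast
      exact Finset.sum_congr rfl fun j _ => hw j
    have hout : (Finset.range p).filter (fun j => s₂.nat OUT j = 1) =
        (s₂.output p).map Fin.valEmbedding := by
      ext j
      simp only [State.output, Finset.mem_filter, Finset.mem_range, Finset.mem_map,
        Finset.mem_univ, true_and]
      constructor
      · rintro ⟨hj, h⟩
        exact ⟨⟨j, hj⟩, h, rfl⟩
      · rintro ⟨i, h, rfl⟩
        exact ⟨i.isLt, h⟩
    have hpack : ∀ I : Finset (Fin p), IsDistPacking (2 * r + 2) H I ↔
        IsConflictFree (Conflict (2 * r + 2) H) (I.map Fin.valEmbedding) := by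
      intro I
      constructor
      · intro h a ha b hb hab
        obtain ⟨i, hi, rfl⟩ := Finset.mem_map.1 ha
        obtain ⟨j, hj, rfl⟩ := Finset.mem_map.1 hb
        rintro (h' | ⟨_, _, h'⟩)
        · exact hab h'
        · exact absurd h' (not_lt.2 (h i hi j hj fun h'' => hab (by rw [h''])))
      · intro h i hi j hj hij
        by_contra hlt
        exact h i (Finset.mem_map_of_mem _ hi) j (Finset.mem_map_of_mem _ hj)
          (fun h' => hij (Fin.ext h')) (.inr ⟨i.isLt, j.isLt, not_le.1 hlt⟩)
    rw [hout] at hcf hmax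
    refine ⟨(hpack _).2 hcf, fun I hI => ?_⟩
    have := hmax.le (I.map Fin.valEmbedding) (by simp) ((hpack I).1 hI)
    rw [hsum, hsum] at this
    exact_mod_cast this
  · refine le_trans ?_ (Nat.add_le_add_right hT 100)
    simp only [Program.cost, Test.cost, NatExpr.cost]
    have key : ∀ T : ℕ, 1 + 1 + 1 + (1 + 1 + 1 + (1 + 1 + 1)) + (1 + 1 + 1 + 1 + T + 1) ≤
      T + 100 + 100 := fun T => by omega
    exact key _

end RAM

theorem mainTheorem3 (d k : ℕ) (hd : Even d) (hd_pos : 0 < d) (hk : 1 ≤ k) :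
    ∃ (P : RAM.Program) (C : ℕ),
      ∀ (n q p : ℕ) (G : SimpleGraph (Fin n)) (D : TreeDecomposition G (Fin q))
        (H : Fin p → G.Subgraph) (w : Fin p → ℚ≥0) (x : InputLists D H),
        D.indepNumber ≤ k → (∀ j, (H j).Connected) →
        ∃ (t : ℕ) (s : RAM.State),
          RAM.Runs P (x.initialState w) t s ∧
          t ≤ C * ((n + q) * G.edgeSet.ncard
                + p * n * ((p + q + n) + p ^ (k + 1) * q) + 1) ∧
          IsMaxWeightDistPacking d H w (s.output p) := by
  obtain ⟨r, rfl⟩ : ∃ r, d = 2 * r + 2 := by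
    obtain ⟨e, rfl⟩ := hd
    exact ⟨e - 1, by omega⟩
  refine ⟨RAM.maxWeightPacking r k, 100000 * (r + k + 2 ^ k + 1), ?_⟩
  intro n q p G D H w x hDk hH
  obtain ⟨t, s, hrun, ht, hs⟩ := RAM.halts_maxWeightPacking w x (r := r) hDk hH
  refine ⟨t, s, hrun, ht.trans ?_, hs⟩
  set B := p * n * ((p + q + n) + p ^ (k + 1) * q)
  have h1 : 100 ≤ 100000 * (r + k + 2 ^ k + 1) :=
    le_trans (by norm_num : 100 ≤ 100000 * 1) (Nat.mul_le_mul_left _ (Nat.le_add_left _ _))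
  calc 100000 * (r + k + 2 ^ k + 1) * B + 100
      ≤ 100000 * (r + k + 2 ^ k + 1) * B + 100000 * (r + k + 2 ^ k + 1) * 1 :=
        Nat.add_le_add_left (by rwa [Nat.mul_one]) _
    _ = 100000 * (r + k + 2 ^ k + 1) * (B + 1) := (Nat.mul_add _ _ _).symm
    _ ≤ _ := Nat.mul_le_mul_left _ (by omega)
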